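/- **Setting.** For every $n$ let $\mathcal C_n\{\rho\}=U_1\cdots U_d\,\rho\,U_d^\dagger\cdots U_1^\dagger$ be an ideal circuit on $n$ qubits with $d=d(n)$ layers, each layer $U_t$ consisting of arbitrary two-qubit unitary gates on pairwise disjoint pairs of qubits. Let $O_n$ be a Hermitian observable with $2^{-n}\operatorname{tr}(O_n^\dagger O_n)=1$, and let $\mathcal E_n$ be a finite nonempty ensemble of $n$-qubit density matrices that is low-average: $\big\|\frac1{|\mathcal E_n|}\sum_{\rho\in\mathcal E_n}\rho\big\|_\infty\le c/2^n$ with $c$ independent of $n$. The noisy implementation at noise rate $\gamma$ is $$\mathcal C_{n,\gamma}\{\rho\}=\mathcal D_0\{U_1\,\mathcal D_1\{\cdots U_d\,\mathcal D_d\{\rho\}\,U_d^\dagger\cdots\}\,U_1^\dagger\},$$ where $\mathcal D_t$ applies the single-qubit depolarizing channel $\rho\mapsto e^{-\gamma}\rho+(1-e^{-\gamma})\,\tfrac{\mathbb 1_j}{2}\otimes\operatorname{tr}_j\rho$ to every qubit $j$ that takes part in a gate of layer $t$ (gate-based noise), and $\mathcal D_0$ applies it to all qubits (read-out noise). For $\varepsilon(n)>0$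 say that the noisy implementation *succeeds to error* $\delta$ at $(n,\gamma)$ if $$\Big(\tfrac1{|\mathcal E_n|}\sum_{\rho\in\mathcal E_n}\big|\operatorname{tr}(\mathcal C_{n,\gamma}\{\rho\}O_n)-\operatorname{tr}(\mathcal C_n\{\rho\}O_n)\big|^2\Big)^{1/2}\le\delta .$$ A *classical algorithm* is one program, the same for all $n$, for a random access machine with unit-cost exact real arithmetic and unit-cost addition, (truncated) subtraction and comparison of natural numbers. It can read at unit cost $n$, the description of the circuit (depth, gate positions, gate matrix entries), the Pauli coefficients $2^{-n}\operatorname{tr}(O_nP)$ and $\operatorname{tr}(\rho P)$, and natural-number parameters (such as truncation thresholds) that depend only on $n$ and are bounded by a polynomial in $n$. It computes the ideal expectation values to root-mean-square error $\varepsilon(n)$ in time $T(n)$ if, for every $n$, on every $\rho\in\mathcal E_n$ it halts within $T(n)$ steps, and the root mean square over $\rho\in\mathcal E_n$ of (output $-\operatorname{tr}(\mathcal C_n\{\rho\}O_n)$) is at most $\varepsilon(n)$. **Statement.** Let $a\in\mathbb N$ and $\Gamma\in\mathbb R$. There is a constant $K>0$, depending only on $a$ and $\Gamma$, such that the following holds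 for all families as above, all $\varepsilon(n)>0$, all $\chi:\mathbb N\to\mathbb R$ and every fixed $\theta<1$. Suppose that $d(n)\le n^a$ and $1/\varepsilon(n)\le n^a$ for all large $n$, and that every classical algorithm which computes $\operatorname{tr}(\mathcal C_n\{\rho\}O_n)$ to root-mean-square error $\varepsilon(n)$ in some time $T(n)$ satisfies $\chi(n)=O(T(n))$. 1. For all large $n$ with $\chi(n)>1$: if the noisy implementation succeeds to error $\theta\,\varepsilon(n)$ at a noise rate $0<\gamma\le\Gamma\log n$, then $\gamma\le K\,\log^2(n)/\log\chi(n)$. 2. If $\chi$ is superpolynomial (for every $k$, $\chi(n)\ge n^k$ for all large $n$), then for all large $n$ the same bound holds for every noise rate $\gamma>0$ at which the noisy implementation succeeds to error $\theta\,\varepsilon(n)$. 3. In particular, if $\chi(n)\ge e^{\alpha n}$ for all large $n$, with $\alpha>0$, then for all large $n$ every noise rate $\gamma>0$ at which the noisy implementation succeeds to error $\theta\,\varepsilon(n)$ satisfies $\gamma\le\frac K\alpha\,\log^2(n)/n$. -/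

import Mathlib

open Filter
open scoped ComplexOrder

noncomputable section

/-! Quantum circuits on `n` qubits. Computational basis states are bit strings. -/

/-- Computational basis labels of `n` qubits. -/
abbrev Bits (n : ℕ) := Fin n → Fin 2

/-- Operators on `n` qubits, in the computational basis. -/
abbrev QOp (n : ℕ) := Matrix (Bits n) (Bits n) ℂ

/-- The single-qubit Pauli matrices `I, X, Y, Z`, numbered `0, 1, 2, 3`. -/
def pauliOne : Fin 4 → Matrix (Fin 2) (Fin 2) ℂ :=
  ![1, !![0, 1; 1, 0], !![0, -Complex.I; Complex.I, 0], !![1, 0; 0, -1]]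

/-- The `n`-qubit Pauli operator (tensor product) with letter `p j` on qubit `j`. -/
def pauli {n : ℕ} (p : Fin n → Fin 4) : QOp n :=
  Matrix.of fun x y => ∏ j, pauliOne (p j) (x j) (y j)

/-- A density matrix. -/
def IsState {n : ℕ} (ρ : QOp n) : Prop := ρ.PosSemidef ∧ ρ.trace = 1

/-- An observable (Hermitian) of normalized Frobenius norm one. -/
def IsNormalizedObservable {n : ℕ} (O : QOp n) : Prop :=
  O.IsHermitian ∧ (O.conjTranspose * O).trace / 2 ^ n = 1

/-- A two-qubit gate: an arbitrary unitary on an ordered pair of distinct qubits. -/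
structure Gate (n : ℕ) where
  fst : Fin n
  snd : Fin n
  ne : fst ≠ snd
  mat : Matrix (Fin 2 × Fin 2) (Fin 2 × Fin 2) ℂ
  unitary : mat ∈ Matrix.unitaryGroup (Fin 2 × Fin 2) ℂ

/-- The gate as an operator on all `n` qubits, acting as the identity on the others. -/
def Gate.toOp {n : ℕ} (g : Gate n) : QOp n :=
  Matrix.of fun x y =>
    if ∀ k, k ≠ g.fst → k ≠ g.snd → x k = y k
    then g.mat (x g.fst, x g.snd) (y g.fst, y g.snd) else 0

/-- The two gates act on disjoint pairs of qubits. -/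
def Gate.DisjointFrom {n : ℕ} (g h : Gate n) : Prop :=
  g.fst ≠ h.fst ∧ g.fst ≠ h.snd ∧ g.snd ≠ h.fst ∧ g.snd ≠ h.snd

/-- A circuit layer (depth-one unitary): gates on pairwise disjoint pairs of qubits. Qubits that
occur in no listed gate are idle; an identity gate need not be listed. -/
structure Layer (n : ℕ) where
  gates : List (Gate n)
  disjoint : gates.Pairwise Gate.DisjointFrom

/-- The unitary of a layer. -/
def Layer.toOp {n : ℕ} (L : Layer n) : QOp n := (L.gates.map Gate.toOp).prod

/-- A circuit, as its list of layers `U₁, …, U_d`. As in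
`U₁ (U₂ ( ⋯ U_d ρ U_d† ⋯ ) U₂†) U₁†`, the head of the list is the layer that acts last on the
state. Its length is the depth `d`. -/
abbrev Circuit (n : ℕ) := List (Layer n)

/-- Tracing out qubit `j` and replacing it by the maximally mixed state. -/
def replaceMixed {n : ℕ} (j : Fin n) (ρ : QOp n) : QOp n :=
  Matrix.of fun x y =>
    if x j = y j
    then (1 / 2) * ∑ b : Fin 2, ρ (Function.update x j b) (Function.update y j b) else 0

/-- Local depolarizing noise of strength `γ` on qubit `j`. -/
def depolarize {n : ℕ} (γ : ℝ) (j : Fin n) (ρ : QOp n) : QOp n :=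
  ((Real.exp (-γ) : ℝ) : ℂ) • ρ + ((1 - Real.exp (-γ) : ℝ) : ℂ) • replaceMixed j ρ

/-- Gate-based noise of a layer: depolarizing noise on every qubit that takes part in a gate. -/
def Layer.noise {n : ℕ} (γ : ℝ) (L : Layer n) (ρ : QOp n) : QOp n :=
  L.gates.foldr (fun g σ => depolarize γ g.fst (depolarize γ g.snd σ)) ρ

/-- Read-out noise: depolarizing noise on all qubits. -/
def readoutNoise {n : ℕ} (γ : ℝ) (ρ : QOp n) : QOp n :=
  (List.finRange n).foldr (depolarize γ) ρ

/-- The ideal circuit applied to a state. -/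
def Circuit.ideal {n : ℕ} (C : Circuit n) (ρ : QOp n) : QOp n :=
  C.foldr (fun L σ => L.toOp * σ * L.toOp.conjTranspose) ρ

/-- The noisy implementation, at noise rate `γ`, with gate-based noise and read-out noise:
`D₀ { U₁ D₁ { ⋯ U_d D_d { ρ } U_d† ⋯ } U₁† }`. -/
def Circuit.noisy {n : ℕ} (γ : ℝ) (C : Circuit n) (ρ : QOp n) : QOp n :=
  readoutNoise γ (C.foldr (fun L σ => L.toOp * L.noise γ σ * L.toOp.conjTranspose) ρ)

/-- The expectation value `tr(ρ O)` (a real number for Hermitian `ρ` and `O`). -/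
def expectation {n : ℕ} (ρ O : QOp n) : ℝ := (ρ * O).trace.re

/-- Root mean square of a finite family of reals. -/
def rootMeanSquare {m : ℕ} (f : Fin m → ℝ) : ℝ := Real.sqrt ((∑ i, f i ^ 2) / m)

/-- For every number `n` of qubits: an ideal circuit, a normalized observable and a finite,
nonempty ensemble of states. -/
structure Experiment where
  circuit : ∀ n, Circuit n
  obs : ∀ n, QOp n
  obs_normalized : ∀ n, IsNormalizedObservable (obs n)
  size : ℕ → ℕ
  size_pos : ∀ n, 0 < size n
  state : ∀ n, Fin (size n) → QOp n
  isState : ∀ n i, IsState (state n i)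

namespace Experiment

/-- The ensembles are low-average with constant `c`: the uniform mixture has spectral norm at most
`c / 2 ^ n`. -/
def LowAverage (E : Experiment) (c : ℝ) : Prop :=
  ∀ n, ‖Matrix.toEuclideanCLM (n := Bits n) (𝕜 := ℂ)
    (((E.size n : ℂ))⁻¹ • ∑ i, E.state n i)‖ ≤ c / 2 ^ n

/-- The ideal expectation value `tr(C{ρ} O)` for the `i`-th input state. -/
def idealValue (E : Experiment) (n : ℕ) (i : Fin (E.size n)) : ℝ :=
  expectation ((E.circuit n).ideal (E.state n i)) (E.obs n)

/-- The expectation value `tr(C_γ{ρ} O)` of the noisy implementation for the `i`-th input state. -/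
def noisyValue (E : Experiment) (n : ℕ) (γ : ℝ) (i : Fin (E.size n)) : ℝ :=
  expectation ((E.circuit n).noisy γ (E.state n i)) (E.obs n)

/-- On `n` qubits and at noise rate `γ`, the noisy implementation reproduces the ideal expectation
values to root-mean-square error `δ` over the ensemble. -/
def NoisySucceeds (E : Experiment) (n : ℕ) (γ δ : ℝ) : Prop :=
  rootMeanSquare (fun i => E.noisyValue n γ i - E.idealValue n i) ≤ δ

end Experiment

/-! The machine model: a random access machine with a memory for natural numbers and a memory for
real numbers (unit-cost exact real arithmetic), with structured control flow. The input is the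
description of the circuit and the Pauli coefficients of the observable and of the input state;
each of these numbers is available at unit cost. -/

/-- What a program can access on one input: the circuit, the observable, one input state, and
integer parameters, which may depend on `n` only. -/
structure Input (n : ℕ) where
  param : ℕ → ℕ
  circuit : Circuit n
  obs : QOp n
  state : QOp n

/-- Memory contents. -/
structure Mem where
  nat : ℕ → ℕ
  real : ℕ → ℝ

/-- All memory cells zero. -/
def Mem.init : Mem := ⟨fun _ => 0, fun _ => 0⟩

/-- Integer expressions. -/
inductive NExpr where
  | const (k : ℕ)
  | read (addr : NExpr)
  | add (a b : NExpr)
  | sub (a b : NExpr)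
  /-- number of qubits -/
  | qubits
  /-- the parameter number `j` -/
  | param (j : ℕ)
  /-- number of layers -/
  | depth
  /-- number of gates in layer `t` -/
  | gateCount (t : NExpr)
  /-- first qubit of gate `g` of layer `t` -/
  | gateFst (t g : NExpr)
  /-- second qubit of gate `g` of layer `t` -/
  | gateSnd (t g : NExpr)

/-- Real expressions. -/
inductive RExpr where
  | ofNat (a : NExpr)
  | read (addr : NExpr)
  | add (a b : RExpr)
  | sub (a b : RExpr)
  | mul (a b : RExpr)
  | div (a b : RExpr)
  /-- real part of the entry of gate `g` of layer `t` in row `(a, b)` and column `(a', b')` -/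
  | gateRe (t g a b a' b' : NExpr)
  /-- imaginary part of that entry -/
  | gateIm (t g a b a' b' : NExpr)
  /-- the coefficient `tr(O P) / 2 ^ n`, the letters of `P` being stored from address `p` on -/
  | obsCoeff (p : NExpr)
  /-- the coefficient `tr(ρ P)`, the letters of `P` being stored from address `p` on -/
  | stateCoeff (p : NExpr)

/-- Programs. The loop runs as long as `a < b`. -/
inductive Prog where
  | skip
  | setNat (addr val : NExpr)
  | setReal (addr : NExpr) (val : RExpr)
  | seq (P Q : Prog)
  | ifNatLt (a b : NExpr) (P Q : Prog)
  | ifRealLt (a b : RExpr) (P Q : Prog)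
  | whileLt (a b : NExpr) (P : Prog)

/-- Gate number `g` of layer number `t`, if there is one (numbering from `0`). -/
def Circuit.gate? {n : ℕ} (C : Circuit n) (t g : ℕ) : Option (Gate n) :=
  (C[t]?).bind fun L => L.gates[g]?

/-- The entry `⟨a b| U |a' b'⟩` of a gate (`0` if the gate does not exist). -/
def Circuit.gateEntry {n : ℕ} (C : Circuit n) (t g a b a' b' : ℕ) : ℂ :=
  match C.gate? t g with
  | some u => u.mat (Fin.ofNat 2 a, Fin.ofNat 2 b) (Fin.ofNat 2 a', Fin.ofNat 2 b')
  | none => 0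

/-- The Pauli string stored in memory from address `p` on. -/
def Mem.pauliAt (s : Mem) (n p : ℕ) : Fin n → Fin 4 := fun j => Fin.ofNat 4 (s.nat (p + j))

def NExpr.eval {n : ℕ} (I : Input n) (s : Mem) : NExpr → ℕ
  | const k => k
  | read addr => s.nat (addr.eval I s)
  | add a b => a.eval I s + b.eval I s
  | sub a b => a.eval I s - b.eval I s
  | qubits => n
  | param j => I.param j
  | depth => List.length I.circuit
  | gateCount t => ((I.circuit[t.eval I s]?).map fun L => L.gates.length).getD 0
  | gateFst t g => ((I.circuit.gate? (t.eval I s) (g.eval I s)).map fun u => (u.fst : ℕ)).getD 0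
  | gateSnd t g => ((I.circuit.gate? (t.eval I s) (g.eval I s)).map fun u => (u.snd : ℕ)).getD 0

/-- The number of operations in an integer expression. -/
def NExpr.cost : NExpr → ℕ
  | const _ => 1
  | read addr => addr.cost + 1
  | add a b => a.cost + b.cost + 1
  | sub a b => a.cost + b.cost + 1
  | qubits => 1
  | param _ => 1
  | depth => 1
  | gateCount t => t.cost + 1
  | gateFst t g => t.cost + g.cost + 1
  | gateSnd t g => t.cost + g.cost + 1

def RExpr.eval {n : ℕ} (I : Input n) (s : Mem) : RExpr → ℝ
  | ofNat a => (a.eval I s : ℝ)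
  | read addr => s.real (addr.eval I s)
  | add a b => a.eval I s + b.eval I s
  | sub a b => a.eval I s - b.eval I s
  | mul a b => a.eval I s * b.eval I s
  | div a b => a.eval I s / b.eval I s
  | gateRe t g a b a' b' => (I.circuit.gateEntry (t.eval I s) (g.eval I s)
      (a.eval I s) (b.eval I s) (a'.eval I s) (b'.eval I s)).re
  | gateIm t g a b a' b' => (I.circuit.gateEntry (t.eval I s) (g.eval I s)
      (a.eval I s) (b.eval I s) (a'.eval I s) (b'.eval I s)).im
  | obsCoeff p => expectation I.obs (pauli (s.pauliAt n (p.eval I s))) / 2 ^ n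
  | stateCoeff p => expectation I.state (pauli (s.pauliAt n (p.eval I s)))

/-- The number of operations in a real expression. -/
def RExpr.cost : RExpr → ℕ
  | ofNat a => a.cost + 1
  | read addr => addr.cost + 1
  | add a b => a.cost + b.cost + 1
  | sub a b => a.cost + b.cost + 1
  | mul a b => a.cost + b.cost + 1
  | div a b => a.cost + b.cost + 1
  | gateRe t g a b a' b' => t.cost + g.cost + a.cost + b.cost + a'.cost + b'.cost + 1
  | gateIm t g a b a' b' => t.cost + g.cost + a.cost + b.cost + a'.cost + b'.cost + 1
  | obsCoeff p => p.cost + 1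
  | stateCoeff p => p.cost + 1

/-- `Exec I P s t s'`: on input `I`, started with memory `s`, the program `P` halts after exactly
`t` steps with memory `s'`. -/
inductive Exec {n : ℕ} (I : Input n) : Prog → Mem → ℕ → Mem → Prop where
  | skip (s : Mem) : Exec I .skip s 1 s
  | setNat (addr val : NExpr) (s : Mem) :
      Exec I (.setNat addr val) s (addr.cost + val.cost + 1)
        { s with nat := Function.update s.nat (addr.eval I s) (val.eval I s) }
  | setReal (addr : NExpr) (val : RExpr) (s : Mem) :
      Exec I (.setReal addr val) s (addr.cost + val.cost + 1)
        { s with real := Function.update s.real (addr.eval I s) (val.eval I s) }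
  | seq {P Q : Prog} {s s' s'' : Mem} {t t' : ℕ} :
      Exec I P s t s' → Exec I Q s' t' s'' → Exec I (.seq P Q) s (t + t') s''
  | ifNat_true {a b : NExpr} {P Q : Prog} {s s' : Mem} {t : ℕ} :
      a.eval I s < b.eval I s → Exec I P s t s' →
      Exec I (.ifNatLt a b P Q) s (a.cost + b.cost + 1 + t) s'
  | ifNat_false {a b : NExpr} {P Q : Prog} {s s' : Mem} {t : ℕ} :
      ¬ a.eval I s < b.eval I s → Exec I Q s t s' →
      Exec I (.ifNatLt a b P Q) s (a.cost + b.cost + 1 + t) s'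
  | ifReal_true {a b : RExpr} {P Q : Prog} {s s' : Mem} {t : ℕ} :
      a.eval I s < b.eval I s → Exec I P s t s' →
      Exec I (.ifRealLt a b P Q) s (a.cost + b.cost + 1 + t) s'
  | ifReal_false {a b : RExpr} {P Q : Prog} {s s' : Mem} {t : ℕ} :
      ¬ a.eval I s < b.eval I s → Exec I Q s t s' →
      Exec I (.ifRealLt a b P Q) s (a.cost + b.cost + 1 + t) s'
  | while_done {a b : NExpr} {P : Prog} {s : Mem} :
      ¬ a.eval I s < b.eval I s →
      Exec I (.whileLt a b P) s (a.cost + b.cost + 1) s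
  | while_step {a b : NExpr} {P : Prog} {s s' s'' : Mem} {t t' : ℕ} :
      a.eval I s < b.eval I s → Exec I P s t s' → Exec I (.whileLt a b P) s' t' s'' →
      Exec I (.whileLt a b P) s (a.cost + b.cost + 1 + t + t') s''

/-- On input `I`, the program halts within `T` steps with output `out` (in real cell `0`). -/
def OutputsWithin {n : ℕ} (P : Prog) (I : Input n) (T : ℕ) (out : ℝ) : Prop :=
  ∃ t ≤ T, ∃ s : Mem, Exec I P Mem.init t s ∧ s.real 0 = out

/-- A classical algorithm: one program for all `n`, together with integer parameters (such as
truncation thresholds) that may depend on `n` and are polynomially bounded in `n`. A program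
refers to only finitely many of the parameters. -/
structure ClassicalAlgorithm where
  prog : Prog
  param : ℕ → ℕ → ℕ
  degree : ℕ
  param_le : ∀ n j, param n j ≤ n ^ degree + degree

namespace Experiment

/-- The input that an algorithm receives for the `i`-th state of the ensemble on `n` qubits. -/
def input (E : Experiment) (A : ClassicalAlgorithm) (n : ℕ) (i : Fin (E.size n)) : Input n :=
  ⟨A.param n, E.circuit n, E.obs n, E.state n i⟩

/-- The algorithm computes the ideal expectation values to root-mean-square error `ε n` over the
ensemble, and runs for at most `T n` steps on every state of the ensemble. -/
def Computes (E : Experiment) (A : ClassicalAlgorithm) (ε : ℕ → ℝ) (T : ℕ → ℕ) : Prop :=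
  ∀ n, ∃ out : Fin (E.size n) → ℝ,
    (∀ i, OutputsWithin A.prog (E.input A n i) (T n) (out i)) ∧
    rootMeanSquare (fun i => out i - E.idealValue n i) ≤ ε n

/-- Every classical algorithm that computes the ideal expectation values to root-mean-square error
`ε n` has runtime `Ω(χ n)`. -/
def ClassicallyHard (E : Experiment) (ε χ : ℕ → ℝ) : Prop :=
  ∀ (A : ClassicalAlgorithm) (T : ℕ → ℕ), E.Computes A ε T →
    ∃ M : ℝ, ∀ᶠ n in atTop, χ n ≤ M * T n

end Experiment

end

noncomputable section


/-! ### Pauli expansions -/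

/-! A circuit that is noisy at rate γ can be simulated classically in time n^O(1 + log n / γ). If
its noisy values are still accurate, this simulation also solves the ideal problem, so a lower bound
χ on the classical runtime limits γ.

In the Heisenberg picture the observable is a real vector of Pauli coefficients of Euclidean norm
one. Gates preserve the norm, and noise on a qubit multiplies by q = exp(-γ) the coefficients of all
strings with a nonidentity letter there. Read-out noise therefore multiplies the coefficient of P by
q to the power of the weight of P. This structure survives every gate, because the noise of the gate
compensates any growth of the weight (`Gate.noisyStep_dampAll`). Hence discarding all strings of
weight above ℓ after each gate costs at most q^(ℓ+1) each time, and later steps do not amplify the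
error: with G gates the total is (G+1) q^(ℓ+1) (`l2_noisyEvolve_sub_truncEvolve`). The low-average
property turns Euclidean errors of coefficients into root-mean-square errors of expectation values,
with a factor √c (`Experiment.LowAverage.rootMeanSquare_le`).

With ℓ = ⌊(2a+3) log n / γ⌋ the simulation error is eventually at most (1-θ)ε, and together with the
error θε of the noisy implementation this gives ε. At most (4n+1)^ℓ strings survive, and
`pauliPropagation` is an explicit program whose runtime is polynomial times this number
(`outputsWithin_pauliPropagation`). Hardness yields log χ ≤ (a+9+4ℓ) log n; multiplied by γ, with γℓ
≤ (2a+3) log n, it reads γ log χ ≤ (a+9) γ log n + 4(2a+3) log² n. For γ ≤ Γ log n this is the first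
bound. If χ is superpolynomial, a rate above log n would leave ℓ bounded and the simulation
polynomial, so γ ≤ log n holds automatically. The exponential case is an instance.

Two points need care. Hardness concerns one algorithm for all n, whereas the noise rate varies with
n: `Experiment.ClassicallyHard.bound` selects a suitable rate for each n, when there is one, and
otherwise simulates exactly. Moreover the parameters of a program are integers, so q is a rounded
fraction, and `l2_noisyEvolve_sub` controls the rounding error. -/

/-- Labels of `n`-qubit Pauli strings. -/
abbrev PStr (n : ℕ) := Fin n → Fin 4

/-- The operator with given real Pauli coefficients. -/
def pauliSum {n : ℕ} (v : PStr n → ℝ) : QOp n := ∑ P, (v P : ℂ) • pauli P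

/-- The Pauli coefficients of an operator. -/
def pauliCoeff {n : ℕ} (O : QOp n) (P : PStr n) : ℝ := expectation O (pauli P) / 2 ^ n

theorem pauliOne_complete (x y z w : Fin 2) :
    ∑ a, pauliOne a x y * pauliOne a z w = if x = w ∧ y = z then 2 else 0 := by
  fin_cases x <;> fin_cases y <;> fin_cases z <;> fin_cases w <;>
    simp [pauliOne, Fin.sum_univ_four] <;> norm_num

theorem pauliOne_orthogonal (a b : Fin 4) :
    ∑ x, ∑ y, pauliOne a x y * pauliOne b y x = if a = b then 2 else 0 := by
  fin_cases a <;> fin_cases b <;>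
    simp [pauliOne, Fin.sum_univ_two] <;> norm_num

theorem pauliOne_star (a : Fin 4) (x y : Fin 2) : star (pauliOne a x y) = pauliOne a y x := by
  fin_cases a <;> fin_cases x <;> fin_cases y <;> simp [pauliOne]

theorem pauli_conjTranspose {n : ℕ} (P : PStr n) : (pauli P).conjTranspose = pauli P := by
  ext x y
  simp only [Matrix.conjTranspose_apply, pauli, Matrix.of_apply]
  rw [show star (∏ j, pauliOne (P j) (y j) (x j)) = ∏ j, star (pauliOne (P j) (y j) (x j)) from
    map_prod (starRingEnd ℂ) _ _]
  simp [pauliOne_star]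

theorem pauliSum_conjTranspose {n : ℕ} (v : PStr n → ℝ) :
    (pauliSum v).conjTranspose = pauliSum v := by
  simp [pauliSum, Matrix.conjTranspose_sum, Matrix.conjTranspose_smul, pauli_conjTranspose]

theorem prod_ite_all {n : ℕ} (p : Fin n → Prop) [∀ j, Decidable (p j)] (z : ℂ) :
    (∏ j, if p j then z else 0) = if ∀ j, p j then z ^ n else 0 := by
  split_ifs with h
  · simp [h]
  · push Not at h
    obtain ⟨j, hj⟩ := h
    exact Finset.prod_eq_zero (Finset.mem_univ j) (by simp [hj])

/-- The sum over strings factorizes into single-qubit sums. This completeness relation is what makes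
the expansion `pauliSum_pauliCoeff` exact. -/
theorem pauli_complete {n : ℕ} (x y z w : Bits n) :
    ∑ P, pauli P x y * pauli P z w = if x = w ∧ y = z then 2 ^ n else 0 := by
  simp only [pauli, Matrix.of_apply, ← Finset.prod_mul_distrib]
  rw [← Fintype.prod_sum (fun j a => pauliOne a (x j) (y j) * pauliOne a (z j) (w j))]
  simp only [pauliOne_complete]
  rw [prod_ite_all]
  simp only [funext_iff, forall_and]

theorem trace_pauli_mul_pauli {n : ℕ} (P Q : PStr n) :
    (pauli P * pauli Q).trace = if P = Q then 2 ^ n else 0 := by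
  simp only [Matrix.trace, Matrix.diag_apply, Matrix.mul_apply, pauli, Matrix.of_apply,
    ← Finset.prod_mul_distrib]
  have : ∀ x : Bits n, ∑ y : Bits n, ∏ j, pauliOne (P j) (x j) (y j) * pauliOne (Q j) (y j) (x j)
      = ∏ j, ∑ b, pauliOne (P j) (x j) b * pauliOne (Q j) b (x j) := fun x =>
    (Fintype.prod_sum (fun j b => pauliOne (P j) (x j) b * pauliOne (Q j) b (x j))).symm
  simp only [this]
  rw [← Fintype.prod_sum (fun j c => ∑ b, pauliOne (P j) c b * pauliOne (Q j) b c)]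
  simp only [pauliOne_orthogonal]
  rw [prod_ite_all]
  simp only [funext_iff]

theorem trace_mul_pauliSum {n : ℕ} (A : QOp n) (v : PStr n → ℝ) :
    (A * pauliSum v).trace = ∑ P, (v P : ℂ) * (A * pauli P).trace := by
  simp [pauliSum, Finset.mul_sum, Matrix.trace_sum, Matrix.trace_smul]

theorem expectation_pauliSum {n : ℕ} (A : QOp n) (v : PStr n → ℝ) :
    expectation A (pauliSum v) = ∑ P, v P * expectation A (pauli P) := by
  simp [expectation, trace_mul_pauliSum]

theorem trace_pauliSum_sq {n : ℕ} (v : PStr n → ℝ) :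
    (pauliSum v * pauliSum v).trace = ((2 ^ n * ∑ P, v P ^ 2 : ℝ) : ℂ) := by
  rw [trace_mul_pauliSum]
  have : ∀ P, (pauliSum v * pauli P).trace = 2 ^ n * (v P : ℂ) := by
    intro P
    rw [Matrix.trace_mul_comm, trace_mul_pauliSum]
    simp [trace_pauli_mul_pauli, mul_comm]
  simp only [this]
  push_cast
  rw [Finset.mul_sum]
  exact Finset.sum_congr rfl fun P _ => by ring

/-- Conjugating the trace reverses the product, and cyclicity restores it. Consequently the real
parts taken in `expectation` and `Gate.ptm` lose nothing. -/
theorem trace_mul_real {ι : Type*} [Fintype ι] {A B : Matrix ι ι ℂ}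
    (hA : A.conjTranspose = A) (hB : B.conjTranspose = B) :
    (((A * B).trace.re : ℝ) : ℂ) = (A * B).trace := by
  rw [← Complex.conj_eq_iff_re, ← Complex.star_def, ← Matrix.trace_conjTranspose,
    Matrix.conjTranspose_mul, hA, hB, Matrix.trace_mul_comm]

theorem pauliSum_pauliCoeff {n : ℕ} {O : QOp n} (hO : O.IsHermitian) :
    pauliSum (pauliCoeff O) = O := by
  ext x y
  have h : ∀ P : PStr n, ((pauliCoeff O P : ℝ) : ℂ) = (O * pauli P).trace / 2 ^ n := by
    intro P
    simp only [pauliCoeff, expectation]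
    push_cast
    rw [trace_mul_real hO (pauli_conjTranspose P)]
  simp only [pauliSum, Matrix.sum_apply, Matrix.smul_apply, h, smul_eq_mul, Matrix.trace,
    Matrix.diag_apply, Matrix.mul_apply, Finset.sum_div, Finset.sum_mul]
  rw [Finset.sum_comm]
  simp_rw [Finset.sum_comm (s := (Finset.univ : Finset (PStr n)))]
  have : ∀ z w : Bits n, ∑ P : PStr n, O z w * pauli P w z / 2 ^ n * pauli P x y
      = if z = x ∧ w = y then O z w else 0 := by
    intro z w
    have e := pauli_complete w z x y
    calc _ = O z w / 2 ^ n * ∑ P : PStr n, pauli P w z * pauli P x y := by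
          rw [Finset.mul_sum]; exact Finset.sum_congr rfl fun P _ => by ring
      _ = _ := by
          rw [e]
          by_cases h1 : z = x <;> by_cases h2 : w = y <;> simp [h1, h2]
  simp only [this]
  simp [ite_and]

/-! ### Depolarizing noise in the Pauli basis -/

/-- Depolarizing noise on qubit `j` acting on Pauli coefficients. -/
def damp {n : ℕ} (q : ℝ) (j : Fin n) (v : PStr n → ℝ) : PStr n → ℝ :=
  fun P => if P j = 0 then v P else q * v P

/-- Exchanging the letter at `j` with the summation variable `b` is an involution on pairs, after
which the summand no longer depends on `b`. -/
theorem sum_update {n : ℕ} {β : Type*} [Fintype β] [DecidableEq β] (j : Fin n)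
    (f : (Fin n → β) → ℂ) :
    ∑ x, ∑ b, f (Function.update x j b) = Fintype.card β * ∑ x, f x := by
  have e : ∑ x : Fin n → β, ∑ b : β, f (Function.update x j b)
      = ∑ x : Fin n → β, ∑ b : β, f x := by
    rw [← Fintype.sum_prod_type' (fun (x : Fin n → β) (b : β) => f (Function.update x j b)),
      ← Fintype.sum_prod_type' (fun (x : Fin n → β) (_ : β) => f x)]
    refine Finset.sum_bij' (fun p _ => (Function.update p.1 j p.2, p.1 j))
      (fun p _ => (Function.update p.1 j p.2, p.1 j)) ?_ ?_ ?_ ?_ ?_ <;> simp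
  rw [e, Finset.sum_comm]
  simp

/-- The matrices X, Y, Z are traceless, so the maximally mixed state on qubit `j` detects the
identity letter only. -/
theorem replaceMixed_trace {n : ℕ} (j : Fin n) (ρ : QOp n) (P : PStr n) :
    (replaceMixed j ρ * pauli P).trace = if P j = 0 then (ρ * pauli P).trace else 0 := by
  have half : ∀ f : Bits n → ℂ, ∑ x, f x = (1 / 2) * ∑ x, ∑ b, f (Function.update x j b) := by
    intro f; rw [sum_update]; simp
  have pu : ∀ (x y : Bits n) (b c : Fin 2),
      pauli P (Function.update x j b) (Function.update y j c)
        = pauliOne (P j) b c * ∏ k ∈ Finset.univ.erase j, pauliOne (P k) (x k) (y k) := by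
    intro x y b c
    simp only [pauli, Matrix.of_apply]
    rw [← Finset.mul_prod_erase _ _ (Finset.mem_univ j)]
    congr 1
    · simp
    · refine Finset.prod_congr rfl fun k hk => ?_
      simp [Finset.ne_of_mem_erase hk]
  simp only [Matrix.trace, Matrix.diag_apply, Matrix.mul_apply]
  -- Averaging both indices over their bit at `j` isolates that qubit, so that only one-qubit sums
  -- remain to be compared.
  have two : ∀ F : Bits n → Bits n → ℂ, ∑ x, ∑ y, F x y
      = (1 / 4) * ∑ x, ∑ y, ∑ b, ∑ c, F (Function.update x j b) (Function.update y j c) := by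
    intro F
    rw [half]
    have : ∀ x b, ∑ y, F (Function.update x j b) y
        = (1 / 2) * ∑ y, ∑ c, F (Function.update x j b) (Function.update y j c) := 
      fun x b => half _
    simp only [this]
    simp only [← Finset.mul_sum]
    rw [← mul_assoc]
    congr 1
    · norm_num
    · exact Finset.sum_congr rfl fun x _ => Finset.sum_comm
  rw [two, two (fun x y => ρ x y * pauli P y x)]
  have pull : ∀ a : ℂ, (if P j = 0 then (1 / 4) * a else 0)
      = (1 / 4) * if P j = 0 then a else 0 := fun a => by split_ifs <;> simp
  rw [pull]
  congr 1
  have push : ∀ F : Bits n → Bits n → ℂ, (if P j = 0 then ∑ x, ∑ y, F x y else 0)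
    = ∑ x, ∑ y, if P j = 0 then F x y else 0 := by intro F; split_ifs <;> simp
  rw [push]
  refine Finset.sum_congr rfl fun x _ => Finset.sum_congr rfl fun y _ => ?_
  simp only [pu, replaceMixed, Matrix.of_apply, Function.update_self, Function.update_idem]
  generalize ∏ k ∈ Finset.univ.erase j, pauliOne (P k) (y k) (x k) = r
  generalize P j = a
  simp only [Fin.sum_univ_two]
  fin_cases a <;> simp [pauliOne] <;> ring

theorem depolarize_trace {n : ℕ} (γ : ℝ) (j : Fin n) (ρ : QOp n) (v : PStr n → ℝ) :
    (depolarize γ j ρ * pauliSum v).trace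
      = (ρ * pauliSum (damp (Real.exp (-γ)) j v)).trace := by
  rw [trace_mul_pauliSum, trace_mul_pauliSum]
  simp only [depolarize, Matrix.add_mul, Matrix.trace_add, Matrix.smul_mul,
    Matrix.trace_smul, replaceMixed_trace, damp]
  refine Finset.sum_congr rfl fun P _ => ?_
  split_ifs
  · simp only [smul_eq_mul]; push_cast; ring
  · simp only [smul_eq_mul]; push_cast; ring

/-! ### Gates in the Pauli basis -/

/-- Two-qubit Pauli matrices. -/
def pauliTwo (a b : Fin 4) : Matrix (Fin 2 × Fin 2) (Fin 2 × Fin 2) ℂ :=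
  Matrix.of fun x y => pauliOne a x.1 y.1 * pauliOne b x.2 y.2

theorem pauliTwo_conjTranspose (a b : Fin 4) : (pauliTwo a b).conjTranspose = pauliTwo a b := by
  ext x y
  simp only [Matrix.conjTranspose_apply, pauliTwo, Matrix.of_apply, star_mul', pauliOne_star]

theorem pauliTwo_expand (X : Matrix (Fin 2 × Fin 2) (Fin 2 × Fin 2) ℂ) (x y : Fin 2 × Fin 2) :
    X x y = ∑ a, ∑ b, (X * pauliTwo a b).trace / 4 * pauliTwo a b x y := by
  have key : ∀ z w : Fin 2 × Fin 2, ∑ a, ∑ b, pauliTwo a b w z * pauliTwo a b x y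
      = if z = x ∧ w = y then 4 else 0 := by
    intro z w
    have : ∀ a b, pauliTwo a b w z * pauliTwo a b x y
        = (pauliOne a w.1 z.1 * pauliOne a x.1 y.1) * (pauliOne b w.2 z.2 * pauliOne b x.2 y.2) := by
      intro a b; simp only [pauliTwo, Matrix.of_apply]; ring
    simp only [this]
    rw [← Finset.sum_mul_sum]
    simp only [pauliOne_complete, Prod.ext_iff]
    by_cases h1 : w.1 = y.1 <;> by_cases h2 : z.1 = x.1 <;> by_cases h3 : w.2 = y.2 <;>
      by_cases h4 : z.2 = x.2 <;> (simp [h1, h2, h3, h4]; try norm_num)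
  symm
  calc _ = ∑ a, ∑ b, ∑ z, ∑ w, X z w / 4 * (pauliTwo a b w z * pauliTwo a b x y) := by
        simp only [Matrix.trace, Matrix.diag_apply, Matrix.mul_apply, Finset.sum_div,
          Finset.sum_mul]
        refine Finset.sum_congr rfl fun a _ => Finset.sum_congr rfl fun b _ =>
          Finset.sum_congr rfl fun z _ => Finset.sum_congr rfl fun w _ => by ring
    _ = ∑ z, ∑ w, X z w / 4 * ∑ a, ∑ b, (pauliTwo a b w z * pauliTwo a b x y) := by
        simp only [Finset.mul_sum]
        simp_rw [Finset.sum_comm (s := (Finset.univ : Finset (Fin 4)))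
          (t := (Finset.univ : Finset (Fin 2 × Fin 2)))]
    _ = X x y := by
        simp only [key, ite_and]
        simp

/-- The Pauli transfer matrix of a gate in the Heisenberg picture. -/
def Gate.ptm {n : ℕ} (g : Gate n) (a b p q : Fin 4) : ℝ :=
  (g.mat.conjTranspose * pauliTwo a b * g.mat * pauliTwo p q).trace.re / 4

theorem Gate.conj_pauliTwo {n : ℕ} (g : Gate n) (a b : Fin 4) (x y : Fin 2 × Fin 2) :
    (g.mat.conjTranspose * pauliTwo a b * g.mat) x y
      = ∑ p, ∑ q, (g.ptm a b p q : ℂ) * pauliTwo p q x y := by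
  rw [pauliTwo_expand (g.mat.conjTranspose * pauliTwo a b * g.mat) x y]
  refine Finset.sum_congr rfl fun p _ => Finset.sum_congr rfl fun q _ => ?_
  rw [Gate.ptm]
  push_cast
  rw [trace_mul_real _ (pauliTwo_conjTranspose p q)]
  simp [Matrix.conjTranspose_mul, pauliTwo_conjTranspose, Matrix.mul_assoc]

/-- Replacing two letters of a string. -/
def setTwo {n : ℕ} {β : Type*} (i j : Fin n) (P : Fin n → β) (a b : β) : Fin n → β :=
  Function.update (Function.update P i a) j b

section setTwo
variable {n : ℕ} {β : Type*} {i j : Fin n}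

theorem setTwo_fst (h : i ≠ j) (P : Fin n → β) (a b : β) : setTwo i j P a b i = a := by
  simp [setTwo, h]

theorem setTwo_snd (P : Fin n → β) (a b : β) : setTwo i j P a b j = b := by
  simp [setTwo]

theorem setTwo_other (P : Fin n → β) (a b : β) {k : Fin n} (hi : k ≠ i) (hj : k ≠ j) :
    setTwo i j P a b k = P k := by
  simp [setTwo, hi, hj]

theorem setTwo_setTwo (h : i ≠ j) (P : Fin n → β) (a b c d : β) :
    setTwo i j (setTwo i j P a b) c d = setTwo i j P c d := by
  funext k
  by_cases hi : k = i
  · subst hi; simp [setTwo_fst h]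
  by_cases hj : k = j
  · subst hj; simp [setTwo_snd]
  simp [setTwo_other, hi, hj]

theorem setTwo_self (P : Fin n → β) : setTwo i j P (P i) (P j) = P := by
  simp [setTwo]

theorem eq_setTwo_iff (h : i ≠ j) (P Q : Fin n → β) :
    (∀ k, k ≠ i → k ≠ j → P k = Q k) ↔ P = setTwo i j Q (P i) (P j) := by
  constructor
  · intro H; funext k
    by_cases hi : k = i
    · subst hi; simp [setTwo_fst h]
    by_cases hj : k = j
    · subst hj; simp [setTwo_snd]
    simp [setTwo_other, hi, hj, H]
  · intro H k hi hj; rw [H, setTwo_other _ _ _ hi hj]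

/-- Sums over all strings that agree with a given one outside of two positions. -/
theorem sum_agree [Fintype β] [DecidableEq β] (h : i ≠ j) (x : Fin n → β)
    (f : (Fin n → β) → ℂ) :
    (∑ z, if ∀ k, k ≠ i → k ≠ j → z k = x k then f z else 0)
      = ∑ c : β × β, f (setTwo i j x c.1 c.2) := by
  rw [← Finset.sum_filter]
  refine Finset.sum_bij' (fun z _ => (z i, z j)) (fun c _ => setTwo i j x c.1 c.2) ?_ ?_ ?_ ?_ ?_
  · simp
  · intro c _
    simp only [Finset.mem_filter, Finset.mem_univ, true_and]
    intro k hi hj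
    exact setTwo_other _ _ _ hi hj
  · intro z hz
    exact ((eq_setTwo_iff h z x).1 (Finset.mem_filter.1 hz).2).symm
  · intro c _; simp [setTwo_fst h, setTwo_snd]
  · intro z hz
    rw [← (eq_setTwo_iff h z x).1 (Finset.mem_filter.1 hz).2]

/-- Exchanging two letters of a string with a pair of letters. -/
theorem sum_setTwo_comm [Fintype β] [DecidableEq β] {M : Type*} [AddCommMonoid M] (h : i ≠ j)
    (F : (Fin n → β) → β → β → M) :
    ∑ P, ∑ a, ∑ b, F P a b = ∑ P, ∑ a, ∑ b, F (setTwo i j P a b) (P i) (P j) := by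
  have e : ∀ G : (Fin n → β) → β → β → M, ∑ P, ∑ a, ∑ b, G P a b
      = ∑ t : (Fin n → β) × β × β, G t.1 t.2.1 t.2.2 := by
    intro G; simp only [Fintype.sum_prod_type]
  rw [e, e]
  refine Finset.sum_bij' (fun t _ => (setTwo i j t.1 t.2.1 t.2.2, t.1 i, t.1 j))
    (fun t _ => (setTwo i j t.1 t.2.1 t.2.2, t.1 i, t.1 j)) ?_ ?_ ?_ ?_ ?_ <;>
  simp [setTwo_fst h, setTwo_snd, setTwo_setTwo h, setTwo_self]

end setTwo

theorem pauli_setTwo {n : ℕ} {i j : Fin n} (h : i ≠ j) (P : PStr n) (x y : Bits n) (a b : Fin 4)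
    (c d : Fin 2 × Fin 2) :
    pauli (setTwo i j P a b) (setTwo i j x c.1 c.2) (setTwo i j y d.1 d.2)
      = pauliTwo a b c d
        * ∏ k ∈ (Finset.univ.erase i).erase j, pauliOne (P k) (x k) (y k) := by
  simp only [pauli, Matrix.of_apply, pauliTwo]
  rw [← Finset.mul_prod_erase _ _ (Finset.mem_univ i),
    ← Finset.mul_prod_erase _ _ (Finset.mem_erase.2 ⟨h.symm, Finset.mem_univ j⟩), mul_assoc]
  simp only [setTwo_fst h, setTwo_snd]
  congr 2
  refine Finset.prod_congr rfl fun k hk => ?_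
  have hj := Finset.ne_of_mem_erase hk
  have hi := Finset.ne_of_mem_erase (Finset.mem_of_mem_erase hk)
  simp [setTwo_other, hi, hj]

/-- Conjugation by a gate, in the Heisenberg picture, on Pauli coefficients. -/
def Gate.conjStep {n : ℕ} (g : Gate n) (v : PStr n → ℝ) : PStr n → ℝ :=
  fun P => ∑ a, ∑ b, g.ptm a b (P g.fst) (P g.snd) * v (setTwo g.fst g.snd P a b)

/-- The gate is the identity on all other qubits, so the entries of the other letters split off as
the common factor `r` and only a two-qubit expansion remains. -/
theorem Gate.conj_pauli {n : ℕ} (g : Gate n) (Q : PStr n) :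
    g.toOp.conjTranspose * pauli Q * g.toOp
      = ∑ a, ∑ b, (g.ptm (Q g.fst) (Q g.snd) a b : ℂ) • pauli (setTwo g.fst g.snd Q a b) := by
  ext x y
  set r := ∏ k ∈ (Finset.univ.erase g.fst).erase g.snd, pauliOne (Q k) (x k) (y k) with hr
  have hR : (∑ a, ∑ b, (g.ptm (Q g.fst) (Q g.snd) a b : ℂ)
        • pauli (setTwo g.fst g.snd Q a b)) x y
      = (g.mat.conjTranspose * pauliTwo (Q g.fst) (Q g.snd) * g.mat)
          (x g.fst, x g.snd) (y g.fst, y g.snd) * r := by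
    simp only [Matrix.sum_apply, Matrix.smul_apply, smul_eq_mul]
    rw [Gate.conj_pauliTwo, Finset.sum_mul]
    refine Finset.sum_congr rfl fun a _ => ?_
    rw [Finset.sum_mul]
    refine Finset.sum_congr rfl fun b _ => ?_
    have := pauli_setTwo g.ne Q x y a b (x g.fst, x g.snd) (y g.fst, y g.snd)
    simp only [setTwo_self] at this
    rw [this, mul_assoc]
  rw [hR]
  simp only [Matrix.mul_apply, Matrix.conjTranspose_apply, Gate.toOp, Matrix.of_apply]
  have e1 : ∀ w : Bits n, (∑ z : Bits n, star (if ∀ k, k ≠ g.fst → k ≠ g.snd → z k = x k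
        then g.mat (z g.fst, z g.snd) (x g.fst, x g.snd) else 0) * pauli Q z w)
      = ∑ c : Fin 2 × Fin 2, star (g.mat c (x g.fst, x g.snd))
          * pauli Q (setTwo g.fst g.snd x c.1 c.2) w := by
    intro w
    have := sum_agree g.ne x
      (fun z => star (g.mat (z g.fst, z g.snd) (x g.fst, x g.snd)) * pauli Q z w)
    simp only [setTwo_fst g.ne, setTwo_snd] at this
    rw [← this]
    refine Finset.sum_congr rfl fun z _ => ?_
    split_ifs <;> simp
  simp only [e1]
  have e2 := sum_agree g.ne y (fun w => (∑ c : Fin 2 × Fin 2, star (g.mat c (x g.fst, x g.snd))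
          * pauli Q (setTwo g.fst g.snd x c.1 c.2) w) * g.mat (w g.fst, w g.snd) (y g.fst, y g.snd))
  simp only [setTwo_fst g.ne, setTwo_snd] at e2
  simp only [mul_ite, mul_zero]
  rw [e2, Finset.sum_mul]
  refine Finset.sum_congr rfl fun d _ => ?_
  rw [mul_right_comm]
  congr 1
  rw [Finset.sum_mul]
  refine Finset.sum_congr rfl fun c _ => ?_
  have := pauli_setTwo g.ne Q x y (Q g.fst) (Q g.snd) c d
  rw [setTwo_self] at this
  rw [this, mul_assoc]

theorem Gate.pauliSum_conjStep {n : ℕ} (g : Gate n) (v : PStr n → ℝ) :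
    pauliSum (g.conjStep v) = g.toOp.conjTranspose * pauliSum v * g.toOp := by
  have e : g.toOp.conjTranspose * pauliSum v * g.toOp
      = ∑ Q, (v Q : ℂ) • (g.toOp.conjTranspose * pauli Q * g.toOp) := by
    simp only [pauliSum, Finset.mul_sum, Finset.sum_mul, Matrix.mul_smul, Matrix.smul_mul]
  rw [e]
  simp only [Gate.conj_pauli, Finset.smul_sum, pauliSum, Gate.conjStep, smul_smul]
  -- Conjugation distributes each string over new letters, while `conjStep` collects from old
  -- letters. Exchanging the two letters of the string with the summation letters turns one into the
  -- other.
  rw [sum_setTwo_comm g.ne]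
  simp only [setTwo_fst g.ne, setTwo_snd, setTwo_setTwo g.ne, setTwo_self]
  refine Finset.sum_congr rfl fun P _ => ?_
  push_cast
  rw [Finset.sum_smul]
  refine Finset.sum_congr rfl fun a _ => ?_
  rw [Finset.sum_smul]
  refine Finset.sum_congr rfl fun b _ => ?_
  rw [mul_comm]

theorem Gate.toOp_mul_conjTranspose {n : ℕ} (g : Gate n) :
    g.toOp * g.toOp.conjTranspose = 1 := by
  ext x y
  have hu : g.mat * g.mat.conjTranspose = 1 := (Matrix.mem_unitaryGroup_iff.1 g.unitary)
  simp only [Matrix.mul_apply, Matrix.conjTranspose_apply, Gate.toOp, Matrix.of_apply]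
  have := sum_agree g.ne x (fun z => g.mat (x g.fst, x g.snd) (z g.fst, z g.snd) *
    star (if ∀ k, k ≠ g.fst → k ≠ g.snd → y k = z k
        then g.mat (y g.fst, y g.snd) (z g.fst, z g.snd) else 0))
  have e : ∀ z : Bits n, (∀ k, k ≠ g.fst → k ≠ g.snd → z k = x k) ↔
    (∀ k, k ≠ g.fst → k ≠ g.snd → x k = z k) := fun z =>
      ⟨fun h k h1 h2 => (h k h1 h2).symm, fun h k h1 h2 => (h k h1 h2).symm⟩
  simp only [e] at this
  simp only [ite_mul, zero_mul]
  rw [this]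
  simp only [setTwo_fst g.ne, setTwo_snd]
  have e2 : ∀ c : Fin 2 × Fin 2, (∀ k, k ≠ g.fst → k ≠ g.snd →
      y k = setTwo g.fst g.snd x c.1 c.2 k) ↔ (∀ k, k ≠ g.fst → k ≠ g.snd → y k = x k) := fun c =>
    forall_congr' fun k => forall_congr' fun h1 => forall_congr' fun h2 => by
      rw [setTwo_other _ _ _ h1 h2]
  simp only [e2]
  by_cases h : ∀ k, k ≠ g.fst → k ≠ g.snd → y k = x k
  · simp only [if_pos h]
    have hm := congrFun (congrFun hu (x g.fst, x g.snd)) (y g.fst, y g.snd)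
    simp only [Matrix.mul_apply, Matrix.conjTranspose_apply] at hm
    rw [hm]
    have : x = y ↔ (x g.fst, x g.snd) = (y g.fst, y g.snd) := by
      constructor
      · rintro rfl; rfl
      · intro hp
        have := (eq_setTwo_iff g.ne y x).1 h
        have h1 : x g.fst = y g.fst := (Prod.ext_iff.1 hp).1
        have h2 : x g.snd = y g.snd := (Prod.ext_iff.1 hp).2
        rw [this, ← h1, ← h2, setTwo_self]
    simp only [Matrix.one_apply, this]
  · simp only [if_neg h, star_zero, mul_zero, Finset.sum_const_zero]
    rw [Matrix.one_apply_ne]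
    rintro rfl
    exact h fun _ _ _ => rfl

/-! ### Circuits in the Heisenberg picture -/

theorem Gate.conjStep_damp {n : ℕ} (g : Gate n) (q : ℝ) (j : Fin n) (hi : j ≠ g.fst)
    (hj : j ≠ g.snd) (v : PStr n → ℝ) :
    g.conjStep (damp q j v) = damp q j (g.conjStep v) := by
  funext P
  simp only [Gate.conjStep, damp, setTwo_other _ _ _ hi hj]
  split_ifs
  · rfl
  · simp only [Finset.mul_sum]
    exact Finset.sum_congr rfl fun a _ => Finset.sum_congr rfl fun b _ => by ring

/-- A gate preceded by its noise, in the Heisenberg picture. -/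
def Gate.noisyStep {n : ℕ} (q : ℝ) (g : Gate n) (v : PStr n → ℝ) : PStr n → ℝ :=
  damp q g.snd (damp q g.fst (g.conjStep v))

/-- The gates of a circuit, in the order of the Heisenberg evolution. -/
def Circuit.gates {n : ℕ} (C : Circuit n) : List (Gate n) := C.flatMap Layer.gates

/-- The read-out noise on Pauli coefficients. -/
def dampList {n : ℕ} (q : ℝ) (l : List (Fin n)) (v : PStr n → ℝ) : PStr n → ℝ :=
  l.foldl (fun v j => damp q j v) v

theorem readout_trace {n : ℕ} (γ : ℝ) (l : List (Fin n)) (ρ : QOp n) (v : PStr n → ℝ) :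
    (l.foldr (depolarize γ) ρ * pauliSum v).trace
      = (ρ * pauliSum (dampList (Real.exp (-γ)) l v)).trace := by
  induction l generalizing v with
  | nil => rfl
  | cons j l ih => rw [List.foldr_cons, depolarize_trace, ih]; rfl

/-- The noise of the gates of a layer on Pauli coefficients. -/
def layerDamp {n : ℕ} (q : ℝ) (l : List (Gate n)) (v : PStr n → ℝ) : PStr n → ℝ :=
  l.foldl (fun v g => damp q g.snd (damp q g.fst v)) v

theorem layerNoise_trace {n : ℕ} (γ : ℝ) (l : List (Gate n)) (ρ : QOp n) (v : PStr n → ℝ) :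
    (l.foldr (fun g σ => depolarize γ g.fst (depolarize γ g.snd σ)) ρ * pauliSum v).trace
      = (ρ * pauliSum (layerDamp (Real.exp (-γ)) l v)).trace := by
  induction l generalizing v with
  | nil => rfl
  | cons g l ih => rw [List.foldr_cons, depolarize_trace, depolarize_trace, ih]; rfl

theorem layerConj_trace {n : ℕ} (l : List (Gate n)) (σ : QOp n) (v : PStr n → ℝ) :
    ((l.map Gate.toOp).prod * σ * (l.map Gate.toOp).prod.conjTranspose * pauliSum v).trace
      = (σ * pauliSum (l.foldl (fun v g => g.conjStep v) v)).trace := by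
  induction l generalizing v with
  | nil => simp
  | cons g l ih =>
    rw [List.foldl_cons, ← ih, Gate.pauliSum_conjStep, List.map_cons, List.prod_cons,
      Matrix.conjTranspose_mul]
    simp only [Matrix.mul_assoc]
    rw [Matrix.trace_mul_comm]
    simp only [Matrix.mul_assoc]

/-- Noise on the qubits of one gate commutes with the other gates of the layer, by disjointness.
From here on a circuit is a plain list of gates, each with its own noise. -/
theorem layer_foldl {n : ℕ} (q : ℝ) (l : List (Gate n)) (hl : l.Pairwise Gate.DisjointFrom)
    (v : PStr n → ℝ) :
    layerDamp q l (l.foldl (fun v g => g.conjStep v) v)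
      = l.foldl (fun v g => g.noisyStep q v) v := by
  induction l generalizing v with
  | nil => rfl
  | cons g l ih =>
    have hc : ∀ (m : List (Gate n)), (∀ h ∈ m, g.DisjointFrom h) → ∀ w : PStr n → ℝ,
        m.foldl (fun v h => h.conjStep v) (damp q g.snd (damp q g.fst w))
          = damp q g.snd (damp q g.fst (m.foldl (fun v h => h.conjStep v) w)) := by
      intro m
      induction m with
      | nil => intro _ w; rfl
      | cons h m ihm =>
        intro hd w
        have hh := hd h List.mem_cons_self
        rw [List.foldl_cons, Gate.conjStep_damp _ _ _ hh.2.2.1 hh.2.2.2,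
          Gate.conjStep_damp _ _ _ hh.1 hh.2.1, ihm fun k hk => hd k (List.mem_cons_of_mem _ hk)]
        rfl
    rw [List.pairwise_cons] at hl
    rw [List.foldl_cons, List.foldl_cons, ← ih hl.2, Gate.noisyStep, hc l hl.1]
    rfl

/-- The noisy circuit on Pauli coefficients, in the Heisenberg picture. -/
def noisyEvolve {n : ℕ} (q : ℝ) (C : Circuit n) (v : PStr n → ℝ) : PStr n → ℝ :=
  C.gates.foldl (fun v g => g.noisyStep q v) (dampList q (List.finRange n) v)

/-- What acts last on the state acts first on the observable; this is why `foldr` over layers turns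
into `foldl` over gates. -/
theorem noisy_trace {n : ℕ} (γ : ℝ) (C : Circuit n) (ρ : QOp n) (v : PStr n → ℝ) :
    (C.noisy γ ρ * pauliSum v).trace = (ρ * pauliSum (noisyEvolve (Real.exp (-γ)) C v)).trace := by
  rw [Circuit.noisy, readoutNoise, readout_trace, noisyEvolve]
  generalize dampList (Real.exp (-γ)) (List.finRange n) v = w
  induction C generalizing w with
  | nil => rfl
  | cons L C ih =>
    rw [List.foldr_cons, Layer.toOp, layerConj_trace, Layer.noise, layerNoise_trace,
      layer_foldl _ _ L.disjoint, ih]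
    simp [Circuit.gates, List.foldl_append]

/-- Exact simulation thereby becomes the case q = 1 of the noisy one and needs no program of its
own. -/
theorem Circuit.noisy_zero {n : ℕ} (C : Circuit n) (ρ : QOp n) : C.noisy 0 ρ = C.ideal ρ := by
  have h : ∀ (j : Fin n) (σ : QOp n), depolarize 0 j σ = σ := by intro j σ; simp [depolarize]
  have h' : ∀ (L : Layer n) (σ : QOp n), L.noise 0 σ = σ := by
    intro L σ
    simp only [Layer.noise, h]
    induction L.gates with
    | nil => rfl
    | cons g l ih => simp
  have hr : ∀ (l : List (Fin n)) (σ : QOp n), l.foldr (depolarize 0) σ = σ := by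
    intro l σ
    induction l with
    | nil => rfl
    | cons g l ih => simpa [h] using ih
  simp only [Circuit.noisy, Circuit.ideal, readoutNoise, hr, h']

theorem expectation_noisy {n : ℕ} (γ : ℝ) (C : Circuit n) (ρ : QOp n) {O : QOp n}
    (hO : O.IsHermitian) :
    expectation (C.noisy γ ρ) O
      = ∑ P, noisyEvolve (Real.exp (-γ)) C (pauliCoeff O) P * expectation ρ (pauli P) := by
  rw [← expectation_pauliSum, expectation, expectation, ← noisy_trace, pauliSum_pauliCoeff hO]

/-! ### The Euclidean norm of Pauli coefficients -/

/-- The Euclidean norm of a finite family of reals. -/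
def l2 {ι : Type*} [Fintype ι] (v : ι → ℝ) : ℝ := Real.sqrt (∑ P, v P ^ 2)

section l2
variable {ι : Type*} [Fintype ι]

theorem l2_eq_norm (v : ι → ℝ) : l2 v = ‖WithLp.toLp 2 v‖ := by
  simp [l2, EuclideanSpace.norm_eq]

theorem l2_add_le (v w : ι → ℝ) : l2 (v + w) ≤ l2 v + l2 w := by
  simp only [l2_eq_norm, WithLp.toLp_add]
  exact norm_add_le _ _

theorem l2_sub_le (u v w : ι → ℝ) : l2 (u - w) ≤ l2 (u - v) + l2 (v - w) := by
  rw [← sub_add_sub_cancel u v w]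
  exact l2_add_le _ _

theorem l2_le_mul {v w : ι → ℝ} {c : ℝ} (hc : 0 ≤ c) (h : ∀ P, |v P| ≤ c * |w P|) :
    l2 v ≤ c * l2 w := by
  rw [l2, l2, ← Real.sqrt_sq hc, ← Real.sqrt_mul (sq_nonneg c), Finset.mul_sum]
  refine Real.sqrt_le_sqrt (Finset.sum_le_sum fun P _ => ?_)
  rw [← mul_pow]
  exact sq_le_sq.2 (by rw [abs_mul, abs_of_nonneg hc]; exact h P)

theorem l2_le {v w : ι → ℝ} (h : ∀ P, |v P| ≤ |w P|) : l2 v ≤ l2 w := by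
  simpa using l2_le_mul zero_le_one (by simpa using h)

end l2

/-- By `trace_pauliSum_sq` the squared norm is, up to 2^n, the trace of the squared operator, which
unitary conjugation preserves. -/
theorem l2_conjStep {n : ℕ} (g : Gate n) (v : PStr n → ℝ) : l2 (g.conjStep v) = l2 v := by
  have h : (pauliSum (g.conjStep v) * pauliSum (g.conjStep v)).trace
      = (pauliSum v * pauliSum v).trace := by
    rw [Gate.pauliSum_conjStep]
    simp only [Matrix.mul_assoc]
    rw [Matrix.trace_mul_comm]
    simp only [Matrix.mul_assoc]
    rw [Gate.toOp_mul_conjTranspose, Matrix.mul_one, ← Matrix.mul_assoc g.toOp,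
      Gate.toOp_mul_conjTranspose, Matrix.one_mul]
  rw [trace_pauliSum_sq, trace_pauliSum_sq] at h
  have h2 := Complex.ofReal_injective h
  rw [l2, l2, mul_left_cancel₀ (by positivity) h2]

theorem Gate.conjStep_sub {n : ℕ} (g : Gate n) (v w : PStr n → ℝ) :
    g.conjStep (v - w) = g.conjStep v - g.conjStep w := by
  funext P
  simp only [Gate.conjStep, Pi.sub_apply, mul_sub, Finset.sum_sub_distrib]

theorem l2_pauliCoeff {n : ℕ} {O : QOp n} (hO : IsNormalizedObservable O) :
    l2 (pauliCoeff O) = 1 := by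
  have h := hO.2
  rw [hO.1] at h
  have e := trace_pauliSum_sq (pauliCoeff O)
  rw [pauliSum_pauliCoeff hO.1] at e
  rw [e] at h
  have h2 : ((∑ P, pauliCoeff O P ^ 2 : ℝ) : ℂ) = 1 := by
    rw [← h]; push_cast; field_simp
  rw [l2, Complex.ofReal_eq_one.1 h2, Real.sqrt_one]

/-! ### Noise on Pauli coefficients -/

/-- The damping factor of one letter. -/
def letterFactor (q : ℝ) (a : Fin 4) : ℝ := if a = 0 then 1 else q

theorem damp_apply {n : ℕ} (q : ℝ) (j : Fin n) (v : PStr n → ℝ) (P : PStr n) :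
    damp q j v P = letterFactor q (P j) * v P := by
  simp only [damp, letterFactor]; split_ifs <;> simp

/-- The weight of a Pauli string. -/
def weight {n : ℕ} (P : PStr n) : ℕ := ∑ j, if P j = 0 then 0 else 1

theorem weight_le {n : ℕ} (P : PStr n) : weight P ≤ n := by
  calc weight P ≤ ∑ _j : Fin n, 1 := Finset.sum_le_sum fun j _ => by split_ifs <;> simp
    _ = n := by simp

theorem pow_weight {n : ℕ} (q : ℝ) (P : PStr n) :
    q ^ weight P = ∏ j, letterFactor q (P j) := by
  rw [weight, ← Finset.prod_pow_eq_pow_sum]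
  refine Finset.prod_congr rfl fun j _ => ?_
  simp only [letterFactor]; split_ifs <;> simp

/-- Depolarizing noise on all qubits. -/
def dampAll {n : ℕ} (q : ℝ) (v : PStr n → ℝ) : PStr n → ℝ := fun P => q ^ weight P * v P

theorem dampList_finRange {n : ℕ} (q : ℝ) (v : PStr n → ℝ) :
    dampList q (List.finRange n) v = dampAll q v := by
  funext P
  rw [dampAll, pow_weight, Fin.prod_univ_def]
  generalize List.finRange n = l
  induction l generalizing v with
  | nil => simp [dampList]
  | cons j l ih =>
    have := ih (damp q j v)
    simp only [dampList, List.foldl_cons, List.map_cons, List.prod_cons] at this ⊢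
    rw [this, damp_apply]
    ring

theorem letterFactor_nonneg {q : ℝ} (h : 0 ≤ q) (a : Fin 4) : 0 ≤ letterFactor q a := by
  simp only [letterFactor]; split_ifs <;> simp [h]

theorem letterFactor_le_one {q : ℝ} (h : q ≤ 1) (a : Fin 4) : letterFactor q a ≤ 1 := by
  simp only [letterFactor]; split_ifs <;> simp [h]

theorem l2_damp_le {n : ℕ} {q : ℝ} (h0 : 0 ≤ q) (h1 : q ≤ 1) (j : Fin n) (v : PStr n → ℝ) :
    l2 (damp q j v) ≤ l2 v := by
  refine l2_le fun P => ?_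
  rw [damp_apply, abs_mul, abs_of_nonneg (letterFactor_nonneg h0 _)]
  exact mul_le_of_le_one_left (abs_nonneg _) (letterFactor_le_one h1 _)

theorem damp_sub {n : ℕ} (q : ℝ) (j : Fin n) (v w : PStr n → ℝ) :
    damp q j (v - w) = damp q j v - damp q j w := by
  funext P; simp only [damp_apply, Pi.sub_apply, mul_sub]

theorem l2_noisyStep_le {n : ℕ} {q : ℝ} (h0 : 0 ≤ q) (h1 : q ≤ 1) (g : Gate n)
    (v : PStr n → ℝ) : l2 (g.noisyStep q v) ≤ l2 v :=
  (l2_damp_le h0 h1 _ _).trans ((l2_damp_le h0 h1 _ _).trans (l2_conjStep g v).le)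

theorem Gate.noisyStep_sub {n : ℕ} (q : ℝ) (g : Gate n) (v w : PStr n → ℝ) :
    g.noisyStep q (v - w) = g.noisyStep q v - g.noisyStep q w := by
  simp only [Gate.noisyStep, Gate.conjStep_sub, damp_sub]

/-- Both sides are the product of the factors of `P i`, `P j`, `a`, `b` and of all letters of `P`
elsewhere. This is the identity behind postponing the global noise: its part on the two qubits
trades places with the noise of the gate, and the rest commutes with the gate. -/
theorem pow_weight_setTwo {n : ℕ} {i j : Fin n} (h : i ≠ j) (q : ℝ) (P : PStr n) (a b : Fin 4) :
    letterFactor q (P j) * letterFactor q (P i) * q ^ weight (setTwo i j P a b)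
      = q ^ weight P * (letterFactor q b * letterFactor q a) := by
  rw [pow_weight, pow_weight]
  have split : ∀ Q : PStr n, ∏ k, letterFactor q (Q k) = letterFactor q (Q i) *
      (letterFactor q (Q j) * ∏ k ∈ (Finset.univ.erase i).erase j, letterFactor q (Q k)) := by
    intro Q
    rw [← Finset.mul_prod_erase _ _ (Finset.mem_univ i),
      ← Finset.mul_prod_erase _ _ (Finset.mem_erase.2 ⟨h.symm, Finset.mem_univ j⟩)]
  rw [split, split P, setTwo_fst h, setTwo_snd]
  have : ∏ k ∈ (Finset.univ.erase i).erase j, letterFactor q (setTwo i j P a b k)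
      = ∏ k ∈ (Finset.univ.erase i).erase j, letterFactor q (P k) := by
    refine Finset.prod_congr rfl fun k hk => ?_
    have hj := Finset.ne_of_mem_erase hk
    have hi := Finset.ne_of_mem_erase (Finset.mem_of_mem_erase hk)
    rw [setTwo_other _ _ _ hi hj]
  rw [this]
  ring

/-- Noise on all qubits can be postponed until after a noisy gate. -/
theorem Gate.noisyStep_dampAll {n : ℕ} (q : ℝ) (g : Gate n) (v : PStr n → ℝ) :
    g.noisyStep q (dampAll q v) = dampAll q (g.conjStep (damp q g.snd (damp q g.fst v))) := by
  funext P
  simp only [Gate.noisyStep, damp_apply, dampAll, Gate.conjStep, Finset.mul_sum,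
    setTwo_fst g.ne, setTwo_snd]
  refine Finset.sum_congr rfl fun a _ => Finset.sum_congr rfl fun b _ => ?_
  linear_combination (g.ptm a b (P g.fst) (P g.snd) * v (setTwo g.fst g.snd P a b)) *
    pow_weight_setTwo g.ne q P a b

/-! ### Truncation of high-weight strings -/

/-- Discarding all strings of weight above `ℓ`. -/
def trunc {n : ℕ} (ℓ : ℕ) (v : PStr n → ℝ) : PStr n → ℝ :=
  fun P => if weight P ≤ ℓ then v P else 0

/-- The evolution in which high-weight strings are discarded after every gate. -/
def truncEvolve {n : ℕ} (q : ℝ) (ℓ : ℕ) (C : Circuit n) (v : PStr n → ℝ) : PStr n → ℝ :=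
  C.gates.foldl (fun v g => trunc ℓ (g.noisyStep q v)) (trunc ℓ (dampAll q v))

theorem l2_trunc_le {n : ℕ} (ℓ : ℕ) (v : PStr n → ℝ) : l2 (trunc ℓ v) ≤ l2 v := by
  refine l2_le fun P => ?_
  simp only [trunc]; split_ifs <;> simp

/-- Both maps are diagonal in the Pauli basis. Hence a truncated vector is again of the damped form
on which the error analysis rests. -/
theorem trunc_dampAll {n : ℕ} (q : ℝ) (ℓ : ℕ) (v : PStr n → ℝ) :
    trunc ℓ (dampAll q v) = dampAll q (trunc ℓ v) := by
  funext P
  simp only [trunc, dampAll]; split_ifs <;> simp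

/-- Every discarded string has weight at least ℓ + 1 and is damped accordingly. -/
theorem l2_sub_trunc_dampAll {n : ℕ} {q : ℝ} (h0 : 0 ≤ q) (h1 : q ≤ 1) (ℓ : ℕ)
    (v : PStr n → ℝ) : l2 (dampAll q v - trunc ℓ (dampAll q v)) ≤ q ^ (ℓ + 1) * l2 v := by
  refine l2_le_mul (by positivity) fun P => ?_
  simp only [Pi.sub_apply, trunc]
  split_ifs with h
  · simpa using by positivity
  · rw [sub_zero, dampAll, abs_mul, abs_of_nonneg (by positivity)]
    exact mul_le_mul_of_nonneg_right (pow_le_pow_of_le_one h0 h1 (by omega)) (abs_nonneg _)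

/-- The truncated vector is carried along as `dampAll q u`, where `u` never grows: each noisy gate
passes through the damping. Thus each gate contributes one truncation error, and earlier errors only
shrink since noisy steps are contractions. -/
theorem l2_foldl_sub_trunc {n : ℕ} {q : ℝ} (h0 : 0 ≤ q) (h1 : q ≤ 1) (ℓ : ℕ)
    (l : List (Gate n)) (w u : PStr n → ℝ) :
    l2 (l.foldl (fun v g => g.noisyStep q v) w
        - l.foldl (fun v g => trunc ℓ (g.noisyStep q v)) (dampAll q u))
      ≤ l2 (w - dampAll q u) + l.length * (q ^ (ℓ + 1) * l2 u) := by
  induction l generalizing w u with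
  | nil => simp
  | cons g l ih =>
    set u' := g.conjStep (damp q g.snd (damp q g.fst u)) with hu'
    have hu : l2 u' ≤ l2 u := by
      rw [hu', l2_conjStep]
      exact (l2_damp_le h0 h1 _ _).trans (l2_damp_le h0 h1 _ _)
    have hs : g.noisyStep q (dampAll q u) = dampAll q u' := g.noisyStep_dampAll q u
    have ht : l2 (trunc ℓ u') ≤ l2 u := (l2_trunc_le _ _).trans hu
    rw [List.foldl_cons, List.foldl_cons, hs, trunc_dampAll]
    refine (ih _ _).trans ?_
    have h2 : l2 (g.noisyStep q w - dampAll q (trunc ℓ u'))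
        ≤ l2 (w - dampAll q u) + q ^ (ℓ + 1) * l2 u := by
      -- The intermediate point is the image of the damped vector before truncation; it separates
      -- the inherited error from the new one.
      refine (l2_sub_le _ (dampAll q u') _).trans (add_le_add ?_ ?_)
      · rw [← hs, ← Gate.noisyStep_sub]
        exact l2_noisyStep_le h0 h1 _ _
      · rw [← trunc_dampAll]
        exact (l2_sub_trunc_dampAll h0 h1 _ _).trans
          (mul_le_mul_of_nonneg_left hu (by positivity))
    have h3 : (l.length : ℝ) * (q ^ (ℓ + 1) * l2 (trunc ℓ u'))
        ≤ l.length * (q ^ (ℓ + 1) * l2 u) := by gcongr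
    rw [List.length_cons]
    push_cast
    linarith

/-- The truncation error. -/
theorem l2_noisyEvolve_sub_truncEvolve {n : ℕ} {q : ℝ} (h0 : 0 ≤ q) (h1 : q ≤ 1) (ℓ : ℕ)
    (C : Circuit n) (v : PStr n → ℝ) :
    l2 (noisyEvolve q C v - truncEvolve q ℓ C v)
      ≤ (C.gates.length + 1) * (q ^ (ℓ + 1) * l2 v) := by
  rw [noisyEvolve, truncEvolve, dampList_finRange]
  have h := l2_foldl_sub_trunc h0 h1 ℓ C.gates (dampAll q v) (trunc ℓ v)
  rw [← trunc_dampAll] at h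
  have h2 : (C.gates.length : ℝ) * (q ^ (ℓ + 1) * l2 (trunc ℓ v))
      ≤ C.gates.length * (q ^ (ℓ + 1) * l2 v) := by
    have := l2_trunc_le ℓ v
    gcongr
  have h3 := l2_sub_trunc_dampAll h0 h1 ℓ v
  linarith

theorem trunc_of_le {n ℓ : ℕ} (h : n ≤ ℓ) (v : PStr n → ℝ) : trunc ℓ v = v := by
  funext P
  simp only [trunc, if_pos ((weight_le P).trans h)]

theorem truncEvolve_of_le {n ℓ : ℕ} (h : n ≤ ℓ) (q : ℝ) (C : Circuit n) (v : PStr n → ℝ) :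
    truncEvolve q ℓ C v = noisyEvolve q C v := by
  simp only [truncEvolve, noisyEvolve, trunc_of_le h, dampList_finRange]

/-- No string has weight above `n`. The cap keeps the threshold polynomially bounded however small
the noise rate is. -/
theorem truncEvolve_min {n : ℕ} (ℓ : ℕ) (q : ℝ) (C : Circuit n) (v : PStr n → ℝ) :
    truncEvolve q (min n ℓ) C v = truncEvolve q ℓ C v := by
  rcases le_total n ℓ with h | h
  · rw [min_eq_left h, truncEvolve_of_le le_rfl, truncEvolve_of_le h]
  · rw [min_eq_right h]

/-! ### Perturbation of the noise rate -/

theorem l2_damp_sub_damp {n : ℕ} {q r : ℝ} (h0 : 0 ≤ q) (h1 : q ≤ 1) (j : Fin n)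
    (v w : PStr n → ℝ) :
    l2 (damp q j v - damp r j w) ≤ l2 (v - w) + |q - r| * l2 w := by
  refine (l2_sub_le _ (damp q j w) _).trans (add_le_add ?_ ?_)
  · rw [← damp_sub]; exact l2_damp_le h0 h1 _ _
  · refine l2_le_mul (abs_nonneg _) fun P => ?_
    simp only [Pi.sub_apply, damp]
    split_ifs
    · simpa using by positivity
    · rw [← sub_mul, abs_mul]

theorem l2_dampList_le {n : ℕ} {q : ℝ} (h0 : 0 ≤ q) (h1 : q ≤ 1) (l : List (Fin n))
    (v : PStr n → ℝ) : l2 (dampList q l v) ≤ l2 v := by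
  induction l generalizing v with
  | nil => exact le_rfl
  | cons j l ih => exact (ih _).trans (l2_damp_le h0 h1 _ _)

theorem l2_dampList_sub {n : ℕ} {q r : ℝ} (h0 : 0 ≤ q) (h1 : q ≤ 1) (r0 : 0 ≤ r) (r1 : r ≤ 1)
    (l : List (Fin n)) (v w : PStr n → ℝ) :
    l2 (dampList q l v - dampList r l w) ≤ l2 (v - w) + l.length * (|q - r| * l2 w) := by
  induction l generalizing v w with
  | nil => simp [dampList]
  | cons j l ih =>
    have h := ih (damp q j v) (damp r j w)
    have h2 := l2_damp_sub_damp h0 h1 j v w (r := r)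
    have h3 : (l.length : ℝ) * (|q - r| * l2 (damp r j w)) ≤ l.length * (|q - r| * l2 w) := by
      have := l2_damp_le r0 r1 j w
      gcongr
    simp only [dampList, List.foldl_cons, List.length_cons] at h ⊢
    push_cast
    linarith

theorem l2_foldl_sub {n : ℕ} {q r : ℝ} (h0 : 0 ≤ q) (h1 : q ≤ 1) (r0 : 0 ≤ r) (r1 : r ≤ 1)
    (l : List (Gate n)) (v w : PStr n → ℝ) :
    l2 (l.foldl (fun v g => g.noisyStep q v) v - l.foldl (fun v g => g.noisyStep r v) w)
      ≤ l2 (v - w) + l.length * (2 * |q - r| * l2 w) := by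
  induction l generalizing v w with
  | nil => simp
  | cons g l ih =>
    have h := ih (g.noisyStep q v) (g.noisyStep r w)
    have h2 : l2 (g.noisyStep q v - g.noisyStep r w) ≤ l2 (v - w) + 2 * |q - r| * l2 w := by
      have e1 := l2_damp_sub_damp h0 h1 g.snd (damp q g.fst (g.conjStep v))
        (damp r g.fst (g.conjStep w)) (r := r)
      have e2 := l2_damp_sub_damp h0 h1 g.fst (g.conjStep v) (g.conjStep w) (r := r)
      have e3 := l2_damp_le r0 r1 g.fst (g.conjStep w)
      rw [← Gate.conjStep_sub, l2_conjStep, l2_conjStep] at e2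
      rw [l2_conjStep] at e3
      have e4 := mul_le_mul_of_nonneg_left e3 (abs_nonneg (q - r))
      simp only [Gate.noisyStep] at *
      linarith
    have h3 : (l.length : ℝ) * (2 * |q - r| * l2 (g.noisyStep r w))
        ≤ l.length * (2 * |q - r| * l2 w) := by
      have := l2_noisyStep_le r0 r1 g w
      gcongr
    simp only [List.foldl_cons, List.length_cons] at h ⊢
    push_cast
    linarith

/-- A telescoping estimate over single-qubit channels: `n` of them form the read-out noise and two
belong to each gate. All steps are contractions, so the differences simply add up. -/
theorem l2_noisyEvolve_sub {n : ℕ} {q r : ℝ} (h0 : 0 ≤ q) (h1 : q ≤ 1) (r0 : 0 ≤ r) (r1 : r ≤ 1)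
    (C : Circuit n) (v : PStr n → ℝ) :
    l2 (noisyEvolve q C v - noisyEvolve r C v) ≤ (n + 2 * C.gates.length) * (|q - r| * l2 v) := by
  have h := l2_foldl_sub h0 h1 r0 r1 C.gates (dampList q (List.finRange n) v)
    (dampList r (List.finRange n) v)
  have h2 := l2_dampList_sub h0 h1 r0 r1 (List.finRange n) v v
  have h3 : (C.gates.length : ℝ) * (2 * |q - r| * l2 (dampList r (List.finRange n) v))
      ≤ C.gates.length * (2 * |q - r| * l2 v) := by
    have := l2_dampList_le r0 r1 (List.finRange n) v
    gcongr
  have h4 : l2 (v - v) = 0 := by simp [l2]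
  rw [h4, List.length_finRange] at h2
  simp only [noisyEvolve]
  linarith

/-! ### Root mean square over a low-average ensemble -/

theorem rootMeanSquare_eq {m : ℕ} (f : Fin m → ℝ) :
    rootMeanSquare f = l2 f / Real.sqrt m := by
  rw [rootMeanSquare, l2, Real.sqrt_div' _ (Nat.cast_nonneg m)]

theorem rootMeanSquare_add_le {m : ℕ} (f g : Fin m → ℝ) :
    rootMeanSquare (fun i => f i + g i) ≤ rootMeanSquare f + rootMeanSquare g := by
  simp only [rootMeanSquare_eq, ← add_div]
  exact div_le_div_of_nonneg_right (l2_add_le f g) (Real.sqrt_nonneg _)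

/-- The variance of `W` in the state `ρ` is nonnegative: expand tr(ρ (W - μ)²) ≥ 0 at the mean μ. -/
theorem expectation_sq_le {n : ℕ} {ρ W : QOp n} (hρ : IsState ρ) (hW : W.conjTranspose = W) :
    expectation ρ W ^ 2 ≤ (ρ * (W * W)).trace.re := by
  set μ := expectation ρ W with hμ
  set X : QOp n := W - (μ : ℂ) • 1 with hX
  have hXH : X.conjTranspose = X := by simp [hX, hW]
  have h1 := (hρ.1.mul_mul_conjTranspose_same X).trace_nonneg
  rw [hXH, Matrix.mul_assoc, Matrix.trace_mul_comm, Matrix.mul_assoc] at h1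
  have e : (ρ * (X * X)).trace
      = (ρ * (W * W)).trace - 2 * μ * (ρ * W).trace + μ ^ 2 * ρ.trace := by
    simp only [hX, Matrix.mul_sub, Matrix.sub_mul, Matrix.mul_smul, Matrix.smul_mul, Matrix.mul_one,
      Matrix.one_mul, Matrix.trace_sub, Matrix.trace_smul, smul_eq_mul]
    ring
  rw [e, hρ.2] at h1
  have h2 := (Complex.le_def.1 h1).1
  have h3 : (ρ * W).trace.re = μ := rfl
  have e2 : ((ρ * (W * W)).trace - 2 * (μ : ℂ) * (ρ * W).trace + (μ : ℂ) ^ 2 * 1).re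
      = (ρ * (W * W)).trace.re - 2 * μ * μ + μ ^ 2 := by
    rw [← h3]
    rw [h3, mul_one, Complex.add_re, Complex.sub_re, ← Complex.ofReal_pow, Complex.ofReal_re,
      mul_assoc, ← Complex.ofReal_ofNat, Complex.re_ofReal_mul, Complex.re_ofReal_mul, h3]
    ring
  rw [e2] at h2
  simp only [Complex.zero_re] at h2
  nlinarith

/-- As `W` is Hermitian, tr(R W²) is the sum of ⟨w, R w⟩ over the columns w of `W`, and tr(W²) is
the sum of their squared norms. -/
theorem trace_mul_sq_le {n : ℕ} (R W : QOp n) (hW : W.conjTranspose = W) :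
    (R * (W * W)).trace.re
      ≤ ‖Matrix.toEuclideanCLM (n := Bits n) (𝕜 := ℂ) R‖ * (W * W).trace.re := by
  have e1 : ∀ A : QOp n, (A * (W * W)).trace.re
      = ∑ x, (inner ℂ (WithLp.toLp 2 (fun y => W y x))
        (Matrix.toEuclideanCLM (n := Bits n) (𝕜 := ℂ) A (WithLp.toLp 2 (fun y => W y x)))).re := by
    intro A
    have : (A * (W * W)).trace = (W.conjTranspose * (A * W)).trace := by
      rw [hW, ← Matrix.mul_assoc, Matrix.trace_mul_comm]
    rw [this, Matrix.trace, Complex.re_sum]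
    refine Finset.sum_congr rfl fun x _ => ?_
    rw [Matrix.toEuclideanCLM_toLp, EuclideanSpace.inner_toLp_toLp]
    simp only [Matrix.diag_apply, Matrix.mul_apply, Matrix.conjTranspose_apply, dotProduct,
      Matrix.mulVec, Pi.star_apply]
    congr 1
    exact Finset.sum_congr rfl fun y _ => mul_comm _ _
  have e2 : (W * W).trace.re = ∑ x, ‖WithLp.toLp 2 (fun y => W y x)‖ ^ 2 := by
    have := e1 1
    rw [Matrix.one_mul] at this
    rw [this]
    refine Finset.sum_congr rfl fun x _ => ?_
    rw [map_one, one_apply_eq_self, inner_self_eq_norm_sq_to_K]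
    norm_cast
  rw [e1, e2, Finset.mul_sum]
  refine Finset.sum_le_sum fun x _ => ?_
  refine (Complex.re_le_norm _).trans ((norm_inner_le_norm _ _).trans ?_)
  have := (Matrix.toEuclideanCLM (n := Bits n) (𝕜 := ℂ) R).le_opNorm
    (WithLp.toLp 2 (fun y => W y x))
  nlinarith [norm_nonneg (WithLp.toLp 2 (fun y => W y x))]

/-- The variance inequality replaces the mean of the squares by tr(σ W²), with σ the uniform
mixture. This is at most ‖σ‖ tr(W²), and the factor 2^n in tr(W²) cancels the one in the low-average
bound. -/
theorem Experiment.LowAverage.rootMeanSquare_le {E : Experiment} {c : ℝ} (hE : E.LowAverage c)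
    (n : ℕ) (w : PStr n → ℝ) :
    rootMeanSquare (fun i => ∑ P, w P * expectation (E.state n i) (pauli P))
      ≤ Real.sqrt c * l2 w := by
  have hc : 0 ≤ c := by
    have := (norm_nonneg _).trans (hE n)
    by_contra h
    exact absurd this (not_le.2 (div_neg_of_neg_of_pos (not_le.1 h) (by positivity)))
  set W := pauliSum w with hW
  have hWH : W.conjTranspose = W := pauliSum_conjTranspose w
  rw [l2, ← Real.sqrt_mul hc, rootMeanSquare]
  refine Real.sqrt_le_sqrt ?_
  simp only [← expectation_pauliSum]
  have hm : (0 : ℝ) < E.size n := by exact_mod_cast E.size_pos n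
  have h1 : (∑ i, expectation (E.state n i) W ^ 2) / (E.size n : ℝ)
      ≤ ((((E.size n : ℂ))⁻¹ • ∑ i, E.state n i) * (W * W)).trace.re := by
    rw [Matrix.smul_mul, Matrix.trace_smul, Matrix.sum_mul, Matrix.trace_sum, smul_eq_mul,
      ← Complex.ofReal_natCast, ← Complex.ofReal_inv, Complex.re_ofReal_mul, Complex.re_sum,
      div_eq_inv_mul]
    refine mul_le_mul_of_nonneg_left ?_ (by positivity)
    exact Finset.sum_le_sum fun i _ => expectation_sq_le (E.isState n i) hWH
  refine h1.trans ((trace_mul_sq_le _ W hWH).trans ?_)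
  have h2 := hE n
  have h3 : (W * W).trace.re = 2 ^ n * ∑ P, w P ^ 2 := by
    rw [hW, trace_pauliSum_sq, Complex.ofReal_re]
  rw [h3]
  calc _ ≤ c / 2 ^ n * (2 ^ n * ∑ P, w P ^ 2) :=
        mul_le_mul_of_nonneg_right h2 (by positivity)
    _ = _ := by field_simp

/-- The value computed by the truncated evolution at noise parameter `q`. -/
def Experiment.truncValue (E : Experiment) (n : ℕ) (q : ℝ) (ℓ : ℕ) (i : Fin (E.size n)) : ℝ :=
  ∑ P, truncEvolve q ℓ (E.circuit n) (pauliCoeff (E.obs n)) P * expectation (E.state n i) (pauli P)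

/-- The two terms are the truncation error at the parameter `q` and the error of using `q` in place
of exp(-γ). -/
theorem Experiment.LowAverage.truncValue_sub_noisyValue {E : Experiment} {c : ℝ}
    (hE : E.LowAverage c) (n ℓ : ℕ) {γ q : ℝ} (hγ : 0 ≤ γ) (h0 : 0 ≤ q)
    (hq : q ≤ Real.exp (-γ)) :
    rootMeanSquare (fun i => E.truncValue n q ℓ i - E.noisyValue n γ i)
      ≤ Real.sqrt c * (((E.circuit n).gates.length + 1) * q ^ (ℓ + 1)
        + (n + 2 * (E.circuit n).gates.length) * (Real.exp (-γ) - q)) := by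
  have he : Real.exp (-γ) ≤ 1 := Real.exp_le_one_iff.2 (by linarith)
  have h1 := l2_noisyEvolve_sub_truncEvolve h0 (hq.trans he) ℓ (E.circuit n)
    (pauliCoeff (E.obs n))
  have h2 := l2_noisyEvolve_sub (Real.exp_nonneg (-γ)) he h0 (hq.trans he) (E.circuit n)
    (pauliCoeff (E.obs n))
  rw [l2_pauliCoeff (E.obs_normalized n), mul_one] at h1 h2
  rw [abs_of_nonneg (by linarith)] at h2
  have h3 := l2_sub_le (noisyEvolve (Real.exp (-γ)) (E.circuit n) (pauliCoeff (E.obs n)))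
    (noisyEvolve q (E.circuit n) (pauliCoeff (E.obs n)))
    (truncEvolve q ℓ (E.circuit n) (pauliCoeff (E.obs n)))
  have h4 := hE.rootMeanSquare_le n (truncEvolve q ℓ (E.circuit n) (pauliCoeff (E.obs n))
    - noisyEvolve (Real.exp (-γ)) (E.circuit n) (pauliCoeff (E.obs n)))
  have h5 : ∀ v w : PStr n → ℝ, l2 (v - w) = l2 (w - v) := by
    intro v w; simp only [l2_eq_norm, WithLp.toLp_sub]; exact norm_sub_rev _ _
  rw [h5] at h4
  have e : (fun i => E.truncValue n q ℓ i - E.noisyValue n γ i)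
      = fun i => ∑ P, (truncEvolve q ℓ (E.circuit n) (pauliCoeff (E.obs n))
    - noisyEvolve (Real.exp (-γ)) (E.circuit n) (pauliCoeff (E.obs n))) P
      * expectation (E.state n i) (pauli P) := by
    funext i
    rw [Experiment.truncValue, Experiment.noisyValue,
      expectation_noisy _ _ _ (E.obs_normalized n).1, ← Finset.sum_sub_distrib]
    exact Finset.sum_congr rfl fun P _ => by rw [Pi.sub_apply]; ring
  rw [e]
  exact h4.trans (mul_le_mul_of_nonneg_left (by linarith) (Real.sqrt_nonneg _))

/-- With damping 1 there is no noise, and with threshold `n` no truncation. This is the fallback for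
those `n` at which no suitable noise rate is available. -/
theorem Experiment.truncValue_exact (E : Experiment) (n : ℕ) (i : Fin (E.size n)) :
    E.truncValue n 1 n i = E.idealValue n i := by
  rw [Experiment.truncValue, Experiment.idealValue, ← Circuit.noisy_zero,
    expectation_noisy _ _ _ (E.obs_normalized n).1, truncEvolve_of_le le_rfl]
  simp

/-! ### A calculus for programs and their running times -/

/-- The number of operations in the text of a program. -/
def Prog.size : Prog → ℕ
  | .skip => 1
  | .setNat addr val => addr.cost + val.cost + 1
  | .setReal addr val => addr.cost + val.cost + 1
  | .seq P Q => P.size + Q.size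
  | .ifNatLt a b P Q => a.cost + b.cost + 1 + P.size + Q.size
  | .ifRealLt a b P Q => a.cost + b.cost + 1 + P.size + Q.size
  | .whileLt a b P => a.cost + b.cost + 1 + P.size

/-- The program halts in a state satisfying `post`, after executing every operation of its text at
most `m` times on average. -/
def WP {n : ℕ} (I : Input n) (P : Prog) (s : Mem) (m : ℕ) (post : Mem → Prop) : Prop :=
  ∃ t ≤ P.size * m, ∃ s', Exec I P s t s' ∧ post s'

section WP
variable {n : ℕ} {I : Input n} {P Q : Prog} {s : Mem} {m : ℕ} {post : Mem → Prop}

theorem WP.mono {post' : Mem → Prop} {m' : ℕ} (h : WP I P s m post) (hm : m ≤ m')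
    (hp : ∀ s', post s' → post' s') : WP I P s m' post' := by
  obtain ⟨t, ht, s', he, hs⟩ := h
  exact ⟨t, ht.trans (Nat.mul_le_mul_left _ hm), s', he, hp _ hs⟩

theorem WP.imp {post' : Mem → Prop} (h : WP I P s m post)
    (hp : ∀ s', post s' → post' s') : WP I P s m post' := h.mono le_rfl hp

theorem WP.skip (hm : 1 ≤ m) (h : post s) : WP I .skip s m post :=
  ⟨1, by simpa [Prog.size] using hm, s, .skip s, h⟩

theorem WP.setNat {addr val : NExpr} (hm : 1 ≤ m)
    (h : post { s with nat := Function.update s.nat (addr.eval I s) (val.eval I s) }) :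
    WP I (.setNat addr val) s m post :=
  ⟨_, Nat.le_mul_of_pos_right _ hm, _, .setNat addr val s, h⟩

theorem WP.setReal {addr : NExpr} {val : RExpr} (hm : 1 ≤ m)
    (h : post { s with real := Function.update s.real (addr.eval I s) (val.eval I s) }) :
    WP I (.setReal addr val) s m post :=
  ⟨_, Nat.le_mul_of_pos_right _ hm, _, .setReal addr val s, h⟩

/-- Text size is additive, so one bound `m` serves both halves. Counting executions per operation of
the text avoids computing any actual program sizes. -/
theorem WP.seq (h : WP I P s m fun s' => WP I Q s' m post) : WP I (.seq P Q) s m post := by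
  obtain ⟨t, ht, s', he, t', ht', s'', he', hp⟩ := h
  exact ⟨t + t', by rw [Prog.size, Nat.add_mul]; omega, s'', .seq he he', hp⟩

theorem WP.ifNat {a b : NExpr} (hm : 1 ≤ m) (ht : a.eval I s < b.eval I s → WP I P s m post)
    (hf : ¬ a.eval I s < b.eval I s → WP I Q s m post) : WP I (.ifNatLt a b P Q) s m post := by
  have hc : a.cost + b.cost + 1 ≤ (a.cost + b.cost + 1) * m := Nat.le_mul_of_pos_right _ hm
  by_cases h : a.eval I s < b.eval I s
  · obtain ⟨t, h1, s', he, hp⟩ := ht h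
    refine ⟨_, ?_, s', .ifNat_true h he, hp⟩
    rw [Prog.size, Nat.add_mul, Nat.add_mul (a.cost + b.cost + 1)]
    omega
  · obtain ⟨t, h1, s', he, hp⟩ := hf h
    refine ⟨_, ?_, s', .ifNat_false h he, hp⟩
    rw [Prog.size, Nat.add_mul, Nat.add_mul (a.cost + b.cost + 1)]
    omega

/-- The rule for loops with a known number of iterations. -/
theorem WP.while {a b : NExpr} (inv : ℕ → Mem → Prop) (N : ℕ) {M : ℕ} (hm : 1 ≤ m)
    (hM : (N + 1) * m ≤ M) (h0 : inv 0 s)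
    (hlt : ∀ k < N, ∀ s, inv k s → a.eval I s < b.eval I s)
    (hstep : ∀ k < N, ∀ s, inv k s → WP I P s m (inv (k + 1)))
    (hend : ∀ s, inv N s → ¬ a.eval I s < b.eval I s) :
    WP I (.whileLt a b P) s M (inv N) := by
  -- With `r` iterations left there remain `r` passes and one more test, the failing one; that test
  -- is the reason for `N + 1` in the bound.
  have key : ∀ r k s, k + r = N → inv k s →
      ∃ t ≤ r * (a.cost + b.cost + 1 + P.size * m) + (a.cost + b.cost + 1), ∃ s',
        Exec I (.whileLt a b P) s t s' ∧ inv N s' := by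
    intro r
    induction r with
    | zero =>
      intro k s hk hi
      obtain rfl : k = N := by omega
      exact ⟨_, by omega, s, .while_done (hend s hi), hi⟩
    | succ r ih =>
      intro k s hk hi
      obtain ⟨t, ht, s', he, hi'⟩ := hstep k (by omega) s hi
      obtain ⟨t', ht', s'', he', hi''⟩ := ih (k + 1) s' (by omega) hi'
      refine ⟨_, ?_, s'', .while_step (hlt k (by omega) s hi) he he', hi''⟩
      rw [Nat.add_mul]
      omega
  obtain ⟨t, ht, s', he, hi⟩ := key N 0 s (by omega) h0
  refine ⟨t, ht.trans ?_, s', he, hi⟩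
  rw [Prog.size]
  refine le_trans ?_ (Nat.mul_le_mul_left _ hM)
  have h1 : (N + 1) * (a.cost + b.cost + 1) ≤ (N + 1) * (a.cost + b.cost + 1) * m :=
    Nat.le_mul_of_pos_right _ hm
  nlinarith [Nat.zero_le (P.size * m)]

end WP

/-! ### Building blocks -/

namespace NExpr

/-- The contents of a memory cell. -/
def cell (k : ℕ) : NExpr := .read (.const k)

variable {n : ℕ} (I : Input n) (s : Mem)

@[simp] theorem eval_const (k : ℕ) : (const k).eval I s = k := rfl
@[simp] theorem eval_read (a : NExpr) : (read a).eval I s = s.nat (a.eval I s) := rfl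
@[simp] theorem eval_cell (k : ℕ) : (cell k).eval I s = s.nat k := rfl
@[simp] theorem eval_add (a b : NExpr) : (add a b).eval I s = a.eval I s + b.eval I s := rfl
@[simp] theorem eval_sub (a b : NExpr) : (sub a b).eval I s = a.eval I s - b.eval I s := rfl
@[simp] theorem eval_qubits : qubits.eval I s = n := rfl
@[simp] theorem eval_param (j : ℕ) : (param j).eval I s = I.param j := rfl
@[simp] theorem eval_depth : depth.eval I s = List.length I.circuit := rfl

end NExpr

namespace RExpr

/-- The sum of a list of expressions. -/
def sum (l : List RExpr) : RExpr := l.foldr .add (.ofNat (.const 0))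

/-- An integer constant. -/
def int (z : ℤ) : RExpr := .sub (.ofNat (.const z.toNat)) (.ofNat (.const (-z).toNat))

variable {n : ℕ} (I : Input n) (s : Mem)

@[simp] theorem eval_ofNat (a : NExpr) : (RExpr.ofNat a).eval I s = (a.eval I s : ℝ) := rfl
@[simp] theorem eval_read (a : NExpr) : (read a).eval I s = s.real (a.eval I s) := rfl
@[simp] theorem eval_add (a b : RExpr) : (add a b).eval I s = a.eval I s + b.eval I s := rfl
@[simp] theorem eval_sub (a b : RExpr) : (sub a b).eval I s = a.eval I s - b.eval I s := rfl
@[simp] theorem eval_mul (a b : RExpr) : (mul a b).eval I s = a.eval I s * b.eval I s := rfl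
@[simp] theorem eval_div (a b : RExpr) : (div a b).eval I s = a.eval I s / b.eval I s := rfl

@[simp] theorem eval_sum (l : List RExpr) :
    (sum l).eval I s = (l.map fun e => e.eval I s).sum := by
  induction l with
  | nil => simp [sum]
  | cons e l ih => rw [List.map_cons, List.sum_cons, ← ih]; rfl

@[simp] theorem eval_int (z : ℤ) : (int z).eval I s = z := by
  have h : ((z.toNat : ℤ) - ((-z).toNat : ℤ) : ℤ) = z := by omega
  simp only [int, eval_sub, eval_ofNat, NExpr.eval_const]
  exact_mod_cast h

end RExpr

/-- Expressions for complex numbers. -/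
structure CExpr where
  re : RExpr
  im : RExpr

namespace CExpr

variable {n : ℕ}

/-- The value of a complex expression. -/
def eval (I : Input n) (s : Mem) (e : CExpr) : ℂ := ⟨e.re.eval I s, e.im.eval I s⟩

/-- Multiplication of complex expressions. -/
def mul (e f : CExpr) : CExpr :=
  ⟨.sub (.mul e.re f.re) (.mul e.im f.im), .add (.mul e.re f.im) (.mul e.im f.re)⟩

/-- Complex conjugation of an expression. -/
def conj (e : CExpr) : CExpr := ⟨e.re, .sub (.int 0) e.im⟩

variable (I : Input n) (s : Mem) (e f : CExpr)

theorem eval_mul : (e.mul f).eval I s = e.eval I s * f.eval I s := by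
  apply Complex.ext <;> simp [eval, mul]

theorem eval_conj : e.conj.eval I s = star (e.eval I s) := by
  apply Complex.ext <;> simp [eval, conj]

theorem re_eval : e.re.eval I s = (e.eval I s).re := rfl

end CExpr

/-- The entries of the Pauli matrices as Gaussian integers. -/
def pauliInt (a : Fin 4) (x y : Fin 2) : ℤ × ℤ :=
  match a, x, y with
  | 0, 0, 0 => (1, 0)
  | 0, 1, 1 => (1, 0)
  | 1, 0, 1 => (1, 0)
  | 1, 1, 0 => (1, 0)
  | 2, 0, 1 => (0, -1)
  | 2, 1, 0 => (0, 1)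
  | 3, 0, 0 => (1, 0)
  | 3, 1, 1 => (-1, 0)
  | _, _, _ => (0, 0)

theorem pauliInt_spec (a : Fin 4) (x y : Fin 2) :
    pauliOne a x y = ⟨(pauliInt a x y).1, (pauliInt a x y).2⟩ := by
  fin_cases a <;> fin_cases x <;> fin_cases y <;> apply Complex.ext <;> simp [pauliOne, pauliInt]

/-- An entry of a Pauli matrix as an expression. -/
def pauliOneExpr (a : Fin 4) (x y : Fin 2) : CExpr :=
  ⟨.int (pauliInt a x y).1, .int (pauliInt a x y).2⟩

/-- An entry of a two-qubit Pauli matrix as an expression. -/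
def pauliTwoExpr (a b : Fin 4) (x y : Fin 2 × Fin 2) : CExpr :=
  (pauliOneExpr a x.1 y.1).mul (pauliOneExpr b x.2 y.2)

theorem eval_pauliTwoExpr {n : ℕ} (I : Input n) (s : Mem) (a b : Fin 4) (x y : Fin 2 × Fin 2) :
    (pauliTwoExpr a b x y).eval I s = pauliTwo a b x y := by
  have h : ∀ (a : Fin 4) (x y : Fin 2), (pauliOneExpr a x y).eval I s = pauliOne a x y := by
    intro a x y
    rw [pauliInt_spec]
    simp [CExpr.eval, pauliOneExpr]
  rw [pauliTwoExpr, CExpr.eval_mul, h, h]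
  rfl

/-- An entry of the current gate. The current layer and the current gate are numbered by the cells
`9` and `10`. -/
def gateExpr (x y : Fin 2 × Fin 2) : CExpr :=
  ⟨.gateRe (.cell 9) (.cell 10) (.const x.1) (.const x.2) (.const y.1) (.const y.2),
    .gateIm (.cell 9) (.cell 10) (.const x.1) (.const x.2) (.const y.1) (.const y.2)⟩

theorem eval_gateExpr {n : ℕ} {I : Input n} {s : Mem} {g : Gate n}
    (h : I.circuit.gate? (s.nat 9) (s.nat 10) = some g) (x y : Fin 2 × Fin 2) :
    (gateExpr x y).eval I s = g.mat x y := by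
  apply Complex.ext <;> simp [CExpr.eval, gateExpr, RExpr.eval, Circuit.gateEntry, h]

/-- All pairs of bits. -/
def bitPairs : List (Fin 2 × Fin 2) := List.finRange 2 ×ˢ List.finRange 2

/-- All pairs of letters. -/
def letterPairs : List (Fin 4 × Fin 4) := List.finRange 4 ×ˢ List.finRange 4

theorem sum_product_finRange {k : ℕ} (f : Fin k × Fin k → ℝ) :
    ((List.finRange k ×ˢ List.finRange k).map f).sum = ∑ x, f x := by
  rw [← List.sum_toFinset f ((List.nodup_finRange k).product (List.nodup_finRange k))]
  refine Finset.sum_congr ?_ fun _ _ => rfl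
  ext ⟨a, b⟩
  simp

/-- An entry of the Pauli transfer matrix of the current gate as an expression. -/
def ptmExpr (a b p q : Fin 4) : RExpr :=
  .div (.sum (bitPairs.map fun x => .sum (bitPairs.map fun w => .sum (bitPairs.map fun z =>
    .sum (bitPairs.map fun y =>
      ((((gateExpr y x).conj.mul (pauliTwoExpr a b y z)).mul (gateExpr z w)).mul
        (pauliTwoExpr p q w x)).re))))) (.int 4)

theorem eval_ptmExpr {n : ℕ} {I : Input n} {s : Mem} {g : Gate n}
    (h : I.circuit.gate? (s.nat 9) (s.nat 10) = some g) (a b p q : Fin 4) :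
    (ptmExpr a b p q).eval I s = g.ptm a b p q := by
  simp only [ptmExpr, RExpr.eval_div, RExpr.eval_sum, RExpr.eval_int, List.map_map, bitPairs,
    sum_product_finRange, Function.comp_def, CExpr.re_eval, CExpr.eval_mul, CExpr.eval_conj,
    eval_gateExpr h, eval_pauliTwoExpr, Gate.ptm, Matrix.trace, Matrix.diag_apply,
    Matrix.mul_apply, Matrix.conjTranspose_apply, Complex.re_sum, Finset.sum_mul]
  norm_num

/-- The damping parameter, given by two of the integer parameters. -/
def Input.rate {n : ℕ} (I : Input n) : ℝ := (I.param 1 : ℝ) / (I.param 2 : ℝ)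

/-- The damping parameter as an expression. -/
def rateExpr : RExpr := .div (.ofNat (.param 1)) (.ofNat (.param 2))

@[simp] theorem eval_rateExpr {n : ℕ} (I : Input n) (s : Mem) :
    rateExpr.eval I s = I.rate := rfl

/-- The damping factor of a letter as an expression. -/
def factorExpr (a : Fin 4) : RExpr := if a = 0 then .int 1 else rateExpr

theorem eval_factorExpr {n : ℕ} (I : Input n) (s : Mem) (a : Fin 4) :
    (factorExpr a).eval I s = letterFactor I.rate a := by
  simp only [factorExpr, letterFactor]
  split_ifs <;> simp

/-- A sequence of assignments to constant addresses. -/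
def assignments {κ : Type*} (addr : κ → ℕ) (val : κ → RExpr) (l : List κ) : Prog :=
  l.foldr (fun k P => .seq (.setReal (.const (addr k)) (val k)) P) .skip

/-- The values depend on the memory for naturals only, so the assignments do not disturb one
another. The alternative that a cell is already correct carries finished assignments through the
induction. -/
theorem wp_assignments {κ : Type*} {n : ℕ} {I : Input n} {m : ℕ} (hm : 1 ≤ m) {addr : κ → ℕ}
    (hinj : Function.Injective addr) {val : κ → RExpr} {v : κ → ℝ} (l : List κ) (s : Mem)
    (hv : ∀ (s' : Mem), s'.nat = s.nat → ∀ k, (val k).eval I s' = v k) :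
    WP I (assignments addr val l) s m fun s' => s'.nat = s.nat ∧
      (∀ k, (k ∈ l ∨ s.real (addr k) = v k) → s'.real (addr k) = v k) ∧
      ∀ x, (∀ k, x ≠ addr k) → s'.real x = s.real x := by
  induction l generalizing s with
  | nil => exact WP.skip hm ⟨rfl, fun k hk => by simpa using hk, fun _ _ => rfl⟩
  | cons k l ih =>
    refine WP.seq (WP.setReal hm ?_)
    refine (ih ⟨s.nat, Function.update s.real (addr k) ((val k).eval I s)⟩
      fun s' hs' => hv s' hs').imp ?_
    rintro s' ⟨h1, h2, h3⟩
    refine ⟨h1, fun k' hk' => h2 k' ?_, fun x hx => ?_⟩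
    · by_cases e : k' = k
      · right
        subst e
        simp [hv s rfl]
      · rcases hk' with hk' | hk'
        · left; simpa [e] using hk'
        · right; simpa [hinj.ne e] using hk'
    · rw [h3 x hx]; simp [hx k]

/-! ### Enumeration of the Pauli strings of low weight -/

/-- The Pauli string with letters `P` as a number in base four. -/
def code {n : ℕ} (P : PStr n) : ℕ := finFunctionFinEquiv P

theorem code_lt {n : ℕ} (P : PStr n) : code P < 4 ^ n := (finFunctionFinEquiv P).isLt

theorem code_injective {n : ℕ} : Function.Injective (code (n := n)) := fun _ _ h =>
  finFunctionFinEquiv.injective (Fin.ext h)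

theorem code_eq_sum {n : ℕ} (P : PStr n) : code P = ∑ j, (P j : ℕ) * 4 ^ (j : ℕ) :=
  finFunctionFinEquiv_apply P

theorem sum_update_add {n : ℕ} (f : Fin n → Fin 4 → ℕ) (P : PStr n) (j : Fin n) (a : Fin 4) :
    ∑ k, f k (Function.update P j a k) + f j (P j) = ∑ k, f k (P k) + f j a := by
  rw [← Finset.add_sum_erase _ _ (Finset.mem_univ j),
    ← Finset.add_sum_erase _ (fun k => f k (P k)) (Finset.mem_univ j)]
  have : ∑ k ∈ Finset.univ.erase j, f k (Function.update P j a k)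
      = ∑ k ∈ Finset.univ.erase j, f k (P k) :=
    Finset.sum_congr rfl fun k hk => by
      rw [Function.update_of_ne (Finset.ne_of_mem_erase hk)]
  rw [this, Function.update_self]
  omega

theorem code_update {n : ℕ} (P : PStr n) (j : Fin n) (a : Fin 4) :
    code (Function.update P j a) + P j * 4 ^ (j : ℕ) = code P + a * 4 ^ (j : ℕ) := by
  simp only [code_eq_sum]
  exact sum_update_add (fun k b => (b : ℕ) * 4 ^ (k : ℕ)) P j a

theorem weight_update {n : ℕ} (P : PStr n) (j : Fin n) (a : Fin 4) :
    weight (Function.update P j a) + (if P j = 0 then 0 else 1)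
      = weight P + (if a = 0 then 0 else 1) :=
  sum_update_add (fun _ b => if b = 0 then 0 else 1) P j a

theorem code_setTwo {n : ℕ} {i j : Fin n} (h : i ≠ j) (P : PStr n) (a b : Fin 4) :
    code P - P i * 4 ^ (i : ℕ) - P j * 4 ^ (j : ℕ) + a * 4 ^ (i : ℕ) + b * 4 ^ (j : ℕ)
      = code (setTwo i j P a b) := by
  have h1 := code_update P i a
  have h2 := code_update (Function.update P i a) j b
  rw [Function.update_of_ne h.symm] at h2
  -- Both digits are summands of the code, hence the truncated subtractions are genuine ones.
  have h3 : P i * 4 ^ (i : ℕ) + P j * 4 ^ (j : ℕ) ≤ code P := by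
    rw [code_eq_sum, ← Finset.add_sum_erase _ _ (Finset.mem_univ i)]
    exact Nat.add_le_add_left (Finset.single_le_sum (f := fun k => (P k : ℕ) * 4 ^ (k : ℕ))
      (fun _ _ => Nat.zero_le _) (Finset.mem_erase.2 ⟨h.symm, Finset.mem_univ j⟩)) _
  rw [setTwo]
  omega

/-- The strings obtained from `P` by filling position `j`. -/
def children {n : ℕ} (ℓ : ℕ) (j : Fin n) (P : PStr n) : List (PStr n) :=
  if weight P < ℓ then [Function.update P j 1, Function.update P j 2, Function.update P j 3] else []

/-- The strings of weight at most `ℓ` that are supported on the first `k` positions. -/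
def strings (n ℓ : ℕ) : ℕ → List (PStr n)
  | 0 => [0]
  | k + 1 => if h : k < n then strings n ℓ k ++ (strings n ℓ k).flatMap (children ℓ ⟨k, h⟩)
      else strings n ℓ k

theorem mem_children {n ℓ : ℕ} {j : Fin n} {P Q : PStr n} :
    Q ∈ children ℓ j P ↔ weight P < ℓ ∧ ∃ a, a ≠ 0 ∧ Q = Function.update P j a := by
  rw [children]
  split_ifs with h
  · simp only [List.mem_cons, List.not_mem_nil, or_false, h, true_and]
    constructor
    · rintro (e | e | e)
      · exact ⟨1, by decide, e⟩
      · exact ⟨2, by decide, e⟩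
      · exact ⟨3, by decide, e⟩
    · rintro ⟨a, ha, e⟩
      fin_cases a
      · exact absurd rfl ha
      · exact Or.inl e
      · exact Or.inr (Or.inl e)
      · exact Or.inr (Or.inr e)
  · simp [h]

/-- A string supported on the first k + 1 positions is either trivial at position k or a child of
the string cleared there, whose weight is smaller by one. -/
theorem mem_strings {n ℓ k : ℕ} (hk : k ≤ n) {P : PStr n} :
    P ∈ strings n ℓ k ↔ weight P ≤ ℓ ∧ ∀ j : Fin n, k ≤ j → P j = 0 := by
  induction k generalizing P with
  | zero =>
    simp only [strings, List.mem_singleton, Nat.zero_le, true_imp_iff]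
    constructor
    · rintro rfl
      exact ⟨by simp [weight], fun _ => rfl⟩
    · exact fun h => funext h.2
  | succ k ih =>
    have hkn : k < n := hk
    simp only [strings, dif_pos hkn, List.mem_append, List.mem_flatMap, mem_children,
      ih (Nat.le_of_lt hkn)]
    constructor
    · rintro (⟨h1, h2⟩ | ⟨Q, ⟨h1, h2⟩, h3, a, ha, rfl⟩)
      · exact ⟨h1, fun j hj => h2 j (by omega)⟩
      · refine ⟨?_, fun j hj => ?_⟩
        · have := weight_update Q ⟨k, hkn⟩ a
          rw [h2 ⟨k, hkn⟩ le_rfl] at this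
          simp only [if_pos, if_neg ha] at this
          omega
        · rw [Function.update_of_ne (by rintro rfl; simp at hj)]
          exact h2 j (by omega)
    · rintro ⟨h1, h2⟩
      by_cases h0 : P ⟨k, hkn⟩ = 0
      · left
        refine ⟨h1, fun j hj => ?_⟩
        rcases Nat.eq_or_lt_of_le hj with e | e
        · rw [show j = ⟨k, hkn⟩ from Fin.ext e.symm, h0]
        · exact h2 j e
      · right
        have hw := weight_update P ⟨k, hkn⟩ 0
        simp only [if_neg h0, if_pos] at hw
        refine ⟨Function.update P ⟨k, hkn⟩ 0, ⟨by omega, fun j hj => ?_⟩, by omega,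
          P ⟨k, hkn⟩, h0, by simp⟩
        rcases Nat.eq_or_lt_of_le hj with e | e
        · rw [show j = ⟨k, hkn⟩ from Fin.ext e.symm, Function.update_self]
        · rw [Function.update_of_ne (by rintro rfl; simp at e)]
          exact h2 j e

/-- Earlier strings are trivial at position k, so clearing that position recovers the parent of a
child, and no child is an earlier string. -/
theorem nodup_strings {n ℓ k : ℕ} (hk : k ≤ n) : (strings n ℓ k).Nodup := by
  induction k with
  | zero => simp [strings]
  | succ k ih =>
    have hkn : k < n := hk
    have hz : ∀ P ∈ strings n ℓ k, P ⟨k, hkn⟩ = 0 := fun P hP =>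
      ((mem_strings (Nat.le_of_lt hkn)).1 hP).2 _ le_rfl
    simp only [strings, dif_pos hkn]
    rw [List.nodup_append']
    refine ⟨ih (Nat.le_of_lt hkn), ?_, ?_⟩
    · rw [List.nodup_flatMap]
      refine ⟨fun P _ => ?_, ?_⟩
      · rw [children]
        split_ifs
        · have : ∀ a b : Fin 4, a ≠ b → Function.update P ⟨k, hkn⟩ a ≠ Function.update P ⟨k, hkn⟩ b :=
            fun a b hab h => hab (by simpa using congrFun h ⟨k, hkn⟩)
          simp only [List.nodup_cons, List.mem_cons, List.not_mem_nil, or_false, not_or]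
          exact ⟨⟨this _ _ (by decide), this _ _ (by decide)⟩, this _ _ (by decide),
            not_false, List.nodup_nil⟩
        · exact List.nodup_nil
      · refine List.Nodup.pairwise_of_forall_ne (ih (Nat.le_of_lt hkn)) ?_
        intro P hP Q hQ hne R hR hR'
        obtain ⟨-, a, -, e⟩ := mem_children.1 hR
        obtain ⟨-, b, -, e'⟩ := mem_children.1 hR'
        apply hne
        have h1 : P = Function.update R ⟨k, hkn⟩ 0 := by
          rw [e, Function.update_idem, ← hz P hP, Function.update_eq_self]
        have h2 : Q = Function.update R ⟨k, hkn⟩ 0 := by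
          rw [e', Function.update_idem, ← hz Q hQ, Function.update_eq_self]
        rw [h1, h2]
    · intro P hP hP'
      obtain ⟨Q, hQ, hPQ⟩ := List.mem_flatMap.1 hP'
      obtain ⟨-, a, ha, rfl⟩ := mem_children.1 hPQ
      exact ha (by simpa using hz _ hP)

theorem mem_strings_self {n ℓ : ℕ} {P : PStr n} : P ∈ strings n ℓ n ↔ weight P ≤ ℓ := by
  rw [mem_strings le_rfl]
  exact and_iff_left fun j hj => absurd j.isLt (by omega)

/-- Induction on ℓ: a nonzero string of weight at most ℓ + 1 arises from one of weight at most ℓ by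
writing one letter, in 4n possible ways; the summand 1 accounts for the zero string. -/
theorem card_weight_le (n ℓ : ℕ) :
    (Finset.univ.filter fun P : PStr n => weight P ≤ ℓ).card ≤ (4 * n + 1) ^ ℓ := by
  induction ℓ with
  | zero =>
    rw [pow_zero, Finset.card_le_one]
    have : ∀ P : PStr n, weight P ≤ 0 → P = 0 := by
      intro P hP
      funext j
      by_contra h
      replace h : P j ≠ 0 := h
      have := weight_update P j 0
      rw [if_neg h, if_pos rfl] at this
      omega
    intro P hP Q hQ
    rw [this P (Finset.mem_filter.1 hP).2, this Q (Finset.mem_filter.1 hQ).2]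
  | succ ℓ ih =>
    set S := Finset.univ.filter fun P : PStr n => weight P ≤ ℓ
    have hsub : (Finset.univ.filter fun P : PStr n => weight P ≤ ℓ + 1)
        ⊆ S ∪ (S ×ˢ (Finset.univ : Finset (Fin n × Fin 4))).image
          (fun t => Function.update t.1 t.2.1 t.2.2) := by
      intro P hP
      have hP := (Finset.mem_filter.1 hP).2
      rw [Finset.mem_union]
      by_cases h : ∃ j, P j ≠ 0
      · obtain ⟨j, hj⟩ := h
        right
        rw [Finset.mem_image]
        refine ⟨(Function.update P j 0, j, P j), ?_, by simp⟩
        have := weight_update P j 0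
        rw [if_neg hj, if_pos rfl] at this
        simp only [Finset.mem_product, Finset.mem_univ, and_true, S, Finset.mem_filter, true_and]
        omega
      · left
        push Not at h
        have : weight P = 0 := Finset.sum_eq_zero fun j _ => if_pos (h j)
        simp only [S, Finset.mem_filter, Finset.mem_univ, true_and, this, Nat.zero_le]
    refine (Finset.card_le_card hsub).trans ((Finset.card_union_le _ _).trans ?_)
    have h1 : ((S ×ˢ (Finset.univ : Finset (Fin n × Fin 4))).image
        (fun t => Function.update t.1 t.2.1 t.2.2)).card ≤ S.card * (n * 4) :=
      Finset.card_image_le.trans (by rw [Finset.card_product]; simp)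
    rw [pow_succ]
    nlinarith

theorem length_strings_le (n ℓ : ℕ) : (strings n ℓ n).length ≤ (4 * n + 1) ^ ℓ := by
  rw [← List.toFinset_card_of_nodup (nodup_strings le_rfl)]
  refine le_trans (Finset.card_le_card fun P hP => ?_) (card_weight_le n ℓ)
  simpa [mem_strings_self] using hP

theorem length_strings_mono {n ℓ k : ℕ} (hk : k ≤ n) :
    (strings n ℓ k).length ≤ (strings n ℓ n).length := by
  rw [← List.toFinset_card_of_nodup (nodup_strings le_rfl),
    ← List.toFinset_card_of_nodup (nodup_strings hk)]
  refine Finset.card_le_card fun P hP => ?_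
  rw [List.mem_toFinset] at hP ⊢
  exact mem_strings_self.2 ((mem_strings hk).1 hP).1

/-! ### Assignment rules and the table of multiples of powers of four -/

theorem WP.setNat_eq {n : ℕ} {I : Input n} {s : Mem} {m : ℕ} {post : Mem → Prop}
    {addr val : NExpr} (a v : ℕ) (hm : 1 ≤ m) (ha : addr.eval I s = a) (hv : val.eval I s = v)
    (h : post ⟨Function.update s.nat a v, s.real⟩) : WP I (.setNat addr val) s m post :=
  WP.setNat hm (by rw [ha, hv]; exact h)

theorem WP.setReal_eq {n : ℕ} {I : Input n} {s : Mem} {m : ℕ} {post : Mem → Prop}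
    {addr : NExpr} {val : RExpr} (a : ℕ) (v : ℝ) (hm : 1 ≤ m) (ha : addr.eval I s = a)
    (hv : val.eval I s = v) (h : post ⟨s.nat, Function.update s.real a v⟩) :
    WP I (.setReal addr val) s m post :=
  WP.setReal hm (by rw [ha, hv]; exact h)

/-- Assignment to a fixed cell. -/
def Prog.setCell (k : ℕ) (e : NExpr) : Prog := .setNat (.const k) e

theorem WP.setCell {n : ℕ} {I : Input n} {s : Mem} {m : ℕ} {post : Mem → Prop} {k : ℕ}
    {val : NExpr} (v : ℕ) (hm : 1 ≤ m) (hv : val.eval I s = v)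
    (h : post ⟨Function.update s.nat k v, s.real⟩) : WP I (.setCell k val) s m post :=
  WP.setNat_eq k v hm rfl hv h

-- The machine cannot multiply naturals, so the multiples c · 4^i with c < 4 are tabulated by
-- repeated addition. Cell `14` is the running address and ends as the start of the records. The
-- entry for c = 0 is never written, since memory starts with zeros.
open NExpr Prog in
def powersBody : Prog :=
  .seq (.setNat (add (cell 14) (const 1)) (cell 1)) <|
  .seq (.setNat (add (cell 14) (const 2)) (add (cell 1) (cell 1))) <|
  .seq (.setNat (add (cell 14) (const 3)) (add (add (cell 1) (cell 1)) (cell 1))) <|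
  .seq (setCell 1 (add (add (cell 1) (cell 1)) (add (cell 1) (cell 1)))) <|
  .seq (setCell 14 (add (cell 14) (const 4))) (setCell 0 (add (cell 0) (const 1)))

-- Cell `15` receives the length of a record: `n` letters, the code and the weight.
open NExpr Prog in
def powers : Prog :=
  .seq (setCell 1 (const 1)) <|
  .seq (setCell 14 (const 1024)) <|
  .seq (.whileLt (cell 0) qubits powersBody) (setCell 15 (add qubits (const 2)))

/-- The vanishing of the remaining memory matters later: the record of the identity string and the
fresh coefficient tables rely on it. -/
structure PowersInv (k : ℕ) (s : Mem) : Prop where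
  idx : s.nat 0 = k
  top : s.nat 1 = 4 ^ k
  start : s.nat 14 = 1024 + 4 * k
  pow : ∀ i < k, ∀ c < 4, s.nat (1024 + 4 * i + c) = c * 4 ^ i
  zero : ∀ x ≥ 1024 + 4 * k, s.nat x = 0
  cells : ∀ x < 1024, x ≠ 0 → x ≠ 1 → x ≠ 14 → s.nat x = 0
  real : ∀ x, s.real x = 0

theorem wp_powersBody {n : ℕ} (I : Input n) {k : ℕ} {s : Mem} (h : PowersInv k s) :
    WP I powersBody s 1 (PowersInv (k + 1)) := by
  obtain ⟨h1, h2, h3, h4, h5, h6, h7⟩ := h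
  refine .seq <| .setNat_eq (1024 + 4 * k + 1) (1 * 4 ^ k) le_rfl ?_ ?_ <|
    .seq <| .setNat_eq (1024 + 4 * k + 2) (2 * 4 ^ k) le_rfl ?_ ?_ <|
    .seq <| .setNat_eq (1024 + 4 * k + 3) (3 * 4 ^ k) le_rfl ?_ ?_ <|
    .seq <| .setCell (4 ^ (k + 1)) le_rfl ?_ <| .seq <| .setCell (1024 + 4 * (k + 1)) le_rfl ?_ <|
    .setCell (k + 1) le_rfl ?_ ?_
  case refine_10 =>
    constructor
    · simp
    · simp
    · simp
    · intro i hi c hc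
      rcases Nat.lt_succ_iff_lt_or_eq.1 hi with hi | rfl
      · simp (disch := omega) only [Function.update_of_ne, h4]
      · obtain rfl | rfl | rfl | rfl : c = 0 ∨ c = 1 ∨ c = 2 ∨ c = 3 := by omega
        all_goals simp (disch := omega) [Function.update_of_ne, h5]
    · intro x hx
      simp (disch := omega) only [Function.update_of_ne, h5]
    · intro x hx _ _ _
      simp (disch := omega) only [Function.update_of_ne, h6]
    · exact h7
  all_goals
    simp (disch := omega) only [NExpr.eval_add, NExpr.eval_cell, NExpr.eval_const,
      Function.update_of_ne, h1, h2, h3]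
  all_goals ring

/-- The invariant wants cell `15` to be zero, while the last assignment fills it; hence the reset in
the postcondition. -/
theorem wp_powers {n : ℕ} (I : Input n) :
    WP I powers Mem.init (n + 1) fun s => PowersInv n ⟨Function.update s.nat 15 0, s.real⟩ ∧
      s.nat 15 = n + 2 := by
  refine .seq <| .setCell 1 (by omega) rfl <| .seq <| .setCell 1024 (by omega) rfl <| .seq ?_
  refine (WP.while PowersInv n le_rfl (by omega) ?_ ?_ (fun k _ s h => wp_powersBody I h) ?_).imp ?_
  · constructor
    case cells =>
      intro x _ _ _ _
      simp (disch := omega) [Function.update_of_ne, Mem.init]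
    case zero =>
      intro x _
      simp (disch := omega) [Function.update_of_ne, Mem.init]
    all_goals simp [Mem.init]
  · intro k hk s h
    simpa [h.idx] using hk
  · intro s h
    simp [h.idx]
  · intro s h
    refine .setCell (n + 2) (by omega) rfl ⟨?_, by simp⟩
    rwa [Function.update_idem, show Function.update s.nat 15 0 = s.nat by
      rw [← h.cells 15 (by omega) (by omega) (by omega) (by omega), Function.update_eq_self]]

/-! ### Records of Pauli strings in memory -/

/-- The address of the `k`-th record. -/
def recAddr (n k : ℕ) : ℕ := 1024 + 4 * n + k * (n + 2)

theorem recAddr_zero (n : ℕ) : recAddr n 0 = 1024 + 4 * n := by simp [recAddr]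

theorem recAddr_succ (n k : ℕ) : recAddr n (k + 1) = recAddr n k + (n + 2) := by
  simp only [recAddr, Nat.add_mul]; omega

theorem le_recAddr (n k : ℕ) : 1024 + 4 * n ≤ recAddr n k := Nat.le_add_right _ _

theorem recAddr_lt {n k m : ℕ} (h : k < m) : recAddr n k + (n + 2) ≤ recAddr n m := by
  rw [← recAddr_succ, recAddr, recAddr]
  exact Nat.add_le_add_left (Nat.mul_le_mul_right _ h) _

/-- The record of `P` is stored at address `p`: its letters, its code and its weight, and its
damping factor in the memory for reals. -/
structure IsRecord {n : ℕ} (I : Input n) (s : Mem) (p : ℕ) (P : PStr n) : Prop where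
  letter : ∀ j : Fin n, s.nat (p + j) = P j
  code : s.nat (p + n) = code P
  weight : s.nat (p + n + 1) = weight P
  factor : s.real p = I.rate ^ _root_.weight P

theorem IsRecord.congr {n : ℕ} {I : Input n} {s s' : Mem} {p : ℕ} {P : PStr n}
    (h : IsRecord I s p P) (hn : ∀ x, p ≤ x → x < p + (n + 2) → s'.nat x = s.nat x)
    (hr : s'.real p = s.real p) : IsRecord I s' p P :=
  ⟨fun j => by rw [hn _ (by omega) (by omega), h.letter],
    by rw [hn _ (by omega) (by omega), h.code],
    by rw [hn _ (by omega) (by omega), h.weight], by rw [hr, h.factor]⟩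

theorem IsRecord.pauliAt {n : ℕ} {I : Input n} {s : Mem} {p : ℕ} {P : PStr n}
    (h : IsRecord I s p P) : s.pauliAt n p = P := by
  funext j
  simp [Mem.pauliAt, h.letter]

/-- The records of a list of strings are stored in memory, together with the tables of powers. -/
structure Built {n : ℕ} (I : Input n) (L : List (PStr n)) (s : Mem) : Prop where
  top : s.nat 1 = 4 ^ n
  fin : s.nat 2 = recAddr n L.length
  start : s.nat 14 = 1024 + 4 * n
  stride : s.nat 15 = n + 2
  pow : ∀ i < n, ∀ c < 4, s.nat (1024 + 4 * i + c) = c * 4 ^ i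
  record : ∀ (k : ℕ) (h : k < L.length), IsRecord I s (recAddr n k) L[k]

theorem Built.congr {n : ℕ} {I : Input n} {L : List (PStr n)} {s s' : Mem} (h : Built I L s)
    (hc : ∀ x ∈ [1, 2, 14, 15], s'.nat x = s.nat x)
    (hn : ∀ x, 1024 ≤ x → x < recAddr n L.length → s'.nat x = s.nat x)
    (hr : ∀ x, 1024 ≤ x → x < recAddr n L.length → s'.real x = s.real x) : Built I L s' := by
  have := le_recAddr n L.length
  refine ⟨by rw [hc _ (by simp), h.top], by rw [hc _ (by simp), h.fin],
    by rw [hc _ (by simp), h.start], by rw [hc _ (by simp), h.stride],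
    fun i hi c hc' => by rw [hn _ (by omega) (by omega), h.pow i hi c hc'], fun k hk => ?_⟩
  have h1 := recAddr_lt (n := n) hk
  have h2 := le_recAddr n k
  exact (h.record k hk).congr (fun x hx hx' => hn x (by omega) (by omega))
    (hr _ (by omega) (by omega))

theorem Built.setCell {n : ℕ} {I : Input n} {L : List (PStr n)} {s : Mem} (h : Built I L s)
    (k v : ℕ) (hk : k < 1024 := by omega) (hk' : k ∉ [1, 2, 14, 15] := by decide) :
    Built I L ⟨Function.update s.nat k v, s.real⟩ :=
  h.congr (fun x hx => Function.update_of_ne (fun e => hk' (by rw [← e]; exact hx)) _ _)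
    (fun x hx _ => Function.update_of_ne (by omega) _ _) fun _ _ _ => rfl

/-! ### Building the list of records -/

open NExpr Prog in
/-- Copy the record at the address in cell `4` to the address in cell `2`. -/
def copyRecord : Prog :=
  .seq (setCell 16 (const 0)) <|
  .whileLt (cell 16) (cell 15) <|
    .seq (.setNat (add (cell 2) (cell 16)) (read (add (cell 4) (cell 16))))
      (setCell 16 (add (cell 16) (const 1)))

theorem wp_copyRecord {n : ℕ} (I : Input n) {s : Mem} {p e S : ℕ} (h2 : s.nat 2 = e)
    (h4 : s.nat 4 = p) (h15 : s.nat 15 = S) (hp : 1024 ≤ p) (he : p + S ≤ e) :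
    WP I copyRecord s (S + 1) fun s' => (∀ i < S, s'.nat (e + i) = s.nat (p + i)) ∧
      (∀ x, x ≠ 16 → ¬ (e ≤ x ∧ x < e + S) → s'.nat x = s.nat x) ∧ s'.real = s.real := by
  refine .seq <| .setCell 0 (by omega) rfl ?_
  refine (WP.while (fun k s' => s'.nat 16 = k ∧ (∀ i < k, s'.nat (e + i) = s.nat (p + i)) ∧
      (∀ x, x ≠ 16 → ¬ (e ≤ x ∧ x < e + k) → s'.nat x = s.nat x) ∧ s'.real = s.real)
    S (m := 1) le_rfl (by omega) ?_ ?_ ?_ ?_).imp ?_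
  · refine ⟨by simp, by simp, fun x hx _ => ?_, rfl⟩
    exact Function.update_of_ne hx _ _
  · rintro k hk s' ⟨i1, i2, i3, i4⟩
    simp only [NExpr.eval_cell, i1]
    rw [i3 15 (by omega) (by omega), h15]
    exact hk
  · rintro k hk s' ⟨i1, i2, i3, i4⟩
    refine .seq <| .setNat_eq (e + k) (s.nat (p + k)) le_rfl ?_ ?_ <| .setCell (k + 1) le_rfl ?_ ?_
    · simp only [NExpr.eval_cell, NExpr.eval_add, i1]
      rw [i3 2 (by omega) (by omega), h2]
    · simp only [NExpr.eval_cell, NExpr.eval_add, NExpr.eval_read, i1]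
      rw [i3 4 (by omega) (by omega), h4, i3 _ (by omega) (by omega)]
    · simp (disch := omega) [Function.update_of_ne, i1]
    · refine ⟨by simp, fun i hi => ?_, fun x hx hx' => ?_, i4⟩
      · rcases Nat.lt_succ_iff_lt_or_eq.1 hi with hi | rfl
        · simp (disch := omega) only [Function.update_of_ne, i2]
        · simp (disch := omega) [Function.update_of_ne]
      · simp (disch := omega) only [Function.update_of_ne, i3]
  · rintro s' ⟨i1, i2, i3, i4⟩
    simp only [NExpr.eval_cell, i1]
    rw [i3 15 (by omega) (by omega), h15]
    exact lt_irrefl _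
  · rintro s' ⟨-, i2, i3, i4⟩
    exact ⟨i2, i3, i4⟩

open NExpr Prog in
/-- Append the record of the string that is obtained from the string at the address in cell `4` by
writing the letter `c` at the position in cell `5`. -/
def pushRecord (c : ℕ) : Prog :=
  .seq copyRecord <|
  .seq (.setNat (add (cell 2) (cell 5)) (const c)) <|
  .seq (.setNat (add (cell 2) qubits)
    (add (read (add (cell 2) qubits)) (read (add (cell 6) (const c))))) <|
  .seq (.setNat (add (add (cell 2) qubits) (const 1))
    (add (read (add (add (cell 2) qubits) (const 1))) (const 1))) <|
  .seq (.setReal (cell 2) (.mul (.read (cell 4)) rateExpr))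
    (setCell 2 (add (cell 2) (cell 15)))

/-- The part of the memory for reals that is not yet in use contains zeros only. -/
def UnusedZero (n : ℕ) (L : List (PStr n)) (s : Mem) : Prop :=
  s.real 0 = 0 ∧ ∀ x ≥ recAddr n L.length, s.real x = 0

/-- The new letter replaces an identity letter, so code, weight and damping factor follow from the
copied values by one addition or multiplication each. -/
theorem wp_pushRecord {n : ℕ} {I : Input n} {L : List (PStr n)} {s : Mem} {k : ℕ} {j : Fin n}
    {a : Fin 4} {P : PStr n} (h : Built I L s) (hz : UnusedZero n L s) (hk : k < L.length)
    (hP : L[k] = P) (h4 : s.nat 4 = recAddr n k) (h5 : s.nat 5 = j) (h6 : s.nat 6 = 1024 + 4 * j)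
    (hj : P j = 0) (ha : a ≠ 0) :
    WP I (pushRecord a) s (n + 3) fun s' => Built I (L ++ [Function.update P j a]) s' ∧
      UnusedZero n (L ++ [Function.update P j a]) s' ∧
      ∀ x ∈ [3, 4, 5, 6], s'.nat x = s.nat x := by
  obtain ⟨b1, b2, b3, b4, b5, b6⟩ := h
  obtain ⟨z1, z2⟩ := hz
  have hr := b6 k hk
  rw [hP] at hr
  have e1 := recAddr_lt (n := n) hk
  have e2 := le_recAddr n k
  have e3 := recAddr_succ n L.length
  have ew := weight_update P j a
  have ec := code_update P j a
  rw [hj, if_neg ha] at ew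
  rw [hj] at ec
  simp only [if_pos, Fin.val_zero, Nat.zero_mul, Nat.add_zero] at ew ec
  have hjn := j.isLt
  have hal := a.isLt
  set p := recAddr n k with hp
  set e := recAddr n L.length with he
  refine .seq <| (wp_copyRecord I b2 h4 b4 (by omega) (by omega)).imp ?_
  rintro s1 ⟨c1, c2, c3⟩
  have c2' : ∀ x, x ≠ 16 → x < e → s1.nat x = s.nat x := fun x hx hx' => c2 x hx (by omega)
  have hpow := b5 j j.isLt a a.isLt
  refine .seq <| .setNat_eq (e + j) a (by omega) ?_ rfl <|
    .seq <| .setNat_eq (e + n) (code (Function.update P j a)) (by omega) ?_ ?_ <|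
    .seq <| .setNat_eq (e + n + 1) (weight (Function.update P j a)) (by omega) ?_ ?_ <|
    .seq <| .setReal_eq e (I.rate ^ weight (Function.update P j a)) (by omega) ?_ ?_ <|
    .setCell (recAddr n (L.length + 1)) (by omega) ?_ ?_
  case refine_9 =>
    refine ⟨⟨?_, ?_, ?_, ?_, ?_, ?_⟩, ⟨?_, ?_⟩, ?_⟩
    · simp (disch := omega) only [Function.update_of_ne, c2', b1]
    · simp
    · simp (disch := omega) only [Function.update_of_ne, c2', b3]
    · simp (disch := omega) only [Function.update_of_ne, c2', b4]
    · intro i hi c hc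
      simp (disch := omega) only [Function.update_of_ne, c2', b5]
    · intro i hi
      rw [List.length_append, List.length_singleton] at hi
      rcases Nat.lt_succ_iff_lt_or_eq.1 hi with hi | rfl
      · have f1 := recAddr_lt (n := n) hi
        have f2 := le_recAddr n i
        rw [List.getElem_append_left hi]
        refine (b6 i hi).congr (fun x hx hx' => ?_) ?_
        · simp (disch := omega) only [Function.update_of_ne, c2']
        · simp (disch := omega) only [Function.update_of_ne, c3]
      · simp only [List.getElem_concat_length]
        refine ⟨fun i => ?_, ?_, ?_, ?_⟩
        · have hi := i.isLt
          by_cases hij : i = j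
          · subst hij
            simp (disch := omega) [Function.update_of_ne, ← he]
          · have : (i : ℕ) ≠ j := fun h => hij (Fin.ext h)
            simp (disch := omega) only [Function.update_of_ne, ← he, c1]
            rw [hr.letter]
        · simp (disch := omega) only [Function.update_of_ne, ← he, Function.update_self]
        · simp (disch := omega) only [Function.update_of_ne, ← he, Function.update_self]
        · simp only [← he, Function.update_self]
    · simp (disch := omega) only [Function.update_of_ne, c3, z1]
    · intro x hx
      rw [List.length_append, List.length_singleton] at hx
      simp (disch := omega) only [Function.update_of_ne, c3, z2]
    · intro x hx
      have hx : x = 3 ∨ x = 4 ∨ x = 5 ∨ x = 6 := by simpa using hx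
      simp (disch := omega) only [Function.update_of_ne, c2']
  all_goals
    simp (disch := omega) only [NExpr.eval_add, NExpr.eval_cell, NExpr.eval_const,
      NExpr.eval_read, NExpr.eval_qubits, RExpr.eval_mul, RExpr.eval_read, eval_rateExpr,
      Function.update_of_ne, c2', c3, b2, h4, h5, h6, b4]
  · rw [c1 n (by omega), hr.code, hpow, ec]
  · rw [Nat.add_assoc, c1 (n + 1) (by omega), ← Nat.add_assoc, hr.weight, ew]
  · rw [hr.factor, ew, pow_succ]
  · rw [e3]

open NExpr Prog in
/-- Append the children of the string at the address in cell `4`. -/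
def pushChildren : Prog :=
  .seq (.ifNatLt (read (add (add (cell 4) qubits) (const 1))) (param 0)
    (.seq (pushRecord 1) (.seq (pushRecord 2) (pushRecord 3))) .skip)
    (setCell 4 (add (cell 4) (cell 15)))

theorem wp_pushChildren {n : ℕ} {I : Input n} {L : List (PStr n)} {s : Mem} {k : ℕ} {j : Fin n}
    {P : PStr n} (h : Built I L s) (hz : UnusedZero n L s) (hk : k < L.length)
    (hP : L[k] = P) (h4 : s.nat 4 = recAddr n k) (h5 : s.nat 5 = j) (h6 : s.nat 6 = 1024 + 4 * j)
    (hj : P j = 0) :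
    WP I pushChildren s (n + 3) fun s' => Built I (L ++ children (I.param 0) j P) s' ∧
      UnusedZero n (L ++ children (I.param 0) j P) s' ∧ s'.nat 4 = recAddr n (k + 1) ∧
      ∀ x ∈ [3, 5, 6], s'.nat x = s.nat x := by
  have hr := h.record k hk
  rw [hP] at hr
  have hw : (NExpr.read (.add (.add (.cell 4) .qubits) (.const 1))).eval I s = weight P := by
    simp [h4, hr.weight]
  have finish : ∀ {s' : Mem} {L' : List (PStr n)}, Built I L' s' → UnusedZero n L' s' →
      (∀ x ∈ [3, 4, 5, 6], s'.nat x = s.nat x) →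
      WP I (Prog.setCell 4 (.add (.cell 4) (.cell 15))) s' (n + 3) fun s' => Built I L' s' ∧
      UnusedZero n L' s' ∧ s'.nat 4 = recAddr n (k + 1) ∧ ∀ x ∈ [3, 5, 6], s'.nat x = s.nat x := by
    intro s' L' hb hu hs
    refine .setCell (recAddr n (k + 1)) (by omega) ?_ ⟨hb.setCell _ _, hu, by simp, fun x hx => ?_⟩
    · rw [NExpr.eval_add, NExpr.eval_cell, NExpr.eval_cell, hs 4 (by simp), h4, hb.stride,
        recAddr_succ]
    · have hx' : x = 3 ∨ x = 5 ∨ x = 6 := by simpa using hx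
      simp (disch := omega) only [Function.update_of_ne]
      exact hs x (by simp; omega)
  refine .seq <| .ifNat (by omega) (fun hlt => ?_) fun hlt => ?_
  · rw [hw, NExpr.eval_param] at hlt
    rw [children, if_pos hlt]
    have key : ∀ {s' : Mem} {L' : List (PStr n)}, Built I (L ++ L') s' →
        UnusedZero n (L ++ L') s' → (∀ x ∈ [3, 4, 5, 6], s'.nat x = s.nat x) → ∀ a : Fin 4, a ≠ 0 →
        WP I (pushRecord a) s' (n + 3) fun s'' =>
          Built I (L ++ (L' ++ [Function.update P j a])) s'' ∧
          UnusedZero n (L ++ (L' ++ [Function.update P j a])) s'' ∧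
          ∀ x ∈ [3, 4, 5, 6], s''.nat x = s.nat x := by
      intro s' L' hb hu hs a ha
      rw [← List.append_assoc]
      refine (wp_pushRecord hb hu (k := k) (by rw [List.length_append]; omega) (P := P)
        (by rw [List.getElem_append_left hk, hP]) (by rw [hs 4 (by simp), h4])
        (by rw [hs 5 (by simp), h5]) (by rw [hs 6 (by simp), h6]) hj ha).imp ?_
      rintro s'' ⟨c1, c2, c3⟩
      exact ⟨c1, c2, fun x hx => (c3 x hx).trans (hs x hx)⟩
    refine .seq <| (key (s' := s) (L' := []) (by simpa using h) (by simpa using hz)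
      (fun _ _ => rfl) 1 (by decide)).imp ?_
    rintro s1 ⟨c1, c2, c3⟩
    refine .seq <| (key c1 c2 c3 2 (by decide)).imp ?_
    rintro s2 ⟨d1, d2, d3⟩
    refine (key d1 d2 d3 3 (by decide)).imp ?_
    rintro s3 ⟨f1, f2, f3⟩
    exact finish f1 f2 f3
  · rw [hw, NExpr.eval_param] at hlt
    rw [children, if_neg hlt, List.append_nil]
    exact .skip (by omega) (finish h hz fun _ _ => rfl)

open NExpr Prog in
/-- Extend the list by all strings that are supported on one more position. -/
def extendList : Prog :=
  .seq (setCell 3 (cell 2)) <|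
  .seq (setCell 4 (cell 14)) <|
  .seq (.whileLt (cell 4) (cell 3) pushChildren) <|
  .seq (setCell 5 (add (cell 5) (const 1))) (setCell 6 (add (cell 6) (const 4)))

/-- Cell `3` freezes the end of the old list, so that only the old strings get children although the
list grows during the loop. -/
theorem wp_extendList {n : ℕ} {I : Input n} {s : Mem} {j : ℕ} (hj : j < n)
    (h : Built I (strings n (I.param 0) j) s) (hz : UnusedZero n (strings n (I.param 0) j) s)
    (h5 : s.nat 5 = j) (h6 : s.nat 6 = 1024 + 4 * j) :
    WP I extendList s (((strings n (I.param 0) n).length + 1) * (n + 3)) fun s' =>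
      Built I (strings n (I.param 0) (j + 1)) s' ∧ UnusedZero n (strings n (I.param 0) (j + 1)) s' ∧
      s'.nat 5 = j + 1 ∧ s'.nat 6 = 1024 + 4 * (j + 1) := by
  have hle := length_strings_mono (ℓ := I.param 0) hj.le
  have hz0 : ∀ P ∈ strings n (I.param 0) j, P ⟨j, hj⟩ = 0 := fun P hP =>
    ((mem_strings hj.le).1 hP).2 _ le_rfl
  rw [show strings n (I.param 0) (j + 1) = strings n (I.param 0) j ++
    (strings n (I.param 0) j).flatMap (children (I.param 0) ⟨j, hj⟩) by simp [strings, hj]]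
  set L := strings n (I.param 0) j
  have hm : 1 ≤ ((strings n (I.param 0) n).length + 1) * (n + 3) :=
    Nat.mul_pos (by omega) (by omega)
  refine .seq <| .setCell (recAddr n L.length) hm (by simp [h.fin]) <|
    .seq <| .setCell (recAddr n 0) hm (by simp [h.start, recAddr_zero]) <| .seq ?_
  refine (WP.while (fun k s' =>
      Built I (L ++ (L.take k).flatMap (children (I.param 0) ⟨j, hj⟩)) s' ∧
      UnusedZero n (L ++ (L.take k).flatMap (children (I.param 0) ⟨j, hj⟩)) s' ∧
      s'.nat 4 = recAddr n k ∧ s'.nat 3 = recAddr n L.length ∧ s'.nat 5 = j ∧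
      s'.nat 6 = 1024 + 4 * j)
    L.length (m := n + 3) (by omega) (Nat.mul_le_mul_right _ (by omega)) ?_ ?_ ?_ ?_).imp ?_
  · simp only [List.take_zero, List.flatMap_nil, List.append_nil]
    refine ⟨(h.setCell _ _).setCell _ _, hz, ?_⟩
    simp [h5, h6]
  · rintro k hk s' ⟨-, -, i1, i2, -⟩
    have := recAddr_lt (n := n) hk
    simp only [NExpr.eval_cell, i1, i2]
    omega
  · rintro k hk s' ⟨i1, i2, i3, i4, i5, i6⟩
    refine (wp_pushChildren (k := k) (P := L[k]) (j := ⟨j, hj⟩) i1 i2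
      (by rw [List.length_append]; omega) (List.getElem_append_left hk) i3 i5 i6
      (hz0 _ (List.getElem_mem hk))).imp ?_
    rintro s'' ⟨c1, c2, c3, c4⟩
    rw [← List.take_append_getElem hk, List.flatMap_append, List.flatMap_singleton,
      ← List.append_assoc]
    exact ⟨c1, c2, c3, by rw [c4 3 (by simp), i4], by rw [c4 5 (by simp), i5],
      by rw [c4 6 (by simp), i6]⟩
  · rintro s' ⟨-, -, i1, i2, -⟩
    simp [i1, i2]
  · rintro s' ⟨i1, i2, -, -, i5, i6⟩
    rw [List.take_length] at i1 i2
    refine .seq <| .setCell (j + 1) hm (by simp [i5]) <|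
      .setCell (1024 + 4 * (j + 1)) hm (by simp [i6]; omega) ?_
    exact ⟨(i1.setCell _ _).setCell _ _, i2, by simp, by simp⟩

open NExpr Prog in
/-- Build the list of all strings of low weight. -/
def buildList : Prog :=
  .seq (setCell 2 (add (cell 14) (cell 15))) <|
  .seq (.setReal (cell 14) (.int 1)) <|
  .seq (setCell 5 (const 0)) <|
  .seq (setCell 6 (const 1024)) <|
  .whileLt (cell 5) qubits extendList

theorem wp_buildList {n : ℕ} {I : Input n} {s : Mem}
    (h : PowersInv n ⟨Function.update s.nat 15 0, s.real⟩) (h15 : s.nat 15 = n + 2) :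
    WP I buildList s ((n + 1) * (((strings n (I.param 0) n).length + 1) * (n + 3))) fun s' =>
      Built I (strings n (I.param 0) n) s' ∧ UnusedZero n (strings n (I.param 0) n) s' := by
  obtain ⟨h1, h2, h3, h4, h5, h6, h7⟩ := h
  have hm0 : 1 ≤ ((strings n (I.param 0) n).length + 1) * (n + 3) :=
    Nat.mul_pos (by omega) (by omega)
  have hm : 1 ≤ (n + 1) * (((strings n (I.param 0) n).length + 1) * (n + 3)) :=
    Nat.mul_pos (by omega) hm0
  have g2 : s.nat 1 = 4 ^ n := by simpa using h2
  have g3 : s.nat 14 = 1024 + 4 * n := by simpa using h3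
  have g4 : ∀ i < n, ∀ c < 4, s.nat (1024 + 4 * i + c) = c * 4 ^ i := by
    intro i hi c hc
    have := h4 i hi c hc
    simpa (disch := omega) only [Function.update_of_ne] using this
  have g5 : ∀ x ≥ 1024 + 4 * n, s.nat x = 0 := by
    intro x hx
    have := h5 x hx
    simpa (disch := omega) only [Function.update_of_ne] using this
  replace h7 : ∀ x, s.real x = 0 := h7
  -- The record of the identity string consists of zeros that are already in place; only its damping
  -- factor 1 has to be written.
  refine .seq <| .setCell (recAddr n 1) hm
      (by simp [g3, h15, recAddr]) <|
    .seq <| .setReal_eq (recAddr n 0) 1 hm (by simp [g3, recAddr_zero])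
      (by simp) <|
    .seq <| .setCell 0 hm rfl <| .seq <| .setCell 1024 hm rfl ?_
  have hend := recAddr_zero n
  have hend1 : recAddr n 1 = recAddr n 0 + (n + 2) := recAddr_succ n 0
  refine (WP.while (fun k s' => Built I (strings n (I.param 0) k) s' ∧
      UnusedZero n (strings n (I.param 0) k) s' ∧ s'.nat 5 = k ∧ s'.nat 6 = 1024 + 4 * k)
    n hm0 le_rfl ?_ ?_ ?_ ?_).imp ?_
  · refine ⟨⟨by simp [g2], by simp [strings], by simp [g3], by simp [h15], fun i hi c hc => ?_,
      fun k hk => ?_⟩, ⟨?_, fun x hx => ?_⟩, by simp, by simp⟩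
    · simp (disch := omega) only [Function.update_of_ne, g4]
    · simp only [strings, List.length_singleton, Nat.lt_one_iff] at hk
      subst hk
      have hc : code (0 : PStr n) = 0 := by simp [code_eq_sum]
      have hw : weight (0 : PStr n) = 0 := by simp [weight]
      simp only [strings, List.getElem_cons_zero]
      refine ⟨fun j => ?_, ?_, ?_, ?_⟩
      · simp (disch := omega) only [Function.update_of_ne, g5]
        rfl
      · simp (disch := omega) only [Function.update_of_ne, g5, hc]
      · simp (disch := omega) only [Function.update_of_ne, g5, hw]
      · simp only [Function.update_self, hw, pow_zero]
    · simp (disch := omega) only [Function.update_of_ne, h7]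
    · simp only [strings, List.length_singleton] at hx
      simp (disch := omega) only [Function.update_of_ne, h7]
  · rintro k hk s' ⟨-, -, i, -⟩
    simpa [i] using hk
  · rintro k hk s' ⟨i1, i2, i3, i4⟩
    exact wp_extendList hk i1 i2 i3 i4
  · rintro s' ⟨-, -, i, -⟩
    simp [i]
  · rintro s' ⟨i1, i2, -⟩
    exact ⟨i1, i2⟩

/-! ### Loops over all records -/

open NExpr Prog in
/-- Execute `body` for every record, with the address of the record in cell `4`. -/
def forRecords (body : Prog) : Prog :=
  .seq (setCell 4 (cell 14)) <|
  .whileLt (cell 4) (cell 2) (.seq body (setCell 4 (add (cell 4) (cell 15))))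

/-- The hypothesis `hcell` makes the invariant blind to cell `4`, which the loop itself advances. -/
theorem wp_forRecords {n : ℕ} {I : Input n} {L : List (PStr n)} {s : Mem} {body : Prog}
    (inv : ℕ → Mem → Prop) (h : Built I L s) (h0 : inv 0 s)
    (hcell : ∀ k s v, inv k s → inv k ⟨Function.update s.nat 4 v, s.real⟩)
    (hbody : ∀ k < L.length, ∀ s : Mem, Built I L s → s.nat 4 = recAddr n k →
      inv k s → WP I body s 1 fun s' => Built I L s' ∧ s'.nat 4 = s.nat 4 ∧ inv (k + 1) s') :
    WP I (forRecords body) s (L.length + 1) fun s' => Built I L s' ∧ inv L.length s' := by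
  refine .seq <| .setCell (recAddr n 0) (by omega) (by simp [h.start, recAddr_zero]) ?_
  refine (WP.while (fun k s' => Built I L s' ∧ s'.nat 4 = recAddr n k ∧ inv k s')
    L.length (m := 1) le_rfl (by omega) ⟨h.setCell _ _, by simp, hcell _ _ _ h0⟩ ?_ ?_ ?_).imp ?_
  · rintro k hk s' ⟨i1, i2, -⟩
    have := recAddr_lt (n := n) hk
    simp only [NExpr.eval_cell, i2, i1.fin]
    omega
  · rintro k hk s' ⟨i1, i2, i3⟩
    refine .seq <| (hbody k hk s' i1 i2 i3).imp ?_
    rintro s'' ⟨c1, c2, c3⟩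
    refine .setCell (recAddr n (k + 1)) le_rfl ?_ ⟨c1.setCell _ _, by simp, hcell _ _ _ c3⟩
    simp [c2, i2, c1.stride, recAddr_succ]
  · rintro s' ⟨i1, i2, -⟩
    simp [i2, i1.fin]
  · rintro s' ⟨i1, -, i3⟩
    exact ⟨i1, i3⟩

/-- Writing a table of real numbers that is indexed by the codes of the recorded strings. -/
theorem wp_forRecords_write {n : ℕ} {I : Input n} {L : List (PStr n)} {s : Mem} {body : Prog}
    {b : ℕ} (f : PStr n → ℝ) (h : Built I L s) (hb : recAddr n L.length ≤ b)
    (hz : ∀ x ≥ b, s.real x = 0)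
    (hbody : ∀ (k : ℕ) (hk : k < L.length) (s' : Mem), Built I L s' → s'.nat 4 = recAddr n k →
      (∀ x, x ≠ 4 → x ≠ 13 → s'.nat x = s.nat x) → (∀ x < b, s'.real x = s.real x) →
      WP I body s' 1 fun s'' => (∀ x, x ≠ 13 → s''.nat x = s'.nat x) ∧
        s''.real = Function.update s'.real (b + code L[k]) (f L[k])) :
    WP I (forRecords body) s (L.length + 1) fun s' => Built I L s' ∧
      (∀ x, x ≠ 4 → x ≠ 13 → s'.nat x = s.nat x) ∧ (∀ x < b, s'.real x = s.real x) ∧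
      (∀ Q, s'.real (b + code Q) = if Q ∈ L then f Q else 0) ∧
      ∀ x ≥ b + 4 ^ n, s'.real x = 0 := by
  refine (wp_forRecords (fun k s' => (∀ x, x ≠ 4 → x ≠ 13 → s'.nat x = s.nat x) ∧
      (∀ x < b, s'.real x = s.real x) ∧
      (∀ Q, s'.real (b + code Q) = if Q ∈ L.take k then f Q else 0) ∧
      ∀ x ≥ b + 4 ^ n, s'.real x = 0) h ?_ ?_ ?_).imp ?_
  · refine ⟨fun _ _ _ => rfl, fun _ _ => rfl, fun Q => ?_, fun x hx => hz x (le_of_add_le_left hx)⟩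
    simp [hz]
  · rintro k s' v ⟨i1, i2, i3, i4⟩
    refine ⟨fun x hx hx' => ?_, i2, i3, i4⟩
    simp (disch := omega) only [Function.update_of_ne]
    exact i1 x hx hx'
  · rintro k hk s' hs' h4 ⟨i1, i2, i3, i4⟩
    refine (hbody k hk s' hs' h4 i1 i2).imp ?_
    rintro s'' ⟨c1, c2⟩
    have hcl := code_lt L[k]
    refine ⟨hs'.congr ?_ (fun x _ _ => c1 x (by omega)) ?_, c1 4 (by omega),
      fun x hx hx' => (c1 x hx').trans (i1 x hx hx'), fun x hx => ?_, fun Q => ?_, fun x hx => ?_⟩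
    · intro x hx
      have hx : x = 1 ∨ x = 2 ∨ x = 14 ∨ x = 15 := by simpa using hx
      exact c1 x (by omega)
    · intro x _ _
      rw [c2, Function.update_of_ne (by omega)]
    · rw [c2, Function.update_of_ne (by omega), i2 x hx]
    · rw [c2, ← List.take_append_getElem hk]
      by_cases hQ : Q = L[k]
      · subst hQ
        rw [Function.update_self, if_pos (List.mem_append_right _ (List.mem_singleton_self _))]
      -- Distinct strings have distinct codes, so the other entries are untouched.
      · rw [Function.update_of_ne (fun e => hQ (code_injective (by omega))), i3]
        simp only [List.mem_append, List.mem_singleton, hQ, or_false]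
    · rw [c2, Function.update_of_ne (by omega), i4 x hx]
  · rintro s' ⟨i1, i2, i3, i4, i5⟩
    rw [List.take_length] at i4
    exact ⟨i1, i2, i3, i4, i5⟩

/-! ### The table of coefficients -/

/-- The current table, at the address in cell `7`, contains the coefficients `v`. -/
structure Holds {n : ℕ} (I : Input n) (L : List (PStr n)) (v : PStr n → ℝ) (s : Mem) : Prop where
  built : Built I L s
  base : recAddr n L.length ≤ s.nat 7
  table : ∀ Q, s.real (s.nat 7 + code Q) = v Q
  rest : ∀ x ≥ s.nat 7 + 4 ^ n, s.real x = 0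
  output : s.real 0 = 0

theorem Holds.setCell {n : ℕ} {I : Input n} {L : List (PStr n)} {v : PStr n → ℝ} {s : Mem}
    (h : Holds I L v s) (k x : ℕ) (hk : k < 1024 := by omega)
    (hk' : k ∉ [1, 2, 14, 15] := by decide) (hk7 : 7 ≠ k := by decide) :
    Holds I L v ⟨Function.update s.nat k x, s.real⟩ := by
  refine ⟨h.built.setCell k x hk hk', ?_, ?_, ?_, h.output⟩
  all_goals
    simp only [Function.update_of_ne hk7]
  · exact h.base
  · exact h.table
  · exact h.rest

open NExpr Prog in
/-- Initialize the table with the coefficients of the observable, after the read-out noise. -/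
def initTable : Prog :=
  .seq (setCell 7 (cell 2)) <| forRecords <|
    .setReal (add (cell 7) (read (add (cell 4) qubits))) (.mul (.obsCoeff (cell 4)) (.read (cell 4)))

theorem wp_initTable {n : ℕ} {I : Input n} {L : List (PStr n)} {s : Mem} (h : Built I L s)
    (hz : UnusedZero n L s) :
    WP I initTable s (L.length + 1)
      (Holds I L fun Q => if Q ∈ L then dampAll I.rate (pauliCoeff I.obs) Q else 0) := by
  refine .seq <| .setCell (recAddr n L.length) (by omega) (by simp [h.fin]) ?_
  have hr := le_recAddr n L.length
  refine (wp_forRecords_write (dampAll I.rate (pauliCoeff I.obs)) (h.setCell 7 _) le_rfl hz.2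
    ?_).imp ?_
  · intro k hk s' hs' h4 hn _
    have hrec := hs'.record k hk
    have h7 : s'.nat 7 = recAddr n L.length := by simp [hn]
    refine .setReal_eq (recAddr n L.length + code L[k])
      (dampAll I.rate (pauliCoeff I.obs) L[k]) le_rfl ?_ ?_ ⟨fun _ _ => rfl, rfl⟩
    · simp [h7, h4, hrec.code]
    · rw [RExpr.eval_mul, RExpr.eval_read, NExpr.eval_cell, h4, hrec.factor, dampAll, mul_comm]
      simp only [RExpr.eval, NExpr.eval_cell, h4, hrec.pauliAt, pauliCoeff]
  · rintro s' ⟨c1, c2, c3, c4, c5⟩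
    have h7 : s'.nat 7 = recAddr n L.length := by simp [c2]
    exact ⟨c1, h7.ge, by rwa [h7], by rwa [h7], by rw [c3 0 (by omega)]; exact hz.1⟩

/-! ### One gate -/

/-- The address of an entry of the Pauli transfer matrix. -/
def ptmAddr (x : (Fin 4 × Fin 4) × (Fin 4 × Fin 4)) : ℕ :=
  256 + 64 * x.1.1 + 16 * x.1.2 + 4 * x.2.1 + x.2.2

theorem ptmAddr_injective : Function.Injective ptmAddr := by
  rintro ⟨⟨a, b⟩, p, q⟩ ⟨⟨a', b'⟩, p', q'⟩ h
  simp only [ptmAddr] at h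
  simp only [Prod.mk.injEq, Fin.ext_iff]
  omega

/-- Store the Pauli transfer matrix of the current gate with its noise. -/
def storePtm : Prog :=
  assignments ptmAddr (fun x => .mul (.mul (factorExpr x.2.2) (factorExpr x.2.1))
    (ptmExpr x.1.1 x.1.2 x.2.1 x.2.2)) (letterPairs ×ˢ letterPairs)

/-- All 256 entries are computed by straight-line code. Their cells lie between the output cell `0`
and the area from 1024 on that holds damping factors and coefficient tables. -/
theorem wp_storePtm {n : ℕ} {I : Input n} {s : Mem} {g : Gate n}
    (h : I.circuit.gate? (s.nat 9) (s.nat 10) = some g) {m : ℕ} (hm : 1 ≤ m) :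
    WP I storePtm s m fun s' => s'.nat = s.nat ∧
      (∀ a b p q : Fin 4, s'.real (256 + 64 * a + 16 * b + 4 * p + q : ℕ) =
        letterFactor I.rate q * letterFactor I.rate p * g.ptm a b p q) ∧
      (∀ x, (x < 256 ∨ 1024 ≤ x) → s'.real x = s.real x) := by
  refine (wp_assignments hm ptmAddr_injective
    (v := fun x => letterFactor I.rate x.2.2 * letterFactor I.rate x.2.1 *
      g.ptm x.1.1 x.1.2 x.2.1 x.2.2) _ s ?_).imp ?_
  · intro s' hs' x
    simp only [RExpr.eval_mul, eval_factorExpr]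
    rw [eval_ptmExpr (by rw [hs', h])]
  · rintro s' ⟨c1, c2, c3⟩
    refine ⟨c1, fun a b p q => ?_, fun x hx => c3 x ?_⟩
    · refine c2 ((a, b), (p, q)) (Or.inl ?_)
      simp [letterPairs]
    · rintro ⟨⟨a, b⟩, p, q⟩
      simp only [ptmAddr]
      omega

open NExpr in
/-- The letter at the first qubit of the current gate. -/
def letterFst : NExpr := read (add (cell 4) (cell 11))

open NExpr in
/-- The letter at the second qubit of the current gate. -/
def letterSnd : NExpr := read (add (cell 4) (cell 12))

open NExpr in
/-- The contribution of one old coefficient to a new one. -/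
def termExpr (x : Fin 4 × Fin 4) : RExpr :=
  .mul
    (.read (add (add (const (256 + 64 * x.1 + 16 * x.2))
      (add (add letterFst letterFst) (add letterFst letterFst))) letterSnd))
    (.read (add (cell 7) (add (add (cell 13) (read (add (cell 17) (const x.1))))
      (read (add (cell 18) (const x.2))))))

open NExpr Prog in
/-- Compute one new coefficient. -/
def updateCoeff : Prog :=
  .seq (setCell 13 (sub (sub (read (add (cell 4) qubits)) (read (add (cell 17) letterFst)))
    (read (add (cell 18) letterSnd)))) <|
  .setReal (add (cell 8) (read (add (cell 4) qubits))) (.sum (letterPairs.map termExpr))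

/-- Cell `13` holds the code without the two letters of the gate. Adding the tabulated multiples for
`a` and `b` gives the address of an old coefficient (`code_setTwo`), without any search. The 16
terms are unrolled in the program text, so one update takes constant time. -/
theorem wp_updateCoeff {n : ℕ} {I : Input n} {L : List (PStr n)} {v : PStr n → ℝ} {s : Mem}
    {g : Gate n} {k : ℕ} (hk : k < L.length) (h : Built I L s) (h4 : s.nat 4 = recAddr n k)
    (h8 : s.nat 8 = s.nat 7 + 4 ^ n)
    (h11 : s.nat 11 = g.fst) (h12 : s.nat 12 = g.snd) (h17 : s.nat 17 = 1024 + 4 * g.fst)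
    (h18 : s.nat 18 = 1024 + 4 * g.snd) (hv : ∀ Q, s.real (s.nat 7 + code Q) = v Q)
    (hp : ∀ a b p q : Fin 4, s.real (256 + 64 * a + 16 * b + 4 * p + q : ℕ) =
        letterFactor I.rate q * letterFactor I.rate p * g.ptm a b p q) :
    WP I updateCoeff s 1 fun s' => (∀ x, x ≠ 13 → s'.nat x = s.nat x) ∧
      s'.real = Function.update s.real (s.nat 7 + 4 ^ n + code L[k])
        (g.noisyStep I.rate v L[k]) := by
  have hr := h.record k hk
  set P := L[k]
  have hk1 := le_recAddr n k
  have lf : (letterFst).eval I s = P g.fst := by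
    simp [letterFst, h4, h11, hr.letter]
  have ls : (letterSnd).eval I s = P g.snd := by
    simp [letterSnd, h4, h12, hr.letter]
  have p1 := h.pow g.fst g.fst.isLt
  have p2 := h.pow g.snd g.snd.isLt
  refine .seq <| .setCell
    (code P - P g.fst * 4 ^ (g.fst : ℕ) - P g.snd * 4 ^ (g.snd : ℕ)) le_rfl ?_ ?_
  · simp only [NExpr.eval_sub, NExpr.eval_read, NExpr.eval_add, NExpr.eval_cell,
      NExpr.eval_qubits, lf, ls, h4, hr.code, h17, h18]
    rw [p1 _ (P g.fst).isLt, p2 _ (P g.snd).isLt]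
  set c := code P - P g.fst * 4 ^ (g.fst : ℕ) - P g.snd * 4 ^ (g.snd : ℕ) with hc
  set s' : Mem := ⟨Function.update s.nat 13 c, s.real⟩ with hs'
  have hs : ∀ x, x ≠ 13 → s'.nat x = s.nat x := fun x hx => Function.update_of_ne hx _ _
  have lf' : (letterFst).eval I s' = P g.fst := by
    rw [← lf]
    simp only [letterFst, NExpr.eval_read, NExpr.eval_add, NExpr.eval_cell]
    rw [hs 4 (by omega), hs 11 (by omega), hs _ (by omega)]
  have ls' : (letterSnd).eval I s' = P g.snd := by
    rw [← ls]
    simp only [letterSnd, NExpr.eval_read, NExpr.eval_add, NExpr.eval_cell]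
    rw [hs 4 (by omega), hs 12 (by omega), hs _ (by omega)]
  refine .setReal_eq (s.nat 7 + 4 ^ n + code P) (g.noisyStep I.rate v P) le_rfl ?_ ?_ ⟨hs, rfl⟩
  · simp only [NExpr.eval_read, NExpr.eval_add, NExpr.eval_cell, NExpr.eval_qubits]
    rw [hs 4 (by omega), hs 8 (by omega), hs _ (by omega), h4, h8, hr.code]
  · simp only [RExpr.eval_sum, List.map_map, letterPairs, sum_product_finRange]
    simp only [Gate.noisyStep, damp_apply, Gate.conjStep, Fintype.sum_prod_type, Finset.mul_sum,
      Function.comp_def]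
    refine Finset.sum_congr rfl fun a _ => Finset.sum_congr rfl fun b _ => ?_
    have e1 : s'.real (256 + 64 * a + 16 * b + (P g.fst + P g.fst + (P g.fst + P g.fst))
        + P g.snd : ℕ) = letterFactor I.rate (P g.snd) * letterFactor I.rate (P g.fst)
          * g.ptm a b (P g.fst) (P g.snd) := by
      exact (congrArg s.real (by omega)).trans (hp a b _ _)
    simp only [termExpr, RExpr.eval_mul, RExpr.eval_read, NExpr.eval_read, NExpr.eval_add,
      NExpr.eval_cell, NExpr.eval_const, lf', ls', e1]
    rw [hs 7 (by omega), hs 17 (by omega), hs 18 (by omega), h17, h18,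
      show s'.nat 13 = c by simp [hs'], hs (1024 + 4 * g.fst + a) (by omega),
      hs (1024 + 4 * g.snd + b) (by omega), p1 _ a.isLt, p2 _ b.isLt, hc, code_setTwo g.ne, show s'.real = s.real from rfl, hv]
    ring

open NExpr Prog in
/-- Update the table for the current gate. -/
def gateStep : Prog :=
  .seq storePtm <|
  .seq (setCell 11 (gateFst (cell 9) (cell 10))) <|
  .seq (setCell 12 (gateSnd (cell 9) (cell 10))) <|
  .seq (setCell 17 (add (const 1024)
    (add (add (cell 11) (cell 11)) (add (cell 11) (cell 11))))) <|
  .seq (setCell 18 (add (const 1024)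
    (add (add (cell 12) (cell 12)) (add (cell 12) (cell 12))))) <|
  .seq (setCell 8 (add (cell 7) (cell 1))) <|
  .seq (forRecords updateCoeff) <|
  .seq (setCell 7 (cell 8)) (setCell 10 (add (cell 10) (const 1)))

/-- The new table lies right behind the old one, in cells never written before. The old coefficients
thus stay readable, and strings outside the list read as zero, which is precisely the truncation. A
table spans 4^n addresses, but only the entries of the list are written, so the time depends on the
length of the list. -/
theorem wp_gateStep {n : ℕ} {I : Input n} {L : List (PStr n)} {v : PStr n → ℝ} {s : Mem}
    {g : Gate n} {t k : ℕ} (h : Holds I L v s) (h9 : s.nat 9 = t) (h10 : s.nat 10 = k)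
    (hg : I.circuit.gate? t k = some g) :
    WP I gateStep s (L.length + 1) fun s' =>
      Holds I L (fun Q => if Q ∈ L then g.noisyStep I.rate v Q else 0) s' ∧
      s'.nat 9 = t ∧ s'.nat 10 = k + 1 := by
  have hm : 1 ≤ L.length + 1 := by omega
  have hpos : 0 < 4 ^ n := by positivity
  have hrl := le_recAddr n L.length
  have hb := h.base
  refine .seq <| (wp_storePtm (g := g) (by rw [h9, h10, hg]) hm).imp ?_
  rintro s1 ⟨c1, c2, c3⟩
  have hB : Built I L s1 := h.built.congr (fun _ _ => by rw [c1]) (fun _ _ _ => by rw [c1])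
    fun x hx _ => c3 x (Or.inr hx)
  have i9 : s1.nat 9 = t := by rw [c1, h9]
  have i10 : s1.nat 10 = k := by rw [c1, h10]
  have i7 : s1.nat 7 = s.nat 7 := by rw [c1]
  refine .seq <| .setCell (g.fst : ℕ) hm (by simp [NExpr.eval, i9, i10, hg]) <|
    .seq <| .setCell (g.snd : ℕ) hm (by simp [NExpr.eval, NExpr.cell, i9, i10, hg]) <|
    .seq <| .setCell (1024 + 4 * g.fst) hm (by simp; omega) <|
    .seq <| .setCell (1024 + 4 * g.snd) hm (by simp; omega) <|
    .seq <| .setCell (s.nat 7 + 4 ^ n) hm (by simp [i7, hB.top]) <| .seq ?_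
  refine (wp_forRecords_write (b := s.nat 7 + 4 ^ n) (g.noisyStep I.rate v)
    (((((hB.setCell 11 _).setCell 12 _).setCell 17 _).setCell 18 _).setCell 8 _)
    (le_add_right h.base) (fun x hx => ?_) ?_).imp ?_
  · have : s1.real x = s.real x := c3 x (Or.inr (by omega))
    exact this.trans (h.rest x hx)
  · intro k' hk' s' hs' h4 hn hr
    have j7 : s'.nat 7 = s.nat 7 := by simp [hn, i7]
    have := wp_updateCoeff (v := v) (g := g) hk' hs' h4 (by simp [hn, i7]) (by simp [hn])
      (by simp [hn]) (by simp [hn]) (by simp [hn]) (fun Q => ?_) (fun a b p q => ?_)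
    · rwa [j7] at this
    · have hQ := code_lt Q
      rw [j7, hr _ (by omega), ← h.table Q]
      exact c3 _ (Or.inr (by omega))
    · rw [hr _ (by omega), ← c2]
  · rintro s2 ⟨d1, d2, d3, d4, d5⟩
    have j8 : s2.nat 8 = s.nat 7 + 4 ^ n := by simp [d2]
    refine .seq <| .setCell (s.nat 7 + 4 ^ n) hm (by simp [j8]) <|
      .setCell (k + 1) hm (by simp [d2, i10]) ?_
    refine ⟨⟨(d1.setCell 7 _).setCell 10 _, ?_, ?_, ?_, ?_⟩, by simp [d2, i9], by simp⟩
    · simpa using le_add_right h.base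
    · simpa using d4
    · simpa using d5
    · show s2.real 0 = 0
      rw [d3 0 (by omega)]
      exact (c3 0 (Or.inl (by omega))).trans h.output

/-! ### The whole circuit -/

open NExpr Prog in
/-- Process all gates of the layer in cell `9`. -/
def layerStep : Prog :=
  .seq (setCell 10 (const 0)) <|
  .seq (.whileLt (cell 10) (gateCount (cell 9)) gateStep) (setCell 9 (add (cell 9) (const 1)))

/-- The first qubits of the gates are pairwise distinct. -/
theorem Layer.length_gates_le {n : ℕ} (L : Layer n) : L.gates.length ≤ n := by
  have h : (L.gates.map Gate.fst).Nodup := by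
    rw [List.Nodup, List.pairwise_map]
    exact L.disjoint.imp fun h => h.1
  simpa using h.length_le_card

theorem wp_layerStep {n : ℕ} {I : Input n} {L : List (PStr n)} {v : PStr n → ℝ} {s : Mem}
    {t : ℕ} (ht : t < List.length I.circuit) (h : Holds I L v s) (h9 : s.nat 9 = t) :
    WP I layerStep s ((n + 1) * (L.length + 1)) fun s' =>
      Holds I L (I.circuit[t].gates.foldl
        (fun v g Q => if Q ∈ L then g.noisyStep I.rate v Q else 0) v) s' ∧ s'.nat 9 = t + 1 := by
  set G := I.circuit[t].gates with hG
  have hlen : G.length ≤ n := I.circuit[t].length_gates_le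
  have hm : 1 ≤ (n + 1) * (L.length + 1) := Nat.mul_pos (by omega) (by omega)
  have hcount : ∀ s' : Mem, s'.nat 9 = t → (NExpr.gateCount (.cell 9)).eval I s' = G.length := by
    intro s' hs'
    simp [NExpr.eval, NExpr.cell, hs', ht, hG]
  refine .seq <| .setCell 0 hm rfl <| .seq ?_
  refine (WP.while (fun k s' =>
      Holds I L ((G.take k).foldl
        (fun v g Q => if Q ∈ L then g.noisyStep I.rate v Q else 0) v) s' ∧
      s'.nat 9 = t ∧ s'.nat 10 = k) G.length (m := L.length + 1) (by omega)
      (Nat.mul_le_mul_right _ (by omega)) ⟨h.setCell 10 _, by simp [h9], by simp⟩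
      ?_ ?_ ?_).imp ?_
  · rintro k hk s' ⟨-, i1, i2⟩
    rw [hcount s' i1]
    simpa [i2] using hk
  · rintro k hk s' ⟨i1, i2, i3⟩
    refine (wp_gateStep (g := G[k]) i1 i2 i3 ?_).imp ?_
    · simp [Circuit.gate?, ht, ← hG, hk]
    · rintro s'' ⟨d1, d2, d3⟩
      rw [← List.take_append_getElem hk, List.foldl_append]
      exact ⟨d1, d2, d3⟩
  · rintro s' ⟨-, i1, i2⟩
    rw [hcount s' i1]
    simp [i2]
  · rintro s' ⟨i1, i2, -⟩
    rw [List.take_length] at i1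
    exact .setCell (t + 1) hm (by simp [i2]) ⟨i1.setCell 9 _, by simp⟩

open NExpr Prog in
/-- Process all layers. -/
def circuitStep : Prog :=
  .seq (setCell 9 (const 0)) <| .whileLt (cell 9) depth layerStep

theorem wp_circuitStep {n : ℕ} {I : Input n} {L : List (PStr n)} {v : PStr n → ℝ} {s : Mem}
    (h : Holds I L v s) :
    WP I circuitStep s ((List.length I.circuit + 1) * ((n + 1) * (L.length + 1))) <|
      Holds I L (I.circuit.gates.foldl
        (fun v g Q => if Q ∈ L then g.noisyStep I.rate v Q else 0) v) := by
  have hm0 : 1 ≤ (n + 1) * (L.length + 1) := Nat.mul_pos (by omega) (by omega)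
  have hm : 1 ≤ (List.length I.circuit + 1) * ((n + 1) * (L.length + 1)) :=
    Nat.mul_pos (by omega) hm0
  refine .seq <| .setCell 0 hm rfl ?_
  refine (WP.while (fun t s' =>
      Holds I L ((Circuit.gates (I.circuit.take t)).foldl
        (fun v g Q => if Q ∈ L then g.noisyStep I.rate v Q else 0) v) s' ∧ s'.nat 9 = t)
      (List.length I.circuit) hm0 le_rfl ⟨h.setCell 9 _, by simp⟩ ?_ ?_ ?_).imp ?_
  · rintro t ht s' ⟨-, i1⟩
    simpa [i1] using ht
  · rintro t ht s' ⟨i1, i2⟩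
    refine (wp_layerStep ht i1 i2).imp ?_
    rintro s'' ⟨d1, d2⟩
    rw [← List.take_append_getElem ht, Circuit.gates, List.flatMap_append, List.flatMap_singleton,
      List.foldl_append]
    exact ⟨d1, d2⟩
  · rintro s' ⟨-, i1⟩
    simp [i1]
  · rintro s' ⟨i1, -⟩
    rwa [List.take_length] at i1

open NExpr Prog in
/-- Pair the table with the coefficients of the state. -/
def outputStep : Prog :=
  forRecords <| .setReal (const 0) (.add (.read (const 0))
    (.mul (.read (add (cell 7) (read (add (cell 4) qubits)))) (.stateCoeff (cell 4))))

theorem wp_outputStep {n : ℕ} {I : Input n} {L : List (PStr n)} (hL : L.Nodup) {v : PStr n → ℝ}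
    (hv : ∀ Q, Q ∉ L → v Q = 0) {s : Mem} (h : Holds I L v s) :
    WP I outputStep s (L.length + 1) fun s' =>
      s'.real 0 = ∑ P, v P * expectation I.state (pauli P) := by
  have hb := h.base
  have hrl := le_recAddr n L.length
  refine (wp_forRecords (fun k s' => s'.nat 7 = s.nat 7 ∧ (∀ x, x ≠ 0 → s'.real x = s.real x) ∧
    s'.real 0 = ((L.take k).map fun P => v P * expectation I.state (pauli P)).sum) h.built
    ⟨rfl, fun _ _ => rfl, by simpa using h.output⟩ ?_ ?_).imp ?_
  · rintro k s' x ⟨i1, i2, i3⟩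
    exact ⟨by simpa using i1, i2, i3⟩
  · rintro k hk s' hs' h4 ⟨i1, i2, i3⟩
    have hr := hs'.record k hk
    refine .setReal_eq 0 (s'.real 0 + v L[k] * expectation I.state (pauli L[k])) le_rfl rfl ?_ ?_
    · simp only [RExpr.eval_add, RExpr.eval_read, RExpr.eval_mul, NExpr.eval_const,
        NExpr.eval_add, NExpr.eval_cell, NExpr.eval_read, NExpr.eval_qubits, h4, hr.code, i1]
      rw [i2 (s.nat 7 + _) (by omega), h.table]
      simp only [RExpr.eval, NExpr.eval_cell, h4, hr.pauliAt]
    · refine ⟨hs'.congr (fun _ _ => rfl) (fun _ _ _ => rfl) fun x hx _ => ?_, rfl, i1,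
        fun x hx => ?_, ?_⟩
      · exact Function.update_of_ne (by omega) _ _
      · exact (Function.update_of_ne hx _ _).trans (i2 x hx)
      · rw [← List.take_append_getElem hk, List.map_append, List.sum_append, ← i3]
        simp
  · rintro s' ⟨-, -, -, i3⟩
    rw [i3, List.take_length, ← List.sum_toFinset _ hL]
    refine Finset.sum_subset (Finset.subset_univ _) fun P _ hP => ?_
    rw [hv P (by simpa using hP), zero_mul]

/-- The simulation algorithm: the evolution of the Pauli coefficients of the observable, truncated
to low weight after every gate. The weight threshold is parameter `0`; the damping parameter is
the quotient of the parameters `1` and `2`. -/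
def pauliPropagation : Prog :=
  .seq powers <| .seq buildList <| .seq initTable <| .seq circuitStep outputStep

theorem trunc_eq_ite_mem {n : ℕ} (ℓ : ℕ) (v : PStr n → ℝ) :
    (fun Q => if Q ∈ strings n ℓ n then v Q else 0) = trunc ℓ v := by
  funext Q
  simp only [mem_strings_self, trunc]

theorem outputsWithin_pauliPropagation {n : ℕ} (I : Input n) :
    OutputsWithin pauliPropagation I
      (pauliPropagation.size * ((List.length I.circuit + 1) * (n + 3) ^ 2 *
        ((4 * n + 1) ^ I.param 0 + 1)))
      (∑ P, truncEvolve I.rate (I.param 0) I.circuit (pauliCoeff I.obs) P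
        * expectation I.state (pauli P)) := by
  set ℓ := I.param 0 with hℓ
  set L := strings n ℓ n with hL
  have hN : L.length ≤ (4 * n + 1) ^ ℓ := length_strings_le n ℓ
  have hstep : (fun (v : PStr n → ℝ) (g : Gate n) Q => if Q ∈ L then g.noisyStep I.rate v Q else 0)
      = fun v g => trunc ℓ (g.noisyStep I.rate v) :=
    funext fun v => funext fun g => trunc_eq_ite_mem _ _
  set M := (List.length I.circuit + 1) * (n + 3) ^ 2 * ((4 * n + 1) ^ ℓ + 1) with hM
  have m5 : L.length + 1 ≤ (4 * n + 1) ^ ℓ + 1 := by omega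
  have m3 : (List.length I.circuit + 1) * ((n + 1) * (L.length + 1)) ≤ M := by
    rw [hM, Nat.mul_assoc]
    exact Nat.mul_le_mul_left _ (Nat.mul_le_mul (by nlinarith) m5)
  have m4 : (n + 1) * ((L.length + 1) * (n + 3)) ≤ M := by
    calc _ = 1 * ((n + 1) * (n + 3)) * (L.length + 1) := by ring
      _ ≤ M := Nat.mul_le_mul (Nat.mul_le_mul (by omega) (by nlinarith)) m5
  have m1 : n + 1 ≤ M := by
    calc n + 1 = 1 * (n + 1) * 1 := by ring
      _ ≤ M := Nat.mul_le_mul (Nat.mul_le_mul (by omega) (by nlinarith)) (by omega)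
  have m2 : L.length + 1 ≤ M := by
    calc L.length + 1 = 1 * 1 * (L.length + 1) := by ring
      _ ≤ M := Nat.mul_le_mul (Nat.mul_le_mul (by omega) (by nlinarith)) m5
  have main : WP I pauliPropagation Mem.init M fun s' => s'.real 0 =
      ∑ P, truncEvolve I.rate ℓ I.circuit (pauliCoeff I.obs) P
        * expectation I.state (pauli P) := by
    refine .seq <| (wp_powers I).mono m1 ?_
    rintro s1 ⟨a1, a2⟩
    refine .seq <| (wp_buildList a1 a2).mono m4 ?_
    rintro s2 ⟨b1, b2⟩
    refine .seq <| (wp_initTable b1 b2).mono m2 fun s3 c1 => ?_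
    refine .seq <| (wp_circuitStep c1).mono m3 fun s4 d1 => ?_
    rw [hstep, trunc_eq_ite_mem] at d1
    refine (wp_outputStep (nodup_strings le_rfl) ?_ d1).mono m2 fun s5 f1 => f1
    intro Q hQ
    have hzero : ∀ w : PStr n → ℝ, trunc ℓ w Q = 0 := fun w => by
      rw [← trunc_eq_ite_mem]; exact if_neg hQ
    -- The final vector is truncated in either case: by the last gate or, without gates, by the
    -- initialization.
    rcases List.eq_nil_or_concat' I.circuit.gates with e | ⟨l, g, e⟩
    · rw [e]; exact hzero _
    · rw [e, List.foldl_append]; exact hzero _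
  obtain ⟨t, ht, s', he, hs⟩ := main
  exact ⟨t, ht, s', he, hs⟩

/-! ### The simulation of a noisy experiment -/

theorem Circuit.length_gates_le {n : ℕ} (C : Circuit n) :
    C.gates.length ≤ n * List.length C := by
  induction C with
  | nil => simp [Circuit.gates]
  | cons L C ih =>
    have := L.length_gates_le
    simp only [Circuit.gates, List.flatMap_cons, List.length_append, List.length_cons] at ih ⊢
    rw [Nat.mul_add]
    omega

/-- The running time of the simulation with weight threshold `ℓ n`. -/
def simulationTime (E : Experiment) (ℓ : ℕ → ℕ) (n : ℕ) : ℕ :=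
  pauliPropagation.size * ((List.length (E.circuit n) + 1) * (n + 3) ^ 2 *
    ((4 * n + 1) ^ ℓ n + 1))

theorem Experiment.computes_of_truncValue {E : Experiment} {ε : ℕ → ℝ} (A : ClassicalAlgorithm)
    (hA : A.prog = pauliPropagation)
    (h : ∀ n, rootMeanSquare (fun i => E.truncValue n (A.param n 1 / A.param n 2) (A.param n 0) i
      - E.idealValue n i) ≤ ε n) :
    E.Computes A ε (simulationTime E fun n => A.param n 0) := fun n =>
  ⟨_, fun i => by rw [hA]; exact outputsWithin_pauliPropagation (E.input A n i), h n⟩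

/-- The exponent 2a + 3 is chosen as (a+1) + a + 2: there are at most n^(a+1) gates, n^(-a) is at
most the target error `e`, and the spare n^(-2) absorbs the constants √c and 1 - θ. Since `q` is
rounded down, q^(ℓ+1) is still at most exp(-γ(ℓ+1)). -/
theorem Experiment.LowAverage.rootMeanSquare_truncValue_le {E : Experiment} {c θ γ e q : ℝ}
    {a n ℓ : ℕ} (hE : E.LowAverage c) (hn : 1 ≤ n) (he : 0 < e)
    (hd : (List.length (E.circuit n) : ℝ) ≤ (n : ℝ) ^ a) (hε : e⁻¹ ≤ (n : ℝ) ^ a)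
    (hc : 5 * Real.sqrt c ≤ (1 - θ) * (n : ℝ) ^ 2) (hγ : 0 < γ)
    (hs : E.NoisySucceeds n γ (θ * e)) (h0 : 0 ≤ q) (hq : q ≤ Real.exp (-γ))
    (hq' : Real.exp (-γ) - q ≤ ((n : ℝ) ^ (2 * a + 3))⁻¹)
    (hℓ : (2 * a + 3 : ℕ) * Real.log n ≤ γ * (ℓ + 1)) :
    rootMeanSquare (fun i => E.truncValue n q ℓ i - E.idealValue n i) ≤ e := by
  have hn' : (1 : ℝ) ≤ n := by exact_mod_cast hn
  have hn0 : (0 : ℝ) < n := by linarith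
  set x : ℝ := (n : ℝ) with hx
  have h1 := hE.truncValue_sub_noisyValue n ℓ hγ.le h0 hq
  have h2 := rootMeanSquare_add_le (fun i => E.truncValue n q ℓ i - E.noisyValue n γ i)
    (fun i => E.noisyValue n γ i - E.idealValue n i)
  simp only [sub_add_sub_cancel] at h2
  have hG : ((E.circuit n).gates.length : ℝ) ≤ x ^ (a + 1) := by
    have : ((E.circuit n).gates.length : ℝ) ≤ x * List.length (E.circuit n) := by
      rw [hx]
      exact_mod_cast (E.circuit n).length_gates_le
    rw [pow_succ']
    exact this.trans (mul_le_mul_of_nonneg_left hd hn0.le)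
  have hpow : q ^ (ℓ + 1) ≤ (x ^ (2 * a + 3))⁻¹ := by
    calc q ^ (ℓ + 1) ≤ Real.exp (-γ) ^ (ℓ + 1) := pow_le_pow_left₀ h0 hq _
      _ = Real.exp (-(γ * (ℓ + 1))) := by rw [← Real.exp_nat_mul]; push_cast; ring_nf
      _ ≤ Real.exp (-((2 * a + 3 : ℕ) * Real.log x)) := Real.exp_le_exp.2 (neg_le_neg hℓ)
      _ = (x ^ (2 * a + 3))⁻¹ := by
        rw [Real.exp_neg, ← Real.log_pow, Real.exp_log (by positivity)]
  have hx1 : x ≤ x ^ (a + 1) := le_self_pow₀ hn' (by omega)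
  -- The constant is 5 = 2 + 3, from G + 1 ≤ 2n^(a+1) and n + 2G ≤ 3n^(a+1).
  have h3 : (((E.circuit n).gates.length : ℝ) + 1) * q ^ (ℓ + 1)
      + (x + 2 * (E.circuit n).gates.length) * (Real.exp (-γ) - q)
      ≤ 5 * x ^ (a + 1) * (x ^ (2 * a + 3))⁻¹ := by
    have e1 : (((E.circuit n).gates.length : ℝ) + 1) * q ^ (ℓ + 1)
        ≤ (2 * x ^ (a + 1)) * (x ^ (2 * a + 3))⁻¹ :=
      mul_le_mul (by linarith) hpow (by positivity) (by positivity)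
    have e2 : (x + 2 * (E.circuit n).gates.length) * (Real.exp (-γ) - q)
        ≤ (3 * x ^ (a + 1)) * (x ^ (2 * a + 3))⁻¹ :=
      mul_le_mul (by linarith) hq' (by linarith) (by positivity)
    linarith
  have h4 : Real.sqrt c * (5 * x ^ (a + 1) * (x ^ (2 * a + 3))⁻¹) ≤ (1 - θ) * e := by
    have hθ : 0 ≤ 1 - θ := by
      have : 0 ≤ (1 - θ) * x ^ 2 := le_trans (by positivity) hc
      exact nonneg_of_mul_nonneg_left this (by positivity)
    have e1 : Real.sqrt c * (5 * x ^ (a + 1) * (x ^ (2 * a + 3))⁻¹)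
        = (5 * Real.sqrt c) * (x ^ 2)⁻¹ * (x ^ a)⁻¹ := by
      have : x ^ (2 * a + 3) = x ^ (a + 1) * (x ^ 2 * x ^ a) := by ring
      rw [this]
      field_simp
    rw [e1]
    have e2 : (5 * Real.sqrt c) * (x ^ 2)⁻¹ ≤ 1 - θ := by
      rw [← div_eq_mul_inv, div_le_iff₀ (by positivity)]
      exact hc
    exact mul_le_mul e2 (inv_le_of_inv_le₀ he hε) (by positivity) hθ
  have h5 := mul_le_mul_of_nonneg_left h3 (Real.sqrt_nonneg c)
  have h6 : rootMeanSquare (fun i => E.noisyValue n γ i - E.idealValue n i) ≤ θ * e := hs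
  linarith

/-- Noise rates at which the noisy implementation succeeds bound the classical complexity. -/
theorem Experiment.ClassicallyHard.bound {E : Experiment} {c θ : ℝ} {ε χ : ℕ → ℝ} {a : ℕ}
    (hE : E.LowAverage c) (hθ : θ < 1) (hε : ∀ n, 0 < ε n)
    (hpoly : ∀ᶠ n : ℕ in atTop, ((List.length (E.circuit n) : ℕ) : ℝ) ≤ (n : ℝ) ^ a ∧
      (ε n)⁻¹ ≤ (n : ℝ) ^ a)
    (hard : E.ClassicallyHard ε χ) (R : ℕ → ℝ → Prop) :
    ∃ M : ℝ, 1 ≤ M ∧ ∀ᶠ n : ℕ in atTop,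
      (∃ γ, 0 < γ ∧ E.NoisySucceeds n γ (θ * ε n) ∧ R n γ) →
      ∃ γ, 0 < γ ∧ R n γ ∧
        χ n ≤ M * (n : ℝ) ^ (a + 8 + 4 * ⌊(2 * a + 3 : ℕ) * Real.log n / γ⌋₊) := by
  classical
  -- The algorithm must be correct for every `n`, not only for large ones. Where this condition
  -- fails it receives the parameters of an exact simulation; the runtime there is irrelevant,
  -- because the conclusion concerns only the other `n`.
  let good : ℕ → Prop := fun n => 2 ≤ n ∧ ((List.length (E.circuit n) : ℕ) : ℝ) ≤ (n : ℝ) ^ a ∧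
    (ε n)⁻¹ ≤ (n : ℝ) ^ a ∧ 5 * Real.sqrt c ≤ (1 - θ) * (n : ℝ) ^ 2 ∧
    ∃ γ, 0 < γ ∧ E.NoisySucceeds n γ (θ * ε n) ∧ R n γ
  have hgood : ∀ n, ∃ γ, good n → 0 < γ ∧ E.NoisySucceeds n γ (θ * ε n) ∧ R n γ := by
    intro n
    by_cases h : good n
    · obtain ⟨-, -, -, -, γ, hγ⟩ := h
      exact ⟨γ, fun _ => hγ⟩
    · exact ⟨0, fun h' => absurd h' h⟩
  choose γ hγ using hgood
  let ℓ : ℕ → ℕ := fun n => ⌊(2 * a + 3 : ℕ) * Real.log n / γ n⌋₊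
  -- Parameters `1` and `2` encode exp(-γ) rounded down to a multiple of n^(-(2a+3)).
  let param : ℕ → ℕ → ℕ := fun n j =>
    if good n then
      if j = 0 then min n (ℓ n)
      else if j = 1 then ⌊Real.exp (-γ n) * (n : ℝ) ^ (2 * a + 3)⌋₊ else n ^ (2 * a + 3)
    else if j = 0 then n else 1
  have hparam : ∀ n j, param n j ≤ n ^ (2 * a + 3) + (2 * a + 3) := by
    intro n j
    have hn : n ≤ n ^ (2 * a + 3) := Nat.le_self_pow (by omega) n
    simp only [param]
    split_ifs with h h1 h2 h3
    · exact (min_le_left _ _).trans (by omega)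
    · refine le_trans (Nat.floor_le_of_le ?_) (Nat.le_add_right _ _)
      have : Real.exp (-γ n) ≤ 1 := Real.exp_le_one_iff.2 (by linarith [(hγ n h).1])
      push_cast
      exact mul_le_of_le_one_left (by positivity) this
    · omega
    · omega
    · omega
  let A : ClassicalAlgorithm := ⟨pauliPropagation, param, 2 * a + 3, hparam⟩
  have hA : E.Computes A ε (simulationTime E fun n => A.param n 0) := by
    refine Experiment.computes_of_truncValue A rfl fun n => ?_
    by_cases h : good n
    · have e0 : A.param n 0 = min n (ℓ n) := by simp [A, param, h]
      have e1 : A.param n 1 = ⌊Real.exp (-γ n) * (n : ℝ) ^ (2 * a + 3)⌋₊ := by simp [A, param, h]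
      have e2 : A.param n 2 = n ^ (2 * a + 3) := by simp [A, param, h]
      have hval : ∀ q i, E.truncValue n q (min n (ℓ n)) i = E.truncValue n q (ℓ n) i := by
        intro q i
        simp only [Experiment.truncValue, truncEvolve_min]
      simp only [e0, hval]
      obtain ⟨hγ0, hs, -⟩ := hγ n h
      obtain ⟨hn, hd, hi, hc, -⟩ := h
      have hnpos : (0 : ℝ) < (n : ℝ) ^ (2 * a + 3) := by positivity
      have hf := Nat.floor_le (a := Real.exp (-γ n) * (n : ℝ) ^ (2 * a + 3)) (by positivity)
      have hf' := Nat.lt_floor_add_one (Real.exp (-γ n) * (n : ℝ) ^ (2 * a + 3))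
      refine hE.rootMeanSquare_truncValue_le (by omega) (hε n) hd hi hc hγ0 hs (by positivity)
        ?_ ?_ ?_
      · rw [e1, e2]
        push_cast
        rwa [div_le_iff₀ hnpos]
      · rw [e1, e2]
        push_cast
        rw [sub_le_iff_le_add, ← one_div, ← add_div, le_div_iff₀ hnpos]
        linarith
      · rw [mul_comm (γ n), ← div_le_iff₀ hγ0]
        exact (Nat.lt_floor_add_one _).le
    · have e0 : A.param n 0 = n := by simp [A, param, h]
      have e1 : A.param n 1 = 1 := by simp [A, param, h]
      have e2 : A.param n 2 = 1 := by simp [A, param, h]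
      rw [e0, e1, e2]
      simp only [Nat.cast_one, div_one, Experiment.truncValue_exact, sub_self]
      simpa [rootMeanSquare] using (hε n).le
  obtain ⟨M, hM⟩ := hard A _ hA
  have hlarge : ∀ᶠ n : ℕ in atTop, 5 * Real.sqrt c ≤ (1 - θ) * (n : ℝ) ^ 2 := by
    have : Tendsto (fun n : ℕ => (1 - θ) * (n : ℝ) ^ 2) atTop atTop :=
      ((tendsto_pow_atTop two_ne_zero).comp tendsto_natCast_atTop_atTop).const_mul_atTop
        (by linarith)
    exact this.eventually_ge_atTop _
  -- The constant from hardness might be negative; the maximum and the added 1 make the new one at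
  -- least 1.
  refine ⟨max 1 M * pauliPropagation.size + 1, ?_, ?_⟩
  · have : 0 ≤ max 1 M * (pauliPropagation.size : ℝ) := by positivity
    linarith
  · filter_upwards [hM, hlarge, hpoly, eventually_ge_atTop 2] with n h1 h2 h3 hn hex
    have hg : good n := ⟨hn, h3.1, h3.2, h2, hex⟩
    refine ⟨γ n, (hγ n hg).1, (hγ n hg).2.2, ?_⟩
    have hℓ : (fun n => A.param n 0) n ≤ ℓ n := by
      simp only [A, param, if_pos hg]
      exact min_le_right _ _
    have hd : List.length (E.circuit n) ≤ n ^ a := by exact_mod_cast h3.1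
    -- The exponent adds up as a + 1 from the depth, 6 from (n + 3)² and 4ℓ + 1 from the number of
    -- strings.
    have hT : simulationTime E (fun n => A.param n 0) n
        ≤ pauliPropagation.size * n ^ (a + 8 + 4 * ℓ n) := by
      refine Nat.mul_le_mul_left _ ?_
      have p1 : n ^ a + 1 ≤ n ^ (a + 1) := by
        have : 1 ≤ n ^ a := Nat.one_le_pow _ _ (by omega)
        rw [pow_succ]; nlinarith
      have p2 : n + 3 ≤ n ^ 3 := by nlinarith [Nat.pow_le_pow_left hn 2]
      have p3 : 4 * n + 1 ≤ n ^ 4 := by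
        nlinarith [Nat.pow_le_pow_left hn 2, Nat.pow_le_pow_left hn 3]
      have p4 : (4 * n + 1) ^ ((fun n => A.param n 0) n) + 1 ≤ n ^ (4 * ℓ n + 1) := by
        have q1 : (4 * n + 1) ^ ((fun n => A.param n 0) n) ≤ n ^ (4 * ℓ n) := by
          calc _ ≤ (4 * n + 1) ^ ℓ n := Nat.pow_le_pow_right (by omega) hℓ
            _ ≤ (n ^ 4) ^ ℓ n := Nat.pow_le_pow_left p3 _
            _ = n ^ (4 * ℓ n) := (pow_mul _ _ _).symm
        have q2 : 1 ≤ n ^ (4 * ℓ n) := Nat.one_le_pow _ _ (by omega)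
        rw [pow_succ]; nlinarith
      calc _ ≤ n ^ (a + 1) * (n ^ 3) ^ 2 * n ^ (4 * ℓ n + 1) :=
            Nat.mul_le_mul (Nat.mul_le_mul ((Nat.add_le_add_right hd 1).trans p1)
              (Nat.pow_le_pow_left p2 2)) p4
        _ = n ^ (a + 8 + 4 * ℓ n) := by ring
    have hT' : (simulationTime E (fun n => A.param n 0) n : ℝ)
        ≤ pauliPropagation.size * (n : ℝ) ^ (a + 8 + 4 * ℓ n) := by exact_mod_cast hT
    calc χ n ≤ M * (simulationTime E (fun n => A.param n 0) n : ℝ) := h1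
      _ ≤ max 1 M * (simulationTime E (fun n => A.param n 0) n : ℝ) :=
          mul_le_mul_of_nonneg_right (le_max_right _ _) (Nat.cast_nonneg _)
      _ ≤ max 1 M * (pauliPropagation.size * (n : ℝ) ^ (a + 8 + 4 * ℓ n)) :=
          mul_le_mul_of_nonneg_left hT' (by positivity)
      _ ≤ (max 1 M * pauliPropagation.size + 1) * (n : ℝ) ^ (a + 8 + 4 * ℓ n) := by
          have : (0 : ℝ) ≤ (n : ℝ) ^ (a + 8 + 4 * ℓ n) := by positivity
          linarith

/-- The bound on the noise rate, up to a multiple of `log n`. -/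
theorem Experiment.ClassicallyHard.noise_le {E : Experiment} {c θ : ℝ} {ε χ : ℕ → ℝ} {a : ℕ}
    (hE : E.LowAverage c) (hθ : θ < 1) (hε : ∀ n, 0 < ε n)
    (hpoly : ∀ᶠ n : ℕ in atTop, ((List.length (E.circuit n) : ℕ) : ℝ) ≤ (n : ℝ) ^ a ∧
      (ε n)⁻¹ ≤ (n : ℝ) ^ a)
    (hard : E.ClassicallyHard ε χ) (Γ : ℝ) :
    ∀ᶠ n : ℕ in atTop, 1 < χ n → ∀ γ : ℝ, 0 < γ → γ ≤ Γ * Real.log n →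
      E.NoisySucceeds n γ (θ * ε n) →
      γ ≤ (Γ * (a + 9) + 4 * (2 * a + 3)) * (Real.log n ^ 2 / Real.log (χ n)) := by
  -- The selected rates are counterexamples to the claim. The rate `g` obtained below may differ
  -- from the given γ, but it violates the same bound, which suffices for the contradiction.
  obtain ⟨M, hM1, hM⟩ := hard.bound hE hθ hε hpoly (fun n γ => γ ≤ Γ * Real.log n ∧
    ¬ γ ≤ (Γ * (a + 9) + 4 * (2 * a + 3)) * (Real.log n ^ 2 / Real.log (χ n)))
  have hlogM : ∀ᶠ n : ℕ in atTop, Real.log M ≤ Real.log n :=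
    (Real.tendsto_log_atTop.comp tendsto_natCast_atTop_atTop).eventually_ge_atTop _
  filter_upwards [hM, hlogM, eventually_ge_atTop 2] with n h1 h2 hn hχ γ hγ hγΓ hs
  by_contra hlt
  obtain ⟨g, hg, ⟨hgΓ, hlt⟩, hχM⟩ := h1 ⟨γ, hγ, hs, hγΓ, hlt⟩
  apply hlt
  set κ := ⌊(2 * a + 3 : ℕ) * Real.log n / g⌋₊ with hκ
  have hn0 : (0 : ℝ) < n := by positivity
  have hlog : 0 < Real.log n := Real.log_pos (by exact_mod_cast hn)
  have hlogχ : 0 < Real.log (χ n) := Real.log_pos hχ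
  have hκ' : g * κ ≤ (2 * a + 3) * Real.log n := by
    have h := Nat.floor_le (a := (2 * a + 3 : ℕ) * Real.log n / g) (by positivity)
    rw [← hκ, le_div_iff₀ hg] at h
    push_cast at h
    linarith
  -- The constant `M` is absorbed by one further log n, which turns a + 8 into a + 9.
  have hle : Real.log (χ n) ≤ Real.log n + (a + 8 + 4 * κ) * Real.log n := by
    calc Real.log (χ n) ≤ Real.log (M * (n : ℝ) ^ (a + 8 + 4 * κ)) :=
          Real.log_le_log (by linarith) hχM
      _ = Real.log M + (a + 8 + 4 * κ) * Real.log n := by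
          rw [Real.log_mul (by linarith) (by positivity), Real.log_pow]
          push_cast
          ring
      _ ≤ _ := by linarith
  rw [← mul_div_assoc, le_div_iff₀ hlogχ]
  have h3 : g * Real.log (χ n) ≤ g * (Real.log n + (a + 8 + 4 * κ) * Real.log n) :=
    mul_le_mul_of_nonneg_left hle hg.le
  have h4 : g * ((a + 9) * Real.log n) ≤ (Γ * Real.log n) * ((a + 9) * Real.log n) :=
    mul_le_mul_of_nonneg_right hgΓ (by positivity)
  have h5 := mul_le_mul_of_nonneg_right hκ' hlog.le
  nlinarith

/-- For superpolynomial lower bounds, the noisy implementation only succeeds at noise rates up to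
`log n`. -/
theorem Experiment.ClassicallyHard.noise_le_log {E : Experiment} {c θ : ℝ} {ε χ : ℕ → ℝ} {a : ℕ}
    (hE : E.LowAverage c) (hθ : θ < 1) (hε : ∀ n, 0 < ε n)
    (hpoly : ∀ᶠ n : ℕ in atTop, ((List.length (E.circuit n) : ℕ) : ℝ) ≤ (n : ℝ) ^ a ∧
      (ε n)⁻¹ ≤ (n : ℝ) ^ a)
    (hard : E.ClassicallyHard ε χ) (hχ : ∀ k : ℕ, ∀ᶠ n : ℕ in atTop, (n : ℝ) ^ k ≤ χ n) :
    ∀ᶠ n : ℕ in atTop, ∀ γ : ℝ, 0 < γ → E.NoisySucceeds n γ (θ * ε n) → γ ≤ Real.log n := by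
  obtain ⟨M, hM1, hM⟩ := hard.bound hE hθ hε hpoly (fun n γ => Real.log n < γ)
  filter_upwards [hM, hχ (a + 8 + 4 * (2 * a + 3) + 1), eventually_ge_atTop 1,
    tendsto_natCast_atTop_atTop.eventually_gt_atTop M] with n h1 h2 hn hnM γ hγ hs
  by_contra hlt
  obtain ⟨g, hg, hlog, hle⟩ := h1 ⟨γ, hγ, hs, not_le.1 hlt⟩
  have hn1 : (1 : ℝ) ≤ n := by exact_mod_cast hn
  -- A rate above log n leaves a bounded weight threshold, so the simulation would be polynomial.
  have hf : ⌊(2 * a + 3 : ℕ) * Real.log n / g⌋₊ ≤ 2 * a + 3 := by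
    refine Nat.floor_le_of_le ?_
    rw [div_le_iff₀ hg]
    exact mul_le_mul_of_nonneg_left hlog.le (Nat.cast_nonneg _)
  have h3 : M * (n : ℝ) ^ (a + 8 + 4 * ⌊(2 * a + 3 : ℕ) * Real.log n / g⌋₊)
      ≤ M * (n : ℝ) ^ (a + 8 + 4 * (2 * a + 3)) :=
    mul_le_mul_of_nonneg_left (pow_le_pow_right₀ hn1 (by omega)) (by linarith)
  have h4 : M * (n : ℝ) ^ (a + 8 + 4 * (2 * a + 3))
      < n * (n : ℝ) ^ (a + 8 + 4 * (2 * a + 3)) :=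
    mul_lt_mul_of_pos_right hnM (by positivity)
  rw [pow_succ'] at h2
  linarith

end

/-! ### The three bounds on the noise rate -/

theorem corollary2 (a : ℕ) (Γ : ℝ) :
    ∃ K : ℝ, 0 < K ∧
      ∀ (E : Experiment) (c θ : ℝ) (ε χ : ℕ → ℝ),
        E.LowAverage c →
        θ < 1 →
        (∀ n, 0 < ε n) →
        (∀ᶠ n in atTop, ((List.length (E.circuit n) : ℕ) : ℝ) ≤ (n : ℝ) ^ a ∧
          (ε n)⁻¹ ≤ (n : ℝ) ^ a) →
        E.ClassicallyHard ε χ →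
        -- noise rates up to a constant times `log n`, and any lower bound `χ`
        (∀ᶠ n : ℕ in atTop, 1 < χ n → ∀ γ : ℝ, 0 < γ → γ ≤ Γ * Real.log n →
          E.NoisySucceeds n γ (θ * ε n) →
          γ ≤ K * (Real.log n ^ 2 / Real.log (χ n))) ∧
        -- all noise rates, for a superpolynomial lower bound `χ`
        ((∀ k : ℕ, ∀ᶠ n : ℕ in atTop, (n : ℝ) ^ k ≤ χ n) →
          ∀ᶠ n : ℕ in atTop, ∀ γ : ℝ, 0 < γ →
            E.NoisySucceeds n γ (θ * ε n) →
            γ ≤ K * (Real.log n ^ 2 / Real.log (χ n))) ∧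
        -- all noise rates, for an exponential lower bound `χ`
        (∀ α : ℝ, 0 < α → (∀ᶠ n : ℕ in atTop, Real.exp (α * n) ≤ χ n) →
          ∀ᶠ n : ℕ in atTop, ∀ γ : ℝ, 0 < γ →
            E.NoisySucceeds n γ (θ * ε n) →
            γ ≤ K / α * (Real.log n ^ 2 / n)) := by
  -- The value 1 covers the rates up to log n that remain in the superpolynomial case, and keeps the
  -- constant positive for negative Γ.
  have hΓ : 0 < max Γ 1 := lt_max_of_lt_right one_pos
  have hK : 0 < max Γ 1 * ((a : ℝ) + 9) + 4 * (2 * a + 3) := by positivity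
  refine ⟨_, hK, fun E c θ ε χ hE hθ hε hpoly hard => ?_⟩
  set K := max Γ 1 * ((a : ℝ) + 9) + 4 * (2 * a + 3)
  have small := hard.noise_le hE hθ hε hpoly (max Γ 1)
  have super : (∀ k : ℕ, ∀ᶠ n : ℕ in atTop, (n : ℝ) ^ k ≤ χ n) →
      ∀ᶠ n : ℕ in atTop, ∀ γ : ℝ, 0 < γ → E.NoisySucceeds n γ (θ * ε n) →
        γ ≤ K * (Real.log n ^ 2 / Real.log (χ n)) := by
    intro hχ
    filter_upwards [small, hard.noise_le_log hE hθ hε hpoly hχ, hχ 1, eventually_ge_atTop 2]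
      with n h1 h2 h3 hn γ hγ hs
    have hn' : (2 : ℝ) ≤ n := by exact_mod_cast hn
    refine h1 (by linarith) γ hγ ((h2 γ hγ hs).trans ?_) hs
    exact le_mul_of_one_le_left (Real.log_nonneg (by linarith)) (le_max_right _ _)
  refine ⟨?_, super, fun α hα hχ => ?_⟩
  · filter_upwards [small, eventually_ge_atTop 1] with n h hn hχ γ hγ hγΓ hs
    refine h hχ γ hγ (hγΓ.trans ?_) hs
    exact mul_le_mul_of_nonneg_right (le_max_left _ _) (Real.log_natCast_nonneg n)
  · have hsup : ∀ k : ℕ, ∀ᶠ n : ℕ in atTop, (n : ℝ) ^ k ≤ χ n := by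
      intro k
      have h := ((isLittleO_pow_exp_pos_mul_atTop k hα).comp_tendsto
        tendsto_natCast_atTop_atTop).bound one_pos
      filter_upwards [h, hχ] with n h1 h2
      simp only [Function.comp_apply, one_mul, Real.norm_eq_abs, Real.abs_exp] at h1
      exact (le_abs_self _).trans (h1.trans h2)
    filter_upwards [super hsup, hχ, eventually_ge_atTop 1] with n h1 h2 hn γ hγ hs
    refine (h1 γ hγ hs).trans ?_
    have hn0 : (0 : ℝ) < n := by exact_mod_cast hn
    have hlog : α * n ≤ Real.log (χ n) := by
      rw [← Real.log_exp (α * n)]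
      exact Real.log_le_log (Real.exp_pos _) h2
    calc K * (Real.log n ^ 2 / Real.log (χ n)) ≤ K * (Real.log n ^ 2 / (α * n)) :=
          mul_le_mul_of_nonneg_left
            (div_le_div_of_nonneg_left (by positivity) (by positivity) hlog) hK.le
      _ = K / α * (Real.log n ^ 2 / n) := by field_simp
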